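/- **Setting.** Let $K\ge 1$, $P_k>0$, $\sigma_k>0$ and $\Omega_k=P_k/\sigma_k^2$ for $k=1,\dots,K$. For each $d\ge1$ put $n=Kd$ and consider $K$ parallel real AWGN channels with inputs and outputs made of $K$ blocks of length $d=n/K$: $y_k=x_k+w_k$, $w_k\sim\mathcal N(0,\sigma_k^2 I_d)$. Let $p_{y|x}$ be the transition density and let $p_y$ be the density of independent blocks $y_k\sim\mathcal N(0,\sigma_k^2(1+\Omega_k)I_d)$. Put $\Lambda(x,y)=\frac1n\ln\frac{p_{y|x}(y|x)}{p_y(y)}$ and $C=\frac1K\sum_k\frac12\log_2(1+\Omega_k)$. Let $x$ be a codeword with $\|x_k\|^2=\frac nK P_k$ for all $k$. For a normalized threshold $\lambda>0$ let $\tau_\lambda=\frac12(1+2\ln(2)\,C-\lambda)$ and $$P_{FA}(\lambda)=\mathbb P[\Lambda(x,y)\ge\tau_\lambda],\ y\sim p_y,\qquad P_{MD}(\lambda)=\mathbb P[\Lambda(x,y)<\tau_\lambda],\ y\sim p_{y|x}(\cdot|x).$$ Let (with principal logarithms) $$\alpha(s)=2\lambda s-\frac1K\sum_{k=1}^K\Big(\frac{2s(1+\Omega_k)}{1+2s\Omega_k}+\ln(1+2s\Omega_k)\Big),\qquad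 \beta(s)=\alpha(s+\tfrac12)+2\ln(2)\,C+1-\lambda,$$ $\mathcal S_\alpha=\{s:\Re s>-\frac1{2\Omega_k}\ \forall k\}$ and $\mathcal S_\beta=\mathcal S_\alpha-\frac12$. Let $1(t)=1$ for $t>0$ and $1(t)=0$ for $t\le 0$. **Theorem.** There are exactly one real $s_\alpha\in\mathcal S_\alpha$ with $\alpha'(s_\alpha)=0$ and exactly one real $s_\beta\in\mathcal S_\beta$ with $\beta'(s_\beta)=0$, and $s_\beta=s_\alpha-\frac12$. There is exactly one (steepest descent) path $p_\alpha:\mathbb R\to\mathbb C$, avoiding the branch cut (that is, with no $1+2p_\alpha(u)\Omega_k$ in $(-\infty,0]$), such that $\Im p_\alpha(u)\ge0$ and $\alpha(p_\alpha(u))=\alpha(s_\alpha)-u^2$ for $u\ge0$, and $p_\alpha(u)=\overline{p_\alpha(-u)}$ for $u<0$. Put $p_\beta=p_\alpha-\frac12$, $c_x(u)=p_x'(u)/p_x(u)$ and $f_x(s)=\mathrm{sign}(\Im s)\sqrt{x(s_x)-x(s)}$ on the range of $p_x$, for $x\in\{\alpha,\beta\}$. *Expansions.* Let $c_{x,k}$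 be the Taylor coefficients of $c_x$ at $u=0$. As $n\to\infty$ along multiples of $K$, with all other parameters fixed: if $s_\alpha\neq0$, then $$P_{FA}(\lambda)\sim 1(-s_\alpha)+\frac{e^{\frac n2\alpha(s_\alpha)}}{\sqrt{2\pi n}}\sum_{k\ge0}\frac{(2k)!}{k!\,(2n)^k}\,\frac{c_{\alpha,2k}}{i},$$ and if $s_\beta\ne0$, then $$P_{MD}(\lambda)\sim 1(s_\beta)+\frac{e^{\frac n2\beta(s_\beta)}}{\sqrt{2\pi n}}\sum_{k\ge0}\frac{(2k)!}{k!\,(2n)^k}\,\frac{c_{\beta,2k}}{-i}.$$ Here $\sim$ means that, for every $N\ge0$, the difference between the probability and the right-hand side with the sum restricted to $0\le k<N$ is $O\big(e^{\frac n2\alpha(s_\alpha)}n^{-1/2-N}\big)$, respectively $O\big(e^{\frac n2\beta(s_\beta)}n^{-1/2-N}\big)$, uniformly over the codewords $x$. *Coefficients.* For FA, they are given by the following steps. 1. $\alpha$ has at $s_\alpha$ the real Taylor coefficients $a_0=\alpha(s_\alpha)$, $a_1=0$ and, for $m\ge2$, $$a_m=\frac1K\sum_{k=1}^K\Big(\frac{(1+\Omega_k)/\Omega_k}{1+2s_\alpha\Omega_k}+\frac1m\Big)\Big(\frac{-2\Omega_k}{1+2s_\alpha\Omega_k}\Big)^m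 ;$$ the sign of $a_m$ is $(-1)^m$ for $m\ge2$; in particular $a_2>0$. 2. $f_\alpha(p_\alpha(u))=u$ for all $u$. Near $s_\alpha$ on the path, $f_\alpha(s)=\sum_m f_m(s-s_\alpha)^m$ with purely imaginary $f_0=0$, $f_1=-i\sqrt{a_2}$ and, for $m\ge2$, $f_m=-\frac1{2f_1}\big(a_{m+1}+\sum_{\ell=2}^{m-1}f_\ell f_{m+1-\ell}\big)$. 3. $p_\alpha$ has at $u=0$ the Taylor coefficients $p_0=s_\alpha$, $p_1=1/f_1$ and, for $m\ge2$, $p_m=-f_1^{-m}\sum_{\ell=1}^{m-1}p_\ell P_{\ell,m}$, where $P_{m,m}=f_1^m$ and $P_{\ell,m}=\sum_{k=1}^{m-\ell}\frac{k\ell-m+k+\ell}{m-\ell}\frac{f_{k+1}}{f_1}P_{\ell,m-k}$ for $\ell<m$. The $p_{2m}$ are real and the $p_{2m+1}$ are imaginary. 4. If $s_\alpha\ne0$, then $c_\alpha$ has at $u=0$ the Taylor coefficients $c_{\alpha,m}=\frac1{s_\alpha}\big((m+1)p_{m+1}-\sum_{\ell=1}^m p_\ell\,c_{\alpha,m-\ell}\big)$.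 The $c_{\alpha,2m}$ are imaginary and the $c_{\alpha,2m+1}$ are real. For MD, $\beta$ has at $s_\beta$ the Taylor coefficients $b_0=\beta(s_\beta)$, $b_1=0$ and $b_m=a_m$ for $m\ge2$, and steps 2 to 4 hold with $\alpha$ and $a_m$ replaced by $\beta$ and $b_m$. -/

import Mathlib

open Filter Topology MeasureTheory

noncomputable section

namespace ParallelAWGN

/-! ### The channel, the likelihood ratio and the two error probabilities

A vector of length `n = K * d` is a family of `K` blocks of length `d`. The `k`-th block has noise
standard deviation `σ k` and power `P k`. -/

/-- The signal-to-noise ratios. -/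
def snr {K : ℕ} (P σ : Fin K → ℝ) (k : Fin K) : ℝ := P k / σ k ^ 2

/-- The channel transition density `p_{y|x}(b|a)`. -/
def transitionDensity {K d : ℕ} (σ : Fin K → ℝ) (a b : Fin K → Fin d → ℝ) : ℝ :=
  ∏ k, 1 / (2 * Real.pi * σ k ^ 2) ^ ((d : ℝ) / 2) *
    Real.exp (-(∑ j, (b k j - a k j) ^ 2) / (2 * σ k ^ 2))

/-- The (capacity achieving) output density `p_y(b)`. -/
def outputDensity {K d : ℕ} (P σ : Fin K → ℝ) (b : Fin K → Fin d → ℝ) : ℝ :=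
  ∏ k, 1 / (2 * Real.pi * σ k ^ 2 * (1 + snr P σ k)) ^ ((d : ℝ) / 2) *
    Real.exp (-(∑ j, b k j ^ 2) / (2 * σ k ^ 2 * (1 + snr P σ k)))

/-- The codewords whose `k`-th block has average power `P k`. -/
def codewordSet {K : ℕ} (P : Fin K → ℝ) (d : ℕ) : Set (Fin K → Fin d → ℝ) :=
  {a | ∀ k, ∑ j, a k j ^ 2 = d * P k}

/-- The normalized log-likelihood ratio. -/
def logLikelihood {K d : ℕ} (P σ : Fin K → ℝ) (a b : Fin K → Fin d → ℝ) : ℝ :=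
  1 / ((K * d : ℕ) : ℝ) * Real.log (transitionDensity σ a b / outputDensity P σ b)

/-- False alarm probability: `P[Λ(a, y) ≥ τ]` for `y` with density `p_y`. -/
def probFA {K d : ℕ} (P σ : Fin K → ℝ) (a : Fin K → Fin d → ℝ) (τ : ℝ) : ℝ :=
  (volume.withDensity fun b => ENNReal.ofReal (outputDensity P σ b)).real
    {b | τ ≤ logLikelihood P σ a b}

/-- Missed detection probability: `P[Λ(a, y) < τ]` for `y` with density `p_{y|x}(·|a)`. -/
def probMD {K d : ℕ} (P σ : Fin K → ℝ) (a : Fin K → Fin d → ℝ) (τ : ℝ) : ℝ :=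
  (volume.withDensity fun b => ENNReal.ofReal (transitionDensity σ a b)).real
    {b | logLikelihood P σ a b < τ}

/-- Capacity, in bits per channel use. -/
def capacity {K : ℕ} (Ω : Fin K → ℝ) : ℝ :=
  1 / (K : ℝ) * ∑ k, 1 / 2 * Real.logb 2 (1 + Ω k)

/-- The likelihood threshold that corresponds to the normalized threshold `lam`. On `codewordSet`,
`Λ(a, b) = 1/2 + log 2 * C - Λ'(a, b) / (2 n)` with
`Λ'(a, b) = ∑ k, Ω k / (1 + Ω k) * ‖b k / σ k - (1 + Ω k) / Ω k • a k / σ k‖ ^ 2`,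
so that `Λ ≥ threshold Ω lam` means `Λ' ≤ n * lam`. -/
def threshold {K : ℕ} (Ω : Fin K → ℝ) (lam : ℝ) : ℝ :=
  (1 + 2 * Real.log 2 * capacity Ω - lam) / 2

/-! ### Exponents, saddle points and steepest descent paths -/

/-- The exponent `α`. -/
def alpha {K : ℕ} (Ω : Fin K → ℝ) (lam : ℝ) (s : ℂ) : ℂ :=
  2 * lam * s - 1 / (K : ℂ) *
    ∑ k, (2 * s * (1 + Ω k) / (1 + 2 * s * Ω k) + Complex.log (1 + 2 * s * Ω k))

/-- The exponent `β`. -/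
def beta {K : ℕ} (Ω : Fin K → ℝ) (lam : ℝ) (s : ℂ) : ℂ :=
  alpha Ω lam (s + 1 / 2) + 2 * (Real.log 2 : ℂ) * (capacity Ω : ℂ) + 1 - lam

/-- The region of convergence for `α`. -/
def regionAlpha {K : ℕ} (Ω : Fin K → ℝ) : Set ℂ := {s | ∀ k, -1 / (2 * Ω k) < s.re}

/-- The region of convergence for `β`, namely `regionAlpha Ω - 1 / 2`. -/
def regionBeta {K : ℕ} (Ω : Fin K → ℝ) : Set ℂ := {s | s + 1 / 2 ∈ regionAlpha Ω}

/-- `s` is a (real) saddle point of `φ` in the region `S`. -/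
def IsSaddlePoint (φ : ℂ → ℂ) (S : Set ℂ) (s : ℝ) : Prop := (s : ℂ) ∈ S ∧ deriv φ s = 0

/-- `p : ℝ → ℂ` is the steepest descent path of `α` through the saddle point `s₀`. Points of the
path avoid the branch cut of `α`; its imaginary part vanishes on the path by `descent`. -/
structure IsSteepestDescentPath {K : ℕ} (Ω : Fin K → ℝ) (lam s₀ : ℝ) (p : ℝ → ℂ) : Prop where
  mem_domain : ∀ u k, 1 + 2 * p u * Ω k ∈ Complex.slitPlane
  im_nonneg : ∀ u, 0 ≤ u → 0 ≤ (p u).im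
  descent : ∀ u, 0 ≤ u → alpha Ω lam (p u) = alpha Ω lam s₀ - (u : ℂ) ^ 2
  symm : ∀ u, u < 0 → p u = (starRingEnd ℂ) (p (-u))

/-- The map `f(s) = sign(Im s) √(φ(s₀) - φ(s))`, considered for `s` on a steepest descent path. -/
def descentInverse (φ : ℂ → ℂ) (s₀ : ℝ) (s : ℂ) : ℝ :=
  SignType.sign s.im * Real.sqrt (φ s₀ - φ s).re

/-- The function `p'(u) / p(u)`. -/
def logDerivPath (p : ℝ → ℂ) (u : ℝ) : ℂ := deriv p u / p u

/-! ### The recursions -/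

/-- The coefficients `a_m`, `m ≥ 2`, evaluated at `sα`. -/
def exponentCoeff {K : ℕ} (Ω : Fin K → ℝ) (sα : ℝ) (m : ℕ) : ℝ :=
  1 / (K : ℝ) * ∑ k, ((1 + Ω k) / Ω k / (1 + 2 * sα * Ω k) + 1 / (m : ℝ)) *
    (-2 * Ω k / (1 + 2 * sα * Ω k)) ^ m

/-- The sequence `a_m` for the function `α`. -/
def aCoeff {K : ℕ} (Ω : Fin K → ℝ) (lam sα : ℝ) : ℕ → ℝ
  | 0 => (alpha Ω lam sα).re
  | 1 => 0
  | m + 2 => exponentCoeff Ω sα (m + 2)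

/-- The sequence `b_m` for the function `β`. -/
def bCoeff {K : ℕ} (Ω : Fin K → ℝ) (lam sα sβ : ℝ) : ℕ → ℝ
  | 0 => (beta Ω lam sβ).re
  | 1 => 0
  | m + 2 => aCoeff Ω lam sα (m + 2)

/-- The sequence `f_m` (see `fCoeff_of_two_le` for the recursion with the usual indices). -/
def fCoeff (a : ℕ → ℝ) : ℕ → ℂ
  | 0 => 0
  | 1 => -Complex.I * (Real.sqrt (a 2) : ℂ)
  | m + 2 => -(1 / (2 * (-Complex.I * (Real.sqrt (a 2) : ℂ)))) *
      ((a (m + 3) : ℂ) + ∑ j : Fin m, fCoeff a (j + 2) * fCoeff a (m + 1 - j))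
  termination_by m => m
  decreasing_by all_goals omega

/-- `powerAux f ℓ N` is `P_{ℓ, ℓ + N}`. -/
def powerAux (f : ℕ → ℂ) (ℓ : ℕ) : ℕ → ℂ
  | 0 => f 1 ^ ℓ
  | N + 1 => ∑ j : Fin (N + 1),
      (((j : ℂ) + 1) * ℓ - (N + 1) + (j + 1)) / (N + 1) * (f (j + 2) / f 1) *
        powerAux f ℓ (N - j)
  termination_by N => N
  decreasing_by omega

/-- The coefficients `P_{ℓ, m}`, used for `ℓ ≤ m` (see `powerCoeff_self`, `powerCoeff_of_lt`). -/
def powerCoeff (f : ℕ → ℂ) (ℓ m : ℕ) : ℂ := powerAux f ℓ (m - ℓ)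

/-- The sequence `p_m` (see `pCoeff_of_two_le`). -/
def pCoeff (s₀ : ℝ) (f : ℕ → ℂ) : ℕ → ℂ
  | 0 => s₀
  | 1 => 1 / f 1
  | m + 2 => -(1 / f 1 ^ (m + 2)) *
      ∑ j : Fin (m + 1), pCoeff s₀ f (j + 1) * powerCoeff f (j + 1) (m + 2)
  termination_by m => m
  decreasing_by omega

/-- The sequence `c_m` (see `cCoeff_eq`). -/
def cCoeff (s₀ : ℝ) (p : ℕ → ℂ) (m : ℕ) : ℂ :=
  1 / (s₀ : ℂ) * ((m + 1) * p (m + 1) - ∑ j : Fin m, p (j + 1) * cCoeff s₀ p (m - (j + 1)))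
  termination_by m
  decreasing_by omega

theorem fCoeff_one (a : ℕ → ℝ) : fCoeff a 1 = -Complex.I * (Real.sqrt (a 2) : ℂ) := by
  rw [fCoeff]

theorem fCoeff_of_two_le (a : ℕ → ℝ) (m : ℕ) (hm : 2 ≤ m) :
    fCoeff a m = -(1 / (2 * fCoeff a 1)) *
      ((a (m + 1) : ℂ) + ∑ ℓ ∈ Finset.Icc 2 (m - 1), fCoeff a ℓ * fCoeff a (m + 1 - ℓ)) := by
  obtain ⟨m, rfl⟩ : ∃ r, m = r + 2 := ⟨m - 2, by omega⟩
  rw [fCoeff_one, fCoeff]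
  congr 2
  rw [Fin.sum_univ_eq_sum_range (fun j => fCoeff a (j + 2) * fCoeff a (m + 1 - j))]
  have h : Finset.Icc 2 (m + 2 - 1) = Finset.Ico 2 (m + 2) := by ext; simp; omega
  rw [h, Finset.sum_Ico_eq_sum_range]
  refine Finset.sum_congr (by simp) fun j hj => ?_
  rw [Nat.add_comm 2 j, show m + 2 + 1 - (j + 2) = m + 1 - j by omega]

theorem powerCoeff_self (f : ℕ → ℂ) (m : ℕ) : powerCoeff f m m = f 1 ^ m := by
  rw [powerCoeff, Nat.sub_self, powerAux]

theorem powerCoeff_of_lt (f : ℕ → ℂ) (ℓ m : ℕ) (h : ℓ < m) :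
    powerCoeff f ℓ m = ∑ k ∈ Finset.Icc 1 (m - ℓ),
      ((k : ℂ) * ℓ - m + k + ℓ) / ((m : ℂ) - ℓ) * (f (k + 1) / f 1) * powerCoeff f ℓ (m - k) := by
  obtain ⟨N, rfl⟩ : ∃ r, m = ℓ + r + 1 := ⟨m - ℓ - 1, by omega⟩
  rw [powerCoeff, show ℓ + N + 1 - ℓ = N + 1 by omega, powerAux]
  rw [Fin.sum_univ_eq_sum_range (fun j => (((j : ℂ) + 1) * ℓ - (N + 1) + (j + 1)) / (N + 1) *
    (f (j + 2) / f 1) * powerAux f ℓ (N - j))]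
  have h : Finset.Icc 1 (N + 1) = Finset.Ico 1 (N + 2) := by ext; simp; omega
  rw [h, Finset.sum_Ico_eq_sum_range]
  refine Finset.sum_congr (by simp) fun j hj => ?_
  rw [Finset.mem_range] at hj
  rw [powerCoeff, show ℓ + N + 1 - (1 + j) - ℓ = N - j by omega, Nat.add_comm 1 j]
  push_cast
  congr 2
  congr 1 <;> ring

theorem pCoeff_of_two_le (s₀ : ℝ) (f : ℕ → ℂ) (m : ℕ) (hm : 2 ≤ m) :
    pCoeff s₀ f m = -(1 / f 1 ^ m) *
      ∑ ℓ ∈ Finset.Icc 1 (m - 1), pCoeff s₀ f ℓ * powerCoeff f ℓ m := by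
  obtain ⟨m, rfl⟩ : ∃ r, m = r + 2 := ⟨m - 2, by omega⟩
  rw [pCoeff]
  congr 1
  rw [Fin.sum_univ_eq_sum_range (fun j => pCoeff s₀ f (j + 1) * powerCoeff f (j + 1) (m + 2))]
  have h : Finset.Icc 1 (m + 2 - 1) = Finset.Ico 1 (m + 2) := by ext; simp; omega
  rw [h, Finset.sum_Ico_eq_sum_range]
  refine Finset.sum_congr (by simp) fun j hj => ?_
  rw [Nat.add_comm 1 j]

theorem cCoeff_eq (s₀ : ℝ) (p : ℕ → ℂ) (m : ℕ) :
    cCoeff s₀ p m = 1 / (s₀ : ℂ) *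
      ((m + 1) * p (m + 1) - ∑ ℓ ∈ Finset.Icc 1 m, p ℓ * cCoeff s₀ p (m - ℓ)) := by
  rw [cCoeff]
  congr 2
  rw [Fin.sum_univ_eq_sum_range (fun j => p (j + 1) * cCoeff s₀ p (m - (j + 1)))]
  have h : Finset.Icc 1 m = Finset.Ico 1 (m + 1) := by ext; simp
  rw [h, Finset.sum_Ico_eq_sum_range]
  refine Finset.sum_congr (by simp) fun j hj => ?_
  rw [Nat.add_comm 1 j]

/-! ### Taylor series, correctness of the procedure, and the partial sums of the expansion -/

/-- `g` is the sum of the power series with coefficients `c` in a neighbourhood of `0`. -/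
def HasTaylorCoeffs (g : ℝ → ℂ) (c : ℕ → ℂ) : Prop :=
  ∀ᶠ u : ℝ in 𝓝 0, HasSum (fun m => c m * (u : ℂ) ^ m) (g u)

/-- Correctness of steps 1 to 3, for an exponent `φ` with saddle point `s₀` and path `p`: the
sequences `a`, `fCoeff a` and `pCoeff s₀ (fCoeff a)` are the Taylor coefficients of `φ` in `s₀`, of
the inverse of the path in `s₀`, and of the path in `0`, with the stated reality properties. -/
structure PathSeries (φ : ℂ → ℂ) (s₀ : ℝ) (a : ℕ → ℝ) (p : ℝ → ℂ) : Prop where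
  exponent : ∀ᶠ s : ℂ in 𝓝 (s₀ : ℂ), HasSum (fun m => (a m : ℂ) * (s - s₀) ^ m) (φ s)
  exponent_sign : ∀ m, 2 ≤ m → 0 < (-1) ^ m * a m
  inverse_path : ∀ u, descentInverse φ s₀ (p u) = u
  inverse : ∀ᶠ s : ℂ in 𝓝[Set.range p] (s₀ : ℂ),
    HasSum (fun m => fCoeff a m * (s - s₀) ^ m) (descentInverse φ s₀ s : ℂ)
  inverse_imag : ∀ m, (fCoeff a m).re = 0
  path : HasTaylorCoeffs p (pCoeff s₀ (fCoeff a))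
  path_even_real : ∀ m, (pCoeff s₀ (fCoeff a) (2 * m)).im = 0
  path_odd_imag : ∀ m, (pCoeff s₀ (fCoeff a) (2 * m + 1)).re = 0

/-- Correctness of step 4: `c` is the sequence of Taylor coefficients of `p'(u) / p(u)` in `0`,
with the stated reality properties. -/
structure LogDerivSeries (p : ℝ → ℂ) (c : ℕ → ℂ) : Prop where
  taylor : HasTaylorCoeffs (logDerivPath p) c
  even_imag : ∀ m, (c (2 * m)).re = 0
  odd_real : ∀ m, (c (2 * m + 1)).im = 0

/-- The unit step function. -/
def unitStep (x : ℝ) : ℝ := if 0 < x then 1 else 0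

/-- The first `N` terms of the expansion. -/
def expansionSum (n : ℕ) (φ₀ : ℂ) (c : ℕ → ℂ) (ι : ℂ) (N : ℕ) : ℂ :=
  Complex.exp ((n : ℂ) / 2 * φ₀) / (Real.sqrt (2 * Real.pi * n) : ℂ) *
    ∑ k ∈ Finset.range N,
      ((2 * k).factorial : ℂ) / ((k.factorial : ℂ) * (2 * (n : ℂ)) ^ k) * (c (2 * k) / ι)

/-- The order of magnitude `e^{n φ₀ / 2} n^{-1/2} n^{-N}` of the first omitted term. -/
def expansionError (n : ℕ) (φ₀ : ℂ) (N : ℕ) : ℝ :=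
  Real.exp ((n : ℝ) / 2 * φ₀.re) / (Real.sqrt n * (n : ℝ) ^ N)

end ParallelAWGN

end

/-! On a codeword with the prescribed block powers, the log-likelihood ratio is a decreasing affine
function of a quadratic statistic `T` (`transitionDensity_eq`), so false alarm is the event `T ≤ n
λ` and missed detection is the complementary event under the other law. Under `p_y` the coordinates
are independent Gaussians, and completing squares gives `E exp(-s T) = exp(n/2 (α(s) - 2 λ s))`; the
power constraint removes all further dependence on the codeword, whence the uniformity. The law
`p_{y|x}` is a tilt of `p_y` by a multiple of `exp(-T/2)`, which shifts `s` by `1/2` and produces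
`β`. Fourier inversion on the vertical line through the saddle (`laplace_inversion`) writes `P[T ≤ n
λ]` as `(1/2πi) ∫ e^{n φ(s)/2} ds/s` plus a unit step, which is `1` when the line runs to the left
of the pole at `0`.

The exponent is strictly convex on the real part of its region, which gives the unique saddle. For
the global path, the key inequality `im_alpha_lt` says that `Im α(x + iy) / y` is strictly
increasing in `y > 0`; over the region its limit at `y = 0` is `α'(x)`. Hence the zeros of `Im α` in
the upper half plane form a graph over `x < s_α`, along which `Re α` increases strictly from `-∞` to
`α(s_α)` (`existsUnique_upper`). So every parameter `u` determines exactly one point of the path.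

The asymptotics need only the germ of the path. On the vertical line `Re φ` drops by at least `½
log(1 + κ ω²)`, so all but a short segment is exponentially small (`exists_tail_bound`). Near the
saddle, `φ(s₀) - φ` is the square of a local coordinate `f` with inverse `q` (`exists_local_path`),
and the segment may be exchanged for the curve `q(u)` at an exponentially small cost
(`exists_local_bound`). There the integral becomes a Gaussian integral of `q'/q`, which `watson`
expands.

The recursions are comparisons of coefficients in `f² = φ(s₀) - φ`, `q ∘ f = id` and `q' = q c`; the
powers of `f` come from `G (G^l)' = l G' G^l` with `f = X G`. Since all `f_m` are imaginary, `p_m`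
and `c_m` are real multiples of `f_1^{-m}` and `f_1^{-(m+1)}`, which gives the parity statements. -/

noncomputable section

namespace ParallelAWGN

section Exponent

/-! ### Calculus of the exponent -/

variable {K : ℕ} {Ω : Fin K → ℝ} {lam : ℝ}

/-- The derivative of `alpha`. -/
def alphaDeriv (Ω : Fin K → ℝ) (lam : ℝ) (s : ℂ) : ℂ :=
  2 * lam - 1 / (K : ℂ) *
    ∑ k, (2 * (1 + Ω k) / (1 + 2 * s * Ω k) ^ 2 + 2 * Ω k / (1 + 2 * s * Ω k))

/-- The restriction of `alpha` to the real axis. -/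
def alphaReal (Ω : Fin K → ℝ) (lam x : ℝ) : ℝ :=
  2 * lam * x - 1 / (K : ℝ) *
    ∑ k, (2 * x * (1 + Ω k) / (1 + 2 * x * Ω k) + Real.log (1 + 2 * x * Ω k))

/-- The restriction of `alphaDeriv` to the real axis. -/
def alphaDerivReal (Ω : Fin K → ℝ) (lam x : ℝ) : ℝ :=
  2 * lam - 1 / (K : ℝ) *
    ∑ k, (2 * (1 + Ω k) / (1 + 2 * x * Ω k) ^ 2 + 2 * Ω k / (1 + 2 * x * Ω k))

theorem mem_regionAlpha_iff (hΩ : ∀ k, 0 < Ω k) {s : ℂ} :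
    s ∈ regionAlpha Ω ↔ ∀ k, 0 < 1 + 2 * s.re * Ω k := by
  refine forall_congr' fun k => ?_
  rw [div_lt_iff₀ (by have := hΩ k; positivity)]
  constructor <;> intro h <;> linarith

theorem re_one_add_two_mul (s : ℂ) (w : ℝ) : (1 + 2 * s * w).re = 1 + 2 * s.re * w := by simp

theorem im_one_add_two_mul (s : ℂ) (w : ℝ) : (1 + 2 * s * w).im = 2 * s.im * w := by simp

theorem hasDerivAt_alpha {s : ℂ} (hs : ∀ k, 1 + 2 * s * Ω k ∈ Complex.slitPlane) :
    HasDerivAt (alpha Ω lam) (alphaDeriv Ω lam s) s := by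
  have hid : HasDerivAt (fun z : ℂ => z) 1 s := hasDerivAt_id s
  have hz : ∀ k, HasDerivAt (fun z : ℂ => 1 + 2 * z * Ω k) (2 * Ω k) s := fun k => by
    simpa using ((hid.const_mul (2 : ℂ)).mul_const (Ω k : ℂ)).const_add (1 : ℂ)
  have h := (hid.const_mul (2 * lam : ℂ)).sub
    ((HasDerivAt.fun_sum (u := Finset.univ) fun k _ =>
      ((((hid.const_mul (2 : ℂ)).mul_const (1 + Ω k : ℂ)).div (hz k)
        (Complex.slitPlane_ne_zero (hs k))).add ((hz k).clog (hs k)))).const_mul (1 / (K : ℂ)))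
  refine HasDerivAt.congr_deriv h ?_
  unfold alphaDeriv
  rw [mul_one]
  congr 2
  refine Finset.sum_congr rfl fun k _ => ?_
  have := Complex.slitPlane_ne_zero (hs k)
  field_simp
  ring

theorem slitPlane_of_mem_region (hΩ : ∀ k, 0 < Ω k) {s : ℂ} (hs : s ∈ regionAlpha Ω) (k : Fin K) :
    1 + 2 * s * Ω k ∈ Complex.slitPlane :=
  Or.inl (by rw [re_one_add_two_mul]; exact (mem_regionAlpha_iff hΩ).1 hs k)

theorem slitPlane_of_im_pos (hΩ : ∀ k, 0 < Ω k) {s : ℂ} (hs : 0 < s.im) (k : Fin K) :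
    1 + 2 * s * Ω k ∈ Complex.slitPlane :=
  Or.inr (by rw [im_one_add_two_mul]; have := hΩ k; positivity)

theorem alpha_ofReal {x : ℝ} (hx : ∀ k, 0 < 1 + 2 * x * Ω k) :
    alpha Ω lam x = alphaReal Ω lam x := by
  unfold alpha alphaReal
  push_cast
  congr 3
  ext k
  rw [Complex.ofReal_log (hx k).le]
  push_cast
  ring

theorem alphaDeriv_ofReal (x : ℝ) : alphaDeriv Ω lam x = alphaDerivReal Ω lam x := by
  unfold alphaDeriv alphaDerivReal
  push_cast
  ring

theorem alpha_conj {s : ℂ} (hs : ∀ k, 1 + 2 * s * Ω k ∈ Complex.slitPlane) :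
    alpha Ω lam ((starRingEnd ℂ) s) = (starRingEnd ℂ) (alpha Ω lam s) := by
  unfold alpha
  simp only [map_sub, map_mul, map_sum, map_add, map_div₀, map_one, Complex.conj_ofReal,
    map_natCast, map_ofNat]
  congr 3
  ext k
  have h := Complex.slitPlane_arg_ne_pi (hs k)
  rw [← Complex.log_conj _ h]
  simp only [map_add, map_mul, map_one, map_ofNat, Complex.conj_ofReal]

theorem hasDerivAt_alphaReal {x : ℝ} (hx : ∀ k, 0 < 1 + 2 * x * Ω k) :
    HasDerivAt (alphaReal Ω lam) (alphaDerivReal Ω lam x) x := by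
  have hid : HasDerivAt (fun z : ℝ => z) 1 x := hasDerivAt_id x
  have hz : ∀ k, HasDerivAt (fun z : ℝ => 1 + 2 * z * Ω k) (2 * Ω k) x := fun k => by
    simpa using ((hid.const_mul (2 : ℝ)).mul_const (Ω k)).const_add (1 : ℝ)
  have h := (hid.const_mul (2 * lam)).sub
    ((HasDerivAt.fun_sum (u := Finset.univ) fun k _ =>
      ((((hid.const_mul (2 : ℝ)).mul_const (1 + Ω k)).div (hz k)
        (hx k).ne').add ((hz k).log (hx k).ne'))).const_mul (1 / (K : ℝ)))
  refine HasDerivAt.congr_deriv h ?_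
  unfold alphaDerivReal
  rw [mul_one]
  congr 2
  refine Finset.sum_congr rfl fun k _ => ?_
  have := (hx k).ne'
  field_simp
  ring

/-- The real points of `regionAlpha`. -/
def realRegion (Ω : Fin K → ℝ) : Set ℝ := {x | ∀ k, 0 < 1 + 2 * x * Ω k}

theorem ofReal_mem_regionAlpha (hΩ : ∀ k, 0 < Ω k) {x : ℝ} :
    (x : ℂ) ∈ regionAlpha Ω ↔ x ∈ realRegion Ω := by
  rw [mem_regionAlpha_iff hΩ]; rfl

theorem convex_realRegion : Convex ℝ (realRegion Ω) := by
  intro x hx y hy a b ha hb hab k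
  have h1 := hx k
  have h2 := hy k
  simp only [smul_eq_mul]
  rcases ha.eq_or_lt with rfl | ha
  · obtain rfl : b = 1 := by linarith
    simpa using h2
  · have : 1 + 2 * (a * x + b * y) * Ω k = a * (1 + 2 * x * Ω k) + b * (1 + 2 * y * Ω k) := by
      linear_combination (-1 : ℝ) * hab
    rw [this]
    positivity

/-- This is strict convexity of `α` on the real axis: each subtracted summand decreases as the
positive quantity `1 + 2 x Ω_k` grows. -/
theorem strictMonoOn_alphaDerivReal (hK : 0 < K) (hΩ : ∀ k, 0 < Ω k) :
    StrictMonoOn (alphaDerivReal Ω lam) (realRegion Ω) := by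
  intro x hx y hy hxy
  unfold alphaDerivReal
  have hK' : (0 : ℝ) < 1 / (K : ℝ) := by positivity
  have : Nonempty (Fin K) := ⟨⟨0, hK⟩⟩
  refine sub_lt_sub_left (mul_lt_mul_of_pos_left (Finset.sum_lt_sum_of_nonempty
    Finset.univ_nonempty fun k _ => ?_) hK') _
  have h1 := hx k
  have h0 := hΩ k
  have h2 : 1 + 2 * x * Ω k < 1 + 2 * y * Ω k := by nlinarith
  gcongr

/-- The derivative tends to `2 λ > 0` at infinity and is negative near the left end of the region,
where a single pole dominates; the intermediate value theorem does the rest. -/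
theorem exists_saddle (hK : 0 < K) (hΩ : ∀ k, 0 < Ω k) (hlam : 0 < lam) :
    ∃ x ∈ realRegion Ω, alphaDerivReal Ω lam x = 0 := by
  have : Nonempty (Fin K) := ⟨⟨0, hK⟩⟩
  have hK' : (0 : ℝ) < K := by positivity
  -- The largest `Ω m` has the rightmost pole `-1 / (2 Ω m)`, which is the end of the region.
  obtain ⟨m, hm⟩ := Finite.exists_max Ω
  -- a point close to the boundary, where the derivative is negative
  set ε : ℝ := 1 / (1 + K * lam) with hε
  have hε0 : 0 < ε := by positivity
  have hε1 : ε < 1 := by rw [hε, div_lt_one (by positivity)]; have := mul_pos hK' hlam; linarith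
  set x₀ : ℝ := (ε - 1) / (2 * Ω m) with hx₀
  have hmpos := hΩ m
  have hx₀m : 1 + 2 * x₀ * Ω m = ε := by rw [hx₀]; field_simp; ring
  have hx₀neg : x₀ < 0 := div_neg_of_neg_of_pos (by linarith) (by positivity)
  have hx₀mem : x₀ ∈ realRegion Ω := fun k => by
    have := hm k
    nlinarith
  have hneg : alphaDerivReal Ω lam x₀ < 0 := by
    have h1 : 2 * (1 + Ω m) / (1 + 2 * x₀ * Ω m) ^ 2 + 2 * Ω m / (1 + 2 * x₀ * Ω m) ≤
        ∑ k, (2 * (1 + Ω k) / (1 + 2 * x₀ * Ω k) ^ 2 + 2 * Ω k / (1 + 2 * x₀ * Ω k)) :=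
      Finset.single_le_sum (f := fun k =>
        (2 * (1 + Ω k) / (1 + 2 * x₀ * Ω k) ^ 2 + 2 * Ω k / (1 + 2 * x₀ * Ω k)))
        (fun k _ => by have := hΩ k; have := hx₀mem k; positivity) (Finset.mem_univ m)
    -- Since `1 / ε² = (1 + K λ)² > K λ`, this one term already exceeds `2 λ` after division by `K`.
    have h2 : 2 * (K * lam) < 2 * (1 + Ω m) / (1 + 2 * x₀ * Ω m) ^ 2 := by
      rw [hx₀m, lt_div_iff₀ (by positivity), hε]
      have : 0 < K * lam := mul_pos hK' hlam
      field_simp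
      nlinarith [sq_nonneg (K * lam)]
    have h3 : 0 < 2 * Ω m / (1 + 2 * x₀ * Ω m) := by rw [hx₀m]; positivity
    unfold alphaDerivReal
    rw [sub_neg, one_div, ← div_eq_inv_mul, lt_div_iff₀ hK']
    linarith
  have hx₁ : ∀ᶠ x in atTop, 0 < alphaDerivReal Ω lam x := by
    have ht : Tendsto (alphaDerivReal Ω lam) atTop
        (𝓝 (2 * lam - 1 / (K : ℝ) * ∑ k : Fin K, ((0 : ℝ) + 0))) := by
      refine tendsto_const_nhds.sub (tendsto_const_nhds.mul (tendsto_finsetSum _ fun k _ => ?_))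
      have hz : Tendsto (fun x : ℝ => 1 + 2 * x * Ω k) atTop atTop :=
        tendsto_atTop_add_const_left _ _
          ((tendsto_id.const_mul_atTop two_pos).atTop_mul_const (hΩ k))
      exact (tendsto_const_nhds.div_atTop ((tendsto_pow_atTop two_ne_zero).comp hz)).add
        (tendsto_const_nhds.div_atTop hz)
    refine ht.eventually (lt_mem_nhds ?_)
    simp; exact hlam
  obtain ⟨x₁, hpos, hle⟩ := (hx₁.and (eventually_ge_atTop 0)).exists
  have hx₁mem : x₁ ∈ realRegion Ω := fun k => by have := hΩ k; positivity
  have hsub : Set.Icc x₀ x₁ ⊆ realRegion Ω := convex_realRegion.ordConnected.out hx₀mem hx₁mem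
  have hcont : ContinuousOn (alphaDerivReal Ω lam) (Set.Icc x₀ x₁) := by
    unfold alphaDerivReal
    refine continuousOn_const.sub (continuousOn_const.mul (continuousOn_finsetSum _ fun k _ => ?_))
    have hz : ContinuousOn (fun x : ℝ => 1 + 2 * x * Ω k) (Set.Icc x₀ x₁) := by fun_prop
    exact (continuousOn_const.div (hz.pow 2) fun x hx => (pow_pos (hsub hx k) 2).ne').add
      (continuousOn_const.div hz fun x hx => (hsub hx k).ne')
  obtain ⟨x, hx, h⟩ := intermediate_value_Icc (by linarith) hcont
    (show (0 : ℝ) ∈ Set.Icc _ _ from ⟨hneg.le, hpos.le⟩)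
  exact ⟨x, hsub hx, h⟩

theorem isSaddlePoint_alpha_iff (hΩ : ∀ k, 0 < Ω k) {x : ℝ} :
    IsSaddlePoint (alpha Ω lam) (regionAlpha Ω) x ↔
      x ∈ realRegion Ω ∧ alphaDerivReal Ω lam x = 0 := by
  unfold IsSaddlePoint
  rw [ofReal_mem_regionAlpha hΩ]
  refine and_congr_right fun hx => ?_
  rw [(hasDerivAt_alpha (slitPlane_of_mem_region hΩ
    ((ofReal_mem_regionAlpha hΩ).2 hx))).deriv, alphaDeriv_ofReal, Complex.ofReal_eq_zero]

theorem existsUnique_saddle_alpha (hK : 0 < K) (hΩ : ∀ k, 0 < Ω k) (hlam : 0 < lam) :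
    ∃! s : ℝ, IsSaddlePoint (alpha Ω lam) (regionAlpha Ω) s := by
  obtain ⟨x, hx, h⟩ := exists_saddle hK hΩ hlam
  refine ⟨x, (isSaddlePoint_alpha_iff hΩ).2 ⟨hx, h⟩, fun y hy => ?_⟩
  obtain ⟨hy, h'⟩ := (isSaddlePoint_alpha_iff hΩ).1 hy
  exact (strictMonoOn_alphaDerivReal hK hΩ).injOn hy hx (h'.trans h.symm)

theorem isSaddlePoint_beta_iff {x : ℝ} :
    IsSaddlePoint (beta Ω lam) (regionBeta Ω) x ↔
      IsSaddlePoint (alpha Ω lam) (regionAlpha Ω) (x + 1 / 2) := by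
  unfold IsSaddlePoint regionBeta beta
  simp only [deriv_add_const, deriv_sub_const, Set.mem_ofPred_eq]
  rw [deriv_comp_add_const]
  push_cast
  rfl

theorem existsUnique_saddle_beta (hK : 0 < K) (hΩ : ∀ k, 0 < Ω k) (hlam : 0 < lam) :
    ∃! s : ℝ, IsSaddlePoint (beta Ω lam) (regionBeta Ω) s := by
  obtain ⟨x, hx, h⟩ := existsUnique_saddle_alpha hK hΩ hlam
  refine ⟨x - 1 / 2, isSaddlePoint_beta_iff.2 (by simpa using hx), fun y hy => ?_⟩
  have := h _ (isSaddlePoint_beta_iff.1 hy)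
  linarith

/-- On the real axis, `alpha` has its unique minimum at the saddle point. -/
theorem alphaReal_lt (hK : 0 < K) (hΩ : ∀ k, 0 < Ω k) {s₀ x : ℝ} (hs : s₀ ∈ realRegion Ω)
    (h0 : alphaDerivReal Ω lam s₀ = 0) (hx : x ∈ realRegion Ω) (hne : x ≠ s₀) :
    alphaReal Ω lam s₀ < alphaReal Ω lam x := by
  have hmono := strictMonoOn_alphaDerivReal (lam := lam) hK hΩ
  have hc : ContinuousOn (alphaReal Ω lam) (realRegion Ω) := fun y hy =>
    (hasDerivAt_alphaReal hy).continuousAt.continuousWithinAt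
  rcases lt_or_gt_of_ne hne with h | h
  · have hsub : Set.Icc x s₀ ⊆ realRegion Ω := convex_realRegion.ordConnected.out hx hs
    refine strictAntiOn_of_deriv_neg (convex_Icc x s₀) (hc.mono hsub) (fun y hy => ?_)
      (Set.left_mem_Icc.2 h.le) (Set.right_mem_Icc.2 h.le) h
    rw [interior_Icc] at hy
    have hyr := hsub (Set.Ioo_subset_Icc_self hy)
    rw [(hasDerivAt_alphaReal hyr).deriv, ← h0]
    exact hmono hyr hs hy.2
  · have hsub : Set.Icc s₀ x ⊆ realRegion Ω := convex_realRegion.ordConnected.out hs hx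
    refine strictMonoOn_of_deriv_pos (convex_Icc s₀ x) (hc.mono hsub) (fun y hy => ?_)
      (Set.left_mem_Icc.2 h.le) (Set.right_mem_Icc.2 h.le) h
    rw [interior_Icc] at hy
    have hyr := hsub (Set.Ioo_subset_Icc_self hy)
    rw [(hasDerivAt_alphaReal hyr).deriv, ← h0]
    exact hmono hs hyr hy.1

/-- Decay of `alpha` on vertical lines. -/
theorem exists_re_alpha_le (hK : 0 < K) (hΩ : ∀ k, 0 < Ω k) {γ : ℝ} (hγ : γ ∈ realRegion Ω) :
    ∃ κ : ℝ, 0 < κ ∧ ∀ ω : ℝ, (alpha Ω lam (γ + ω * Complex.I)).re ≤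
      (alpha Ω lam γ).re - 1 / 2 * Real.log (1 + κ * ω ^ 2) := by
  have : Nonempty (Fin K) := ⟨⟨0, hK⟩⟩
  -- The smallest of these squares is a rate that serves all `k` at once.
  obtain ⟨m, hm⟩ := Finite.exists_min fun k => (2 * Ω k / (1 + 2 * γ * Ω k)) ^ 2
  refine ⟨(2 * Ω m / (1 + 2 * γ * Ω m)) ^ 2,
    by have := hΩ m; have := hγ m; positivity, fun ω => ?_⟩
  set κ := (2 * Ω m / (1 + 2 * γ * Ω m)) ^ 2 with hκ
  have hre : ∀ s : ℂ, (alpha Ω lam s).re = 2 * lam * s.re - 1 / (K : ℝ) *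
      ∑ k, ((2 * s * (1 + Ω k) / (1 + 2 * s * Ω k)).re + (Complex.log (1 + 2 * s * Ω k)).re) := by
    intro s
    unfold alpha
    rw [show (1 / (K : ℂ)) = ((1 / (K : ℝ) : ℝ) : ℂ) by push_cast; rfl, Complex.sub_re,
      Complex.re_ofReal_mul, Complex.re_sum]
    simp
  -- Termwise with `z = 1 + 2 s Ω_k`: the rational part is `(1 + Ω_k)/Ω_k (1 - Re z⁻¹)`, which does
  -- not decrease off the real axis, and `|z|²` gains at least the factor `1 + κ ω²`. Averaging over
  -- `k` preserves the gain.
  have hterm : ∀ k, (2 * (γ : ℂ) * (1 + Ω k) / (1 + 2 * γ * Ω k)).re +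
      (Complex.log (1 + 2 * γ * Ω k)).re + 1 / 2 * Real.log (1 + κ * ω ^ 2) ≤
      (2 * (γ + ω * Complex.I) * (1 + Ω k) / (1 + 2 * (γ + ω * Complex.I) * Ω k)).re +
      (Complex.log (1 + 2 * (γ + ω * Complex.I) * Ω k)).re := by
    intro k
    have hzpos := hγ k
    have hΩk := hΩ k
    set z : ℂ := 1 + 2 * (γ + ω * Complex.I) * Ω k with hz
    set x := 1 + 2 * γ * Ω k with hx
    have hzre : z.re = x := by simp [hz, hx]
    have hzim : z.im = 2 * ω * Ω k := by simp [hz]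
    have hzC : (1 + 2 * (γ : ℂ) * Ω k) = (x : ℂ) := by simp [hx]
    have hz0 : z ≠ 0 := fun h => by rw [h] at hzre; simp at hzre; linarith
    have hx0 : (x : ℂ) ≠ 0 := by exact_mod_cast hzpos.ne'
    have hnsq : Complex.normSq z = x ^ 2 + (2 * ω * Ω k) ^ 2 := by
      rw [Complex.normSq_apply, hzre, hzim]; ring
    have hOC : (Ω k : ℂ) ≠ 0 := by exact_mod_cast hΩk.ne'
    have e1 : (2 * (γ + ω * Complex.I) * (1 + Ω k) / z : ℂ) =
        (((1 + Ω k) / Ω k : ℝ) : ℂ) * (1 - z⁻¹) := by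
      have : 2 * ((γ : ℂ) + ω * Complex.I) = (z - 1) / Ω k := by rw [hz]; field_simp; ring
      rw [this]; push_cast; field_simp
    have e2 : (2 * (γ : ℂ) * (1 + Ω k) / x : ℂ) = (((1 + Ω k) / Ω k * (1 - x⁻¹) : ℝ) : ℂ) := by
      have : 2 * (γ : ℂ) = (x - 1) / Ω k := by rw [hx]; push_cast; field_simp; ring
      rw [this]; push_cast; field_simp
    rw [hzC, e1, e2, Complex.ofReal_re, Complex.re_ofReal_mul, Complex.sub_re, Complex.one_re,
      Complex.inv_re, hzre, hnsq, ← Complex.ofReal_log hzpos.le, Complex.ofReal_re, Complex.log_re]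
    have hnorm : Real.log ‖z‖ = 1 / 2 * Real.log (x ^ 2 + (2 * ω * Ω k) ^ 2) := by
      rw [← hnsq, Complex.normSq_eq_norm_sq, Real.log_pow]; push_cast; ring
    have hinv : x / (x ^ 2 + (2 * ω * Ω k) ^ 2) ≤ x⁻¹ := by
      rw [div_le_iff₀ (by positivity), mul_add, pow_two, inv_mul_cancel_left₀ hzpos.ne']
      have : 0 ≤ x⁻¹ * (2 * ω * Ω k) ^ 2 := by positivity
      linarith
    have hcoef : 0 ≤ (1 + Ω k) / Ω k := by positivity
    have hlog : Real.log x + 1 / 2 * Real.log (1 + κ * ω ^ 2) ≤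
        1 / 2 * Real.log (x ^ 2 + (2 * ω * Ω k) ^ 2) := by
      have h1 : Real.log x = 1 / 2 * Real.log (x ^ 2) := by rw [Real.log_pow]; push_cast; ring
      rw [h1, ← mul_add, ← Real.log_mul (by positivity) (by positivity)]
      have h3 : κ * x ^ 2 ≤ (2 * Ω k) ^ 2 := by
        have := hm k
        rw [div_pow (2 * Ω k), le_div_iff₀ (by positivity)] at this
        exact this
      refine mul_le_mul_of_nonneg_left (Real.log_le_log (by positivity) ?_) (by norm_num)
      nlinarith [mul_le_mul_of_nonneg_right h3 (sq_nonneg ω)]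
    rw [hnorm]
    have := mul_le_mul_of_nonneg_left (sub_le_sub_left hinv 1) hcoef
    linarith
  rw [hre, hre]
  have hsum := Finset.sum_le_sum fun k (_ : k ∈ Finset.univ) => hterm k
  rw [Finset.sum_add_distrib] at hsum
  simp only [Finset.sum_const, Finset.card_univ, Fintype.card_fin, nsmul_eq_mul] at hsum
  have hK' : (0 : ℝ) < K := by positivity
  have h4 := mul_le_mul_of_nonneg_left hsum (one_div_nonneg.2 hK'.le)
  rw [mul_add, ← mul_assoc (1 / (K : ℝ)) (K : ℝ), one_div_mul_cancel hK'.ne', one_mul] at h4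
  simp only [Complex.add_re, Complex.ofReal_re, Complex.re_ofReal_mul, Complex.I_re, mul_zero,
    add_zero]
  linarith

end Exponent

section DescentPath

/-! ### The steepest descent path -/

variable {K : ℕ} {Ω : Fin K → ℝ} {lam : ℝ}

/-- In polar coordinates the left side is `sin θ cos θ`, which is at most `sin θ < θ`. -/
theorem re_mul_im_div_normSq_lt_arg {z : ℂ} (hz : 0 < z.im) :
    z.im * z.re / Complex.normSq z < z.arg := by
  have hz0 : z ≠ 0 := fun h => by simp [h] at hz
  have hn : 0 < ‖z‖ := norm_pos_iff.2 hz0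
  have harg : 0 < z.arg := by
    rcases (Complex.arg_nonneg_iff.2 hz.le).eq_or_lt with h | h
    · have := (Complex.arg_eq_zero_iff.1 h.symm).2
      linarith
    · exact h
  have h1 : z.im * z.re / Complex.normSq z = Real.sin z.arg * Real.cos z.arg := by
    rw [Complex.sin_arg, Complex.cos_arg hz0, Complex.normSq_eq_norm_sq]
    field_simp
  have hs : 0 < Real.sin z.arg := by rw [Complex.sin_arg]; positivity
  rw [h1]
  calc Real.sin z.arg * Real.cos z.arg ≤ Real.sin z.arg * 1 :=
        mul_le_mul_of_nonneg_left (Real.cos_le_one _) hs.le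
    _ < z.arg := by rw [mul_one]; exact Real.sin_lt harg

/-- With `z = 1 + 2 s Ω_k`, partial fractions give `2 s (1 + Ω_k) / z = (1 + Ω_k)/Ω_k (1 - z⁻¹)`. In
this form both parts of `α` depend on `s` in a way that is easy to estimate. -/
theorem im_alpha (hΩ : ∀ k, 0 < Ω k) {s : ℂ} (hs : ∀ k, 1 + 2 * s * Ω k ≠ 0) :
    (alpha Ω lam s).im = 2 * lam * s.im - 1 / (K : ℝ) * ∑ k, ((1 + Ω k) / Ω k *
      ((1 + 2 * s * Ω k).im / Complex.normSq (1 + 2 * s * Ω k)) + (1 + 2 * s * Ω k).arg) := by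
  unfold alpha
  rw [show (1 / (K : ℂ)) = ((1 / (K : ℝ) : ℝ) : ℂ) by push_cast; rfl, Complex.sub_im,
    Complex.im_ofReal_mul, Complex.im_sum, show (2 * (lam : ℂ)) = ((2 * lam : ℝ) : ℂ) by
      push_cast; rfl, Complex.im_ofReal_mul]
  congr 2
  refine Finset.sum_congr rfl fun k _ => ?_
  have hOC : (Ω k : ℂ) ≠ 0 := by exact_mod_cast (hΩ k).ne'
  have e1 : (2 * s * (1 + Ω k) / (1 + 2 * s * Ω k) : ℂ) =
      (((1 + Ω k) / Ω k : ℝ) : ℂ) * (1 - (1 + 2 * s * Ω k)⁻¹) := by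
    have := hs k
    push_cast; field_simp; ring
  rw [e1, Complex.add_im, Complex.log_im, Complex.im_ofReal_mul, Complex.sub_im, Complex.inv_im,
    Complex.one_im]
  ring

theorem re_alpha (hΩ : ∀ k, 0 < Ω k) {s : ℂ} (hs : ∀ k, 1 + 2 * s * Ω k ≠ 0) :
    (alpha Ω lam s).re = 2 * lam * s.re - 1 / (K : ℝ) * ∑ k, ((1 + Ω k) / Ω k *
      (1 - (1 + 2 * s * Ω k).re / Complex.normSq (1 + 2 * s * Ω k)) +
        Real.log ‖1 + 2 * s * Ω k‖) := by
  unfold alpha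
  rw [show (1 / (K : ℂ)) = ((1 / (K : ℝ) : ℝ) : ℂ) by push_cast; rfl, Complex.sub_re,
    Complex.re_ofReal_mul, Complex.re_sum, show (2 * (lam : ℂ)) = ((2 * lam : ℝ) : ℂ) by
      push_cast; rfl, Complex.re_ofReal_mul]
  congr 2
  refine Finset.sum_congr rfl fun k _ => ?_
  have hOC : (Ω k : ℂ) ≠ 0 := by exact_mod_cast (hΩ k).ne'
  have e1 : (2 * s * (1 + Ω k) / (1 + 2 * s * Ω k) : ℂ) =
      (((1 + Ω k) / Ω k : ℝ) : ℂ) * (1 - (1 + 2 * s * Ω k)⁻¹) := by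
    have := hs k
    push_cast; field_simp; ring
  rw [e1, Complex.add_re, Complex.log_re, Complex.re_ofReal_mul, Complex.sub_re, Complex.inv_re,
    Complex.one_re]

/-- The inequality behind the geometry of the path. After inserting `Im z = 2 Ω_k Im s` it holds
summand by summand, from `Re z² < |z|²` for the double pole and from `Im z Re z / |z|² < arg z` for
the logarithm. -/
theorem im_alpha_lt (hK : 0 < K) (hΩ : ∀ k, 0 < Ω k) {s : ℂ} (hs : 0 < s.im) :
    (alpha Ω lam s).im < s.im * (alphaDeriv Ω lam s).re := by
  have : Nonempty (Fin K) := ⟨⟨0, hK⟩⟩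
  have hz : ∀ k, 0 < (1 + 2 * s * Ω k).im := fun k => by
    rw [im_one_add_two_mul]; have := hΩ k; positivity
  have hz0 : ∀ k, (1 + 2 * s * Ω k : ℂ) ≠ 0 := fun k h => by have := hz k; rw [h] at this; simp at this
  rw [im_alpha hΩ hz0]
  unfold alphaDeriv
  rw [show (1 / (K : ℂ)) = ((1 / (K : ℝ) : ℝ) : ℂ) by push_cast; rfl, Complex.sub_re,
    Complex.re_ofReal_mul, Complex.re_sum, mul_sub, mul_left_comm,
    Finset.mul_sum _ _ s.im]
  have h1 : (2 * (lam : ℂ)).re = 2 * lam := by simp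
  rw [h1, mul_comm s.im (2 * lam)]
  have hK' : (0 : ℝ) < 1 / (K : ℝ) := by positivity
  refine sub_lt_sub_left (mul_lt_mul_of_pos_left (Finset.sum_lt_sum_of_nonempty
    Finset.univ_nonempty fun k _ => ?_) hK') _
  have hΩk := hΩ k
  have hzk := hz k
  have him := im_one_add_two_mul s (Ω k)
  set z := 1 + 2 * s * Ω k with hzdef
  have hn : 0 < Complex.normSq z := Complex.normSq_pos.2 (hz0 k)
  have e1 : (2 * (1 + Ω k) / z ^ 2 : ℂ) = ((2 * (1 + Ω k) : ℝ) : ℂ) * (z ^ 2)⁻¹ := by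
    push_cast; rfl
  have e2 : (2 * Ω k / z : ℂ) = ((2 * Ω k : ℝ) : ℂ) * z⁻¹ := by push_cast; rfl
  rw [e1, e2, Complex.add_re, Complex.re_ofReal_mul, Complex.re_ofReal_mul, Complex.inv_re,
    Complex.inv_re, map_pow]
  have h2 : (z ^ 2).re / Complex.normSq z ^ 2 < 1 / Complex.normSq z := by
    rw [div_lt_div_iff₀ (by positivity) hn, one_mul, pow_two (Complex.normSq z)]
    refine mul_lt_mul_of_pos_right ?_ hn
    rw [pow_two, Complex.mul_re, Complex.normSq_apply]
    nlinarith
  have h3 := re_mul_im_div_normSq_lt_arg hzk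
  have h4 : s.im * (2 * (1 + Ω k) * ((z ^ 2).re / Complex.normSq z ^ 2) +
      2 * Ω k * (z.re / Complex.normSq z)) = (1 + Ω k) / Ω k * z.im *
      ((z ^ 2).re / Complex.normSq z ^ 2) + z.im * z.re / Complex.normSq z := by
    rw [him]; field_simp
  rw [h4]
  have h5 : (1 + Ω k) / Ω k * z.im * ((z ^ 2).re / Complex.normSq z ^ 2) <
      (1 + Ω k) / Ω k * z.im * (1 / Complex.normSq z) :=
    mul_lt_mul_of_pos_left h2 (by positivity)
  have h6 : (1 + Ω k) / Ω k * z.im * (1 / Complex.normSq z) =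
    (1 + Ω k) / Ω k * (z.im / Complex.normSq z) := by ring
  linarith

/-- `Im α(x + i y)`. -/
def imAlpha (Ω : Fin K → ℝ) (lam x y : ℝ) : ℝ := (alpha Ω lam ⟨x, y⟩).im

theorem hasDerivAt_imAlpha {x y : ℝ}
    (hs : ∀ k, 1 + 2 * (⟨x, y⟩ : ℂ) * Ω k ∈ Complex.slitPlane) :
    HasDerivAt (imAlpha Ω lam x) (alphaDeriv Ω lam ⟨x, y⟩).re y := by
  have h1 : HasDerivAt (fun t : ℝ => (x + t * Complex.I : ℂ)) Complex.I y := by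
    simpa using ((Complex.ofRealCLM.hasDerivAt (x := y)).mul_const Complex.I).const_add (x : ℂ)
  have he : (⟨x, y⟩ : ℂ) = x + y * Complex.I := Complex.mk_eq_add_mul_I x y
  have h2 := HasDerivAt.scomp y (he ▸ hasDerivAt_alpha (lam := lam) hs) h1
  have h3 := Complex.imCLM.hasFDerivAt.comp_hasDerivAt y h2
  refine (h3.congr_deriv ?_).congr_of_eventuallyEq (Eventually.of_forall fun t => ?_)
  · simp [he]
  · simp [imAlpha, Complex.mk_eq_add_mul_I]

/-- By the Cauchy–Riemann equations `∂_y Im α = Re α'`, so `im_alpha_lt` is the positivity of the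
derivative of this quotient. Consequently `Im α` changes sign at most once on each vertical
half-line, from negative to positive. -/
theorem strictMonoOn_imAlpha_div (hK : 0 < K) (hΩ : ∀ k, 0 < Ω k) (x : ℝ) :
    StrictMonoOn (fun y => imAlpha Ω lam x y / y) (Set.Ioi 0) := by
  have hd : ∀ y ∈ Set.Ioi (0 : ℝ), HasDerivAt (fun y => imAlpha Ω lam x y / y)
      (((alphaDeriv Ω lam ⟨x, y⟩).re * y - imAlpha Ω lam x y * 1) / y ^ 2) y := fun y hy =>
    (hasDerivAt_imAlpha (slitPlane_of_im_pos hΩ hy)).div (hasDerivAt_id y) (ne_of_gt hy)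
  refine strictMonoOn_of_deriv_pos (convex_Ioi 0)
    (fun y hy => (hd y hy).continuousAt.continuousWithinAt) fun y hy => ?_
  rw [interior_Ioi] at hy
  rw [(hd y hy).deriv]
  have := im_alpha_lt (lam := lam) hK hΩ (s := ⟨x, y⟩) hy
  have hy' : 0 < y := hy
  simp only at this
  refine div_pos ?_ (by positivity)
  unfold imAlpha
  linarith

theorem imAlpha_sign_of_lt (hK : 0 < K) (hΩ : ∀ k, 0 < Ω k) {x y y' : ℝ} (hy : 0 < y)
    (h : y < y') : (0 ≤ imAlpha Ω lam x y → 0 < imAlpha Ω lam x y') ∧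
      (imAlpha Ω lam x y' ≤ 0 → imAlpha Ω lam x y < 0) := by
  have hy' := hy.trans h
  have := strictMonoOn_imAlpha_div (lam := lam) hK hΩ x hy hy' h
  simp only at this
  constructor
  · intro h0
    have h1 : 0 ≤ imAlpha Ω lam x y / y := by positivity
    exact (div_pos_iff_of_pos_right hy').1 (h1.trans_lt this)
  · intro h0
    have h1 : imAlpha Ω lam x y' / y' ≤ 0 := div_nonpos_of_nonpos_of_nonneg h0 hy'.le
    have := this.trans_le h1
    rwa [div_lt_iff₀ hy, zero_mul] at this

/-- As `Im α` vanishes on the real axis, this is a difference quotient in `y`. It decides the sign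
of `Im α` close to the axis. -/
theorem tendsto_imAlpha_div (hΩ : ∀ k, 0 < Ω k) {x : ℝ} (hx : x ∈ realRegion Ω) :
    Tendsto (fun y => imAlpha Ω lam x y / y) (𝓝[>] 0) (𝓝 (alphaDerivReal Ω lam x)) := by
  have h := hasDerivAt_imAlpha (Ω := Ω) (lam := lam) (x := x) (y := 0)
    (slitPlane_of_mem_region hΩ ((mem_regionAlpha_iff hΩ).2 hx))
  have h0 : imAlpha Ω lam x 0 = 0 := by
    have : (⟨x, 0⟩ : ℂ) = (x : ℂ) := rfl
    rw [imAlpha, this, alpha_ofReal hx, Complex.ofReal_im]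
  have h1 : (alphaDeriv Ω lam ⟨x, 0⟩).re = alphaDerivReal Ω lam x := by
    have : (⟨x, 0⟩ : ℂ) = (x : ℂ) := rfl
    rw [this, alphaDeriv_ofReal, Complex.ofReal_re]
  rw [h1] at h
  refine (h.tendsto_slope_zero_right).congr fun y => ?_
  simp [h0, div_eq_inv_mul]

/-- The quotient `Im α / y` increases strictly from its limit `α'(x) ≥ 0`. Comparison through `y /
2` keeps the inequality strict in the limit. -/
theorem imAlpha_pos_of_le (hK : 0 < K) (hΩ : ∀ k, 0 < Ω k) {x y : ℝ} (hx : x ∈ realRegion Ω)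
    (h : 0 ≤ alphaDerivReal Ω lam x) (hy : 0 < y) : 0 < imAlpha Ω lam x y := by
  by_contra hcon
  have h2 : 0 < y / 2 := by positivity
  have h1 := (imAlpha_sign_of_lt (lam := lam) (x := x) hK hΩ h2 (by linarith)).2
    (not_lt.1 hcon)
  have h3 : imAlpha Ω lam x (y / 2) / (y / 2) < 0 := div_neg_of_neg_of_pos h1 h2
  have := le_of_tendsto (tendsto_imAlpha_div (lam := lam) hΩ hx) (b := imAlpha Ω lam x (y / 2) / (y / 2)) (by
    filter_upwards [Ioo_mem_nhdsGT h2] with t ht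
    exact (strictMonoOn_imAlpha_div hK hΩ x ht.1 h2 ht.2).le)
  linarith

/-- The linear term `2 λ y` wins: the arguments are at most `π`, and `Im z / |z|² ≤ 1 / Im z ≤ 1 /
(2 Ω_k)` once `y ≥ 1`. -/
theorem exists_imAlpha_pos (hK : 0 < K) (hΩ : ∀ k, 0 < Ω k) (hlam : 0 < lam) (x : ℝ) :
    ∃ y, 0 < y ∧ 0 < imAlpha Ω lam x y := by
  have hK' : (0 : ℝ) < K := by positivity
  set M := 1 / (K : ℝ) * ∑ k, ((1 + Ω k) / Ω k * (1 / (2 * Ω k)) + Real.pi) with hM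
  have hM0 : 0 ≤ M := by
    refine mul_nonneg (by positivity) (Finset.sum_nonneg fun k _ => ?_)
    have := hΩ k
    have := Real.pi_pos
    positivity
  refine ⟨M / lam + 1, by positivity, ?_⟩
  set y := M / lam + 1 with hy
  have hy1 : 1 ≤ y := by rw [hy]; have : 0 ≤ M / lam := by positivity
                         linarith
  have hy0 : 0 < y := by linarith
  have hs : 0 < (⟨x, y⟩ : ℂ).im := hy0
  rw [imAlpha, im_alpha hΩ fun k => Complex.slitPlane_ne_zero (slitPlane_of_im_pos hΩ hs k)]
  have hle : 1 / (K : ℝ) * ∑ k, ((1 + Ω k) / Ω k *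
      ((1 + 2 * (⟨x, y⟩ : ℂ) * Ω k).im / Complex.normSq (1 + 2 * (⟨x, y⟩ : ℂ) * Ω k)) +
      (1 + 2 * (⟨x, y⟩ : ℂ) * Ω k).arg) ≤ M := by
    refine mul_le_mul_of_nonneg_left (Finset.sum_le_sum fun k _ => ?_) (by positivity)
    have hΩk := hΩ k
    refine add_le_add (mul_le_mul_of_nonneg_left ?_ (by positivity)) (Complex.arg_le_pi _)
    have him : (1 + 2 * (⟨x, y⟩ : ℂ) * Ω k).im = 2 * y * Ω k := im_one_add_two_mul _ _
    rw [div_le_div_iff₀ (Complex.normSq_pos.2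
      (Complex.slitPlane_ne_zero (slitPlane_of_im_pos hΩ hs k))) (by positivity),
      Complex.normSq_apply, him]
    nlinarith [mul_self_nonneg (1 + 2 * (⟨x, y⟩ : ℂ) * Ω k).re, mul_pos hΩk hΩk,
      mul_le_mul_of_nonneg_left hy1 (mul_pos (mul_pos hΩk hΩk) hy0).le]
  have h3 : lam * y = M + lam := by rw [hy]; field_simp
  simp only
  linarith

/-- Inside the region the limit of `Im α / y` at the axis is negative. Outside, some `1 + 2 x Ω_m`
is not positive, so its argument stays at least `π / 2` however small `y` is. -/
theorem exists_imAlpha_neg (hK : 0 < K) (hΩ : ∀ k, 0 < Ω k) (hlam : 0 < lam) {x : ℝ}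
    (h : x ∈ realRegion Ω → alphaDerivReal Ω lam x < 0) :
    ∃ y, 0 < y ∧ imAlpha Ω lam x y < 0 := by
  have hK' : (0 : ℝ) < K := by positivity
  by_cases hx : x ∈ realRegion Ω
  · have := ((tendsto_imAlpha_div (lam := lam) hΩ hx).eventually (gt_mem_nhds (h hx))).and
      self_mem_nhdsWithin
    obtain ⟨y, hy, hy0⟩ := this.exists
    have hy0 : 0 < y := hy0
    rw [div_lt_iff₀ hy0, zero_mul] at hy
    exact ⟨y, hy0, hy⟩
  · simp only [realRegion, Set.mem_ofPred_eq, not_forall, not_lt] at hx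
    obtain ⟨m, hm⟩ := hx
    -- With this height `2 λ y = π / (4 K)`, half of the guaranteed contribution `π / (2 K)` of the
    -- argument.
    set y := Real.pi / (8 * K * lam) with hy
    have hy0 : 0 < y := by have := Real.pi_pos; positivity
    refine ⟨y, hy0, ?_⟩
    have hs : 0 < (⟨x, y⟩ : ℂ).im := hy0
    rw [imAlpha, im_alpha hΩ fun k => Complex.slitPlane_ne_zero (slitPlane_of_im_pos hΩ hs k)]
    have hnn : ∀ k, 0 ≤ (1 + Ω k) / Ω k *
        ((1 + 2 * (⟨x, y⟩ : ℂ) * Ω k).im / Complex.normSq (1 + 2 * (⟨x, y⟩ : ℂ) * Ω k)) := by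
      intro k
      have hΩk := hΩ k
      have him : (1 + 2 * (⟨x, y⟩ : ℂ) * Ω k).im = 2 * y * Ω k := im_one_add_two_mul _ _
      rw [him]
      have := Complex.normSq_nonneg (1 + 2 * (⟨x, y⟩ : ℂ) * Ω k)
      positivity
    have hargnn : ∀ k, 0 ≤ (1 + 2 * (⟨x, y⟩ : ℂ) * Ω k).arg := fun k => by
      rw [Complex.arg_nonneg_iff, im_one_add_two_mul]
      have := hΩ k
      positivity
    have harg : Real.pi / 2 ≤ (1 + 2 * (⟨x, y⟩ : ℂ) * Ω m).arg := by
      have him : (1 + 2 * (⟨x, y⟩ : ℂ) * Ω m).im = 2 * y * Ω m := im_one_add_two_mul _ _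
      have hre : (1 + 2 * (⟨x, y⟩ : ℂ) * Ω m).re = 1 + 2 * x * Ω m := re_one_add_two_mul _ _
      by_contra hcon
      have := (Complex.arg_lt_pi_div_two_iff).1 (not_le.1 hcon)
      rw [him, hre] at this
      have hp : 0 < 2 * y * Ω m := by have := hΩ m; positivity
      rcases this with h | h | h
      · linarith
      · linarith
      · rw [h, Complex.zero_im] at him; linarith
    have hle := Finset.single_le_sum (f := fun k => (1 + Ω k) / Ω k *
        ((1 + 2 * (⟨x, y⟩ : ℂ) * Ω k).im / Complex.normSq (1 + 2 * (⟨x, y⟩ : ℂ) * Ω k)) +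
        (1 + 2 * (⟨x, y⟩ : ℂ) * Ω k).arg) (fun k _ => add_nonneg (hnn k) (hargnn k))
        (Finset.mem_univ m)
    simp only at hle ⊢
    have h1 := mul_le_mul_of_nonneg_left ((add_le_add (hnn m) harg).trans hle)
      (one_div_nonneg.2 hK'.le)
    have h2 : 2 * lam * y = 1 / (K : ℝ) * (Real.pi / 4) := by rw [hy]; field_simp; ring
    have h3 : 1 / (K : ℝ) * (Real.pi / 4) < 1 / (K : ℝ) * (0 + Real.pi / 2) :=
      mul_lt_mul_of_pos_left (by linarith [Real.pi_pos]) (by positivity)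
    linarith

/-- The zero set of `Im α` in the upper half plane is a curve over the reals left of the saddle. -/
theorem exists_level_curve (hK : 0 < K) (hΩ : ∀ k, 0 < Ω k) (hlam : 0 < lam) {s₀ : ℝ}
    (hs : s₀ ∈ realRegion Ω) (h0 : alphaDerivReal Ω lam s₀ = 0) :
    ∃ Y : ℝ → ℝ, (∀ x < s₀, 0 < Y x ∧ imAlpha Ω lam x (Y x) = 0) ∧
      (∀ x y, 0 < y → imAlpha Ω lam x y = 0 → x < s₀) ∧
      (∀ x < s₀, ∀ y, 0 < y → 0 < imAlpha Ω lam x y → Y x < y) ∧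
      (∀ x < s₀, ∀ y, 0 < y → imAlpha Ω lam x y < 0 → y < Y x) ∧
      (∀ x < s₀, ∀ y, 0 < y → imAlpha Ω lam x y = 0 → y = Y x) := by
  have hex : ∀ x, ∃ y, x < s₀ → 0 < y ∧ imAlpha Ω lam x y = 0 := by
    intro x
    by_cases hx : x < s₀
    swap
    · exact ⟨0, fun h => absurd h hx⟩
    obtain ⟨y₁, hy₁, h₁⟩ := exists_imAlpha_neg (lam := lam) hK hΩ hlam (x := x) fun hxr => by
      rw [← h0]; exact strictMonoOn_alphaDerivReal hK hΩ hxr hs hx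
    obtain ⟨y₂, hy₂, h₂⟩ := exists_imAlpha_pos (lam := lam) hK hΩ hlam x
    have hle : y₁ ≤ y₂ := by
      by_contra hcon
      have := (imAlpha_sign_of_lt (lam := lam) (x := x) hK hΩ hy₂ (not_le.1 hcon)).1 h₂.le
      linarith
    have hc : ContinuousOn (imAlpha Ω lam x) (Set.Icc y₁ y₂) := fun y hy =>
      (hasDerivAt_imAlpha (slitPlane_of_im_pos hΩ (hy₁.trans_le hy.1 :
        0 < (⟨x, y⟩ : ℂ).im))).continuousAt.continuousWithinAt
    obtain ⟨y, hy, h⟩ := intermediate_value_Icc hle hc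
      (show (0 : ℝ) ∈ Set.Icc _ _ from ⟨h₁.le, h₂.le⟩)
    exact ⟨y, fun _ => ⟨hy₁.trans_le hy.1, h⟩⟩
  choose Y hY using hex
  refine ⟨Y, hY, fun x y hy h => ?_, fun x hx y hy h => ?_, fun x hx y hy h => ?_,
    fun x hx y hy h => ?_⟩
  · by_contra hcon
    rw [not_lt] at hcon
    have hxr : x ∈ realRegion Ω := fun k => by
      have := hs k; have := hΩ k; nlinarith
    have := imAlpha_pos_of_le (lam := lam) hK hΩ hxr
      (by rw [← h0]; exact (strictMonoOn_alphaDerivReal hK hΩ).monotoneOn hs hxr hcon) hy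
    linarith
  · obtain ⟨h1, h2⟩ := hY x hx
    rcases lt_trichotomy (Y x) y with h3 | h3 | h3
    · exact h3
    · rw [h3] at h2; linarith
    · have := (imAlpha_sign_of_lt (lam := lam) (x := x) hK hΩ hy h3).1 h.le; linarith
  · obtain ⟨h1, h2⟩ := hY x hx
    rcases lt_trichotomy y (Y x) with h3 | h3 | h3
    · exact h3
    · rw [h3] at h; linarith
    · have := (imAlpha_sign_of_lt (lam := lam) (x := x) hK hΩ h1 h3).2 h.le; linarith
  · obtain ⟨h1, h2⟩ := hY x hx
    rcases lt_trichotomy y (Y x) with h3 | h3 | h3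
    · have := (imAlpha_sign_of_lt (lam := lam) (x := x) hK hΩ hy h3).1 h.ge; linarith
    · exact h3
    · have := (imAlpha_sign_of_lt (lam := lam) (x := x) hK hΩ h1 h3).1 h2.ge; linarith

theorem continuousAt_imAlpha_left {x y : ℝ}
    (hs : ∀ k, 1 + 2 * (⟨x, y⟩ : ℂ) * Ω k ∈ Complex.slitPlane) :
    ContinuousAt (fun t => imAlpha Ω lam t y) x := by
  have h1 : ContinuousAt (fun t : ℝ => (⟨t, y⟩ : ℂ)) x := by
    simp_rw [Complex.mk_eq_add_mul_I]; fun_prop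
  exact Complex.continuous_im.continuousAt.comp
    (ContinuousAt.comp (g := alpha Ω lam) (hasDerivAt_alpha hs).continuousAt h1)

theorem analyticAt_alpha {s : ℂ} (hs : ∀ k, 1 + 2 * s * Ω k ∈ Complex.slitPlane) :
    AnalyticAt ℂ (alpha Ω lam) s := by
  rw [Complex.analyticAt_iff_eventually_differentiableAt]
  have : ∀ᶠ z : ℂ in 𝓝 s, ∀ k, 1 + 2 * z * Ω k ∈ Complex.slitPlane :=
    eventually_all.2 fun k => ContinuousAt.eventually_mem
      (f := fun z : ℂ => 1 + 2 * z * Ω k) (by fun_prop) (Complex.isOpen_slitPlane.mem_nhds (hs k))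
  filter_upwards [this] with z hz
  exact (hasDerivAt_alpha hz).differentiableAt

/-- Values on the level curve: for every real `v`, the equation `α(s) = v` has a solution in the
upper half plane if and only if `v < α(s₀)`, and at most one. -/
theorem existsUnique_upper (hK : 0 < K) (hΩ : ∀ k, 0 < Ω k) (hlam : 0 < lam) {s₀ : ℝ}
    (hs : s₀ ∈ realRegion Ω) (h0 : alphaDerivReal Ω lam s₀ = 0) :
    (∀ v < alphaReal Ω lam s₀, ∃ s : ℂ, 0 < s.im ∧ alpha Ω lam s = v) ∧
    (∀ s : ℂ, ∀ v : ℝ, 0 < s.im → alpha Ω lam s = v → v < alphaReal Ω lam s₀) ∧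
    (∀ s s' : ℂ, ∀ v : ℝ, 0 < s.im → 0 < s'.im → alpha Ω lam s = v → alpha Ω lam s' = v →
      s = s') := by
  obtain ⟨Y, hY, hlt, hYlt, hltY, hYu⟩ := exists_level_curve hK hΩ hlam hs h0
  have hslit : ∀ x < s₀, ∀ k, 1 + 2 * (⟨x, Y x⟩ : ℂ) * Ω k ∈ Complex.slitPlane := fun x hx =>
    slitPlane_of_im_pos hΩ (hY x hx).1
  -- continuity of the curve
  have hYc : ∀ x < s₀, ContinuousAt Y x := by
    intro x hx
    refine tendsto_order.2 ⟨fun a ha => ?_, fun a ha => ?_⟩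
    · set c := max a (Y x / 2) with hc
      have hc0 : 0 < c := lt_max_of_lt_right (half_pos (hY x hx).1)
      have hcY : c < Y x := max_lt ha (half_lt_self (hY x hx).1)
      have h1 := (imAlpha_sign_of_lt (lam := lam) (x := x) hK hΩ hc0 hcY).2 (hY x hx).2.le
      have h2 := (continuousAt_imAlpha_left (lam := lam)
        (slitPlane_of_im_pos hΩ (hc0 : 0 < (⟨x, c⟩ : ℂ).im))).eventually (gt_mem_nhds h1)
      filter_upwards [h2, gt_mem_nhds hx] with t ht hts
      exact (le_max_left _ _).trans_lt (hltY t hts c hc0 ht)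
    · have ha0 : 0 < a := (hY x hx).1.trans ha
      have h1 := (imAlpha_sign_of_lt (lam := lam) (x := x) hK hΩ (hY x hx).1 ha).1 (hY x hx).2.ge
      have h2 := (continuousAt_imAlpha_left (lam := lam)
        (slitPlane_of_im_pos hΩ (ha0 : 0 < (⟨x, a⟩ : ℂ).im))).eventually (lt_mem_nhds h1)
      filter_upwards [h2, gt_mem_nhds hx] with t ht hts
      exact hYlt t hts a ha0 ht
  have hY0 : Tendsto Y (𝓝[<] s₀) (𝓝 0) := by
    refine tendsto_order.2 ⟨fun a ha => ?_, fun a ha => ?_⟩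
    · filter_upwards [self_mem_nhdsWithin] with t ht
      exact ha.trans (hY t ht).1
    · have h1 := imAlpha_pos_of_le (lam := lam) hK hΩ hs h0.ge ha
      have h2 := (continuousAt_imAlpha_left (lam := lam)
        (slitPlane_of_im_pos hΩ (ha : 0 < (⟨s₀, a⟩ : ℂ).im))).eventually (lt_mem_nhds h1)
      filter_upwards [self_mem_nhdsWithin, nhdsWithin_le_nhds h2] with t hts ht
      exact hYlt t hts a ha ht
  -- the values along the curve
  set r : ℝ → ℝ := fun x => (alpha Ω lam ⟨x, Y x⟩).re with hr
  have hval : ∀ x < s₀, alpha Ω lam ⟨x, Y x⟩ = (r x : ℂ) := fun x hx =>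
    Complex.ext (by simp [hr]) (by simpa [imAlpha] using (hY x hx).2)
  have hcurve : ∀ x < s₀, ContinuousAt (fun t => (⟨t, Y t⟩ : ℂ)) x := fun x hx => by
    have := hYc x hx
    simp_rw [Complex.mk_eq_add_mul_I]
    fun_prop
  have hrc : ∀ x < s₀, ContinuousAt r x := fun x hx =>
    Complex.continuous_re.continuousAt.comp
      (ContinuousAt.comp (g := alpha Ω lam) (hasDerivAt_alpha (hslit x hx)).continuousAt
        (hcurve x hx))
  have hrpos : ∀ x < s₀, 0 < deriv r x := by
    intro x hx
    set w : ℂ := ⟨x, Y x⟩ with hw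
    -- On the curve `Im α = 0`, so `im_alpha_lt` forces `Re α' > 0`.
    have hre : 0 < (alphaDeriv Ω lam w).re := by
      have := im_alpha_lt (lam := lam) hK hΩ (s := w) (hY x hx).1
      rw [hval x hx, Complex.ofReal_im] at this
      exact pos_of_mul_pos_right this (hY x hx).1.le
    have hne : alphaDeriv Ω lam w ≠ 0 := fun h => by rw [h] at hre; simp at hre
    have hst : HasStrictDerivAt (alpha Ω lam) (alphaDeriv Ω lam w) w := by
      have := (analyticAt_alpha (lam := lam) (hslit x hx)).hasStrictDerivAt
      rwa [(hasDerivAt_alpha (hslit x hx)).deriv] at this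
    have hg := (hst.to_localInverse hne).hasDerivAt
    have hleft := HasStrictDerivAt.eventually_left_inverse hst hne
    set g := hst.localInverse _ _ _ hne with hgdef
    rw [hval x hx] at hg
    -- Differentiability of `Y` is not needed: the real part of a local inverse of `α` is a left
    -- inverse of `r`, so `r' = 1 / Re(1 / α')`.
    have hG : HasDerivAt (fun t : ℝ => (g t).re) ((alphaDeriv Ω lam w)⁻¹).re (r x) :=
      hg.real_of_complex
    have hGpos : 0 < ((alphaDeriv Ω lam w)⁻¹).re := by
      rw [Complex.inv_re]; exact div_pos hre (Complex.normSq_pos.2 hne)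
    have hev : ∀ᶠ t in 𝓝 x, (g (r t : ℂ)).re = t := by
      filter_upwards [(hcurve x hx).eventually hleft, gt_mem_nhds hx] with t ht hts
      rw [← hval t hts, ht]
    have := HasDerivAt.of_local_left_inverse (hrc x hx) hG hGpos.ne' hev
    rw [this.deriv]
    exact inv_pos.2 hGpos
  have hmono : StrictMonoOn r (Set.Iio s₀) :=
    strictMonoOn_of_deriv_pos (convex_Iio s₀) (fun x hx => (hrc x hx).continuousWithinAt)
      fun x hx => hrpos x (by rwa [interior_Iio] at hx)
  have hlim : Tendsto r (𝓝[<] s₀) (𝓝 (alphaReal Ω lam s₀)) := by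
    have h1 : Tendsto (fun t => (⟨t, Y t⟩ : ℂ)) (𝓝[<] s₀) (𝓝 (s₀ : ℂ)) := by
      simp_rw [Complex.mk_eq_add_mul_I]
      have h2 : Tendsto (fun t : ℝ => (t : ℂ)) (𝓝[<] s₀) (𝓝 (s₀ : ℂ)) :=
        (Complex.continuous_ofReal.tendsto s₀).mono_left nhdsWithin_le_nhds
      have h3 : Tendsto (fun t : ℝ => (Y t : ℂ)) (𝓝[<] s₀) (𝓝 ((0 : ℝ) : ℂ)) :=
        (Complex.continuous_ofReal.tendsto _).comp hY0
      simpa using h2.add (h3.mul_const Complex.I)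
    have h4 := ((hasDerivAt_alpha (lam := lam) (slitPlane_of_mem_region hΩ
      ((ofReal_mem_regionAlpha hΩ).2 hs))).continuousAt.tendsto).comp h1
    have h5 := (Complex.continuous_re.tendsto _).comp h4
    rw [alpha_ofReal hs, Complex.ofReal_re] at h5
    exact h5
  have hrlt : ∀ x < s₀, r x < alphaReal Ω lam s₀ := by
    intro x hx
    obtain ⟨x', hx', hx's⟩ := exists_between hx
    refine (hmono hx hx's hx').trans_le (ge_of_tendsto hlim ?_)
    filter_upwards [Ioo_mem_nhdsLT hx's] with t ht
    exact (hmono hx's ht.2 ht.1).le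
  have hon : ∀ s : ℂ, ∀ v : ℝ, 0 < s.im → alpha Ω lam s = v →
      s.re < s₀ ∧ s = ⟨s.re, Y s.re⟩ ∧ r s.re = v := by
    intro s v hsim hv
    have him : imAlpha Ω lam s.re s.im = 0 := by simp [imAlpha, hv]
    have h1 := hlt _ _ hsim him
    have h2 : s = ⟨s.re, Y s.re⟩ := Complex.ext rfl (hYu _ h1 _ hsim him)
    refine ⟨h1, h2, ?_⟩
    rw [hr]
    simp only
    rw [← h2, hv, Complex.ofReal_re]
  refine ⟨fun v hv => ?_, fun s v hsim hv => ?_, fun s s' v hsim hs'im hv hv' => ?_⟩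
  · obtain ⟨x₂, hx₂, hx₂s⟩ := ((hlim.eventually (lt_mem_nhds hv)).and self_mem_nhdsWithin).exists
    -- Once all `1 + 2 x Ω_k ≤ -1`, every summand in `re_alpha` is nonnegative, so `r x ≤ 2 λ x`.
    have hbot : ∀ᶠ x in atBot, r x < v := by
      have hneg : ∀ᶠ x : ℝ in atBot, ∀ k, 2 * x * Ω k ≤ -2 := eventually_all.2 fun k =>
        ((tendsto_id.const_mul_atBot two_pos).atBot_mul_const (hΩ k)).eventually_le_atBot (-2)
      filter_upwards [hneg, (tendsto_id.const_mul_atBot (by positivity : 0 < 2 * lam)).eventually_lt_atBot v, eventually_lt_atBot s₀] with x hx hxv hxs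
      refine lt_of_le_of_lt ?_ hxv
      rw [hr]
      simp only
      rw [re_alpha hΩ fun k => Complex.slitPlane_ne_zero (hslit x hxs k)]
      simp only [id]
      refine sub_le_self _ (mul_nonneg (by positivity) (Finset.sum_nonneg fun k _ => ?_))
      have hre : (1 + 2 * (⟨x, Y x⟩ : ℂ) * Ω k).re = 1 + 2 * x * Ω k := re_one_add_two_mul _ _
      have hxk := hx k
      have hΩk := hΩ k
      have hnorm : 1 ≤ ‖1 + 2 * (⟨x, Y x⟩ : ℂ) * Ω k‖ := by
        refine le_trans ?_ (Complex.abs_re_le_norm _)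
        rw [hre, abs_of_nonpos (by linarith)]
        linarith
      have h1 : (1 + 2 * (⟨x, Y x⟩ : ℂ) * Ω k).re / Complex.normSq (1 + 2 * (⟨x, Y x⟩ : ℂ) * Ω k)
          ≤ 0 := div_nonpos_of_nonpos_of_nonneg (by rw [hre]; linarith) (Complex.normSq_nonneg _)
      have h2 : 0 ≤ (1 + Ω k) / Ω k := by positivity
      have h3 := Real.log_nonneg hnorm
      have h4 := mul_nonneg h2 (by linarith : 0 ≤ 1 - (1 + 2 * (⟨x, Y x⟩ : ℂ) * Ω k).re / Complex.normSq (1 + 2 * (⟨x, Y x⟩ : ℂ) * Ω k))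
      linarith
    obtain ⟨x₁, hx₁, hx₁₂⟩ := (hbot.and (eventually_le_atBot x₂)).exists
    obtain ⟨x, hx, h⟩ := intermediate_value_Icc hx₁₂ (f := r)
      (fun t ht => (hrc t (ht.2.trans_lt hx₂s)).continuousWithinAt) ⟨hx₁.le, hx₂.le⟩
    have hxs : x < s₀ := hx.2.trans_lt hx₂s
    exact ⟨⟨x, Y x⟩, (hY x hxs).1, by rw [hval x hxs, h]⟩
  · obtain ⟨h1, -, h3⟩ := hon s v hsim hv
    exact h3 ▸ hrlt _ h1
  · obtain ⟨h1, h2, h3⟩ := hon s v hsim hv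
    obtain ⟨h1', h2', h3'⟩ := hon s' v hs'im hv'
    have := hmono.injOn h1 h1' (h3.trans h3'.symm)
    rw [h2, h2', this]

/-- The points of a steepest descent path with nonnegative parameter. -/
def IsDescentPoint (Ω : Fin K → ℝ) (lam s₀ u : ℝ) (s : ℂ) : Prop :=
  (∀ k, 1 + 2 * s * Ω k ∈ Complex.slitPlane) ∧ 0 ≤ s.im ∧
    alpha Ω lam s = alpha Ω lam s₀ - (u : ℂ) ^ 2

/-- On the real axis the slit condition is membership in the region, where `α ≥ α(s₀)` with equality
only at `s₀`; the value `α(s₀) - u²` then leaves only `u = 0`. -/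
theorem isDescentPoint_im_zero (hK : 0 < K) (hΩ : ∀ k, 0 < Ω k) {s₀ u : ℝ}
    (hs : s₀ ∈ realRegion Ω) (h0 : alphaDerivReal Ω lam s₀ = 0) {s : ℂ}
    (h : IsDescentPoint Ω lam s₀ u s) (him : s.im = 0) : s = s₀ ∧ u = 0 := by
  obtain ⟨h1, -, h3⟩ := h
  have hre : s = (s.re : ℂ) := Complex.ext rfl (by simpa using him)
  have hmem : s.re ∈ realRegion Ω := fun k => by
    rcases h1 k with h | h
    · rwa [re_one_add_two_mul] at h
    · rw [im_one_add_two_mul, him] at h; simp at h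
  rw [hre, alpha_ofReal hmem, alpha_ofReal hs] at h3
  have h4 : alphaReal Ω lam s.re = alphaReal Ω lam s₀ - u ^ 2 := by exact_mod_cast h3
  by_cases hne : s.re = s₀
  · rw [hne] at h4
    exact ⟨by rw [hre, hne], by nlinarith⟩
  · have := alphaReal_lt hK hΩ hs h0 hmem hne
    nlinarith

theorem existsUnique_descentPoint (hK : 0 < K) (hΩ : ∀ k, 0 < Ω k) (hlam : 0 < lam) {s₀ : ℝ}
    (hs : s₀ ∈ realRegion Ω) (h0 : alphaDerivReal Ω lam s₀ = 0) (u : ℝ) :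
    ∃! s : ℂ, IsDescentPoint Ω lam s₀ u s := by
  obtain ⟨hex, hlt, huniq⟩ := existsUnique_upper hK hΩ hlam hs h0
  have hcast : alpha Ω lam s₀ - (u : ℂ) ^ 2 = ((alphaReal Ω lam s₀ - u ^ 2 : ℝ) : ℂ) := by
    rw [alpha_ofReal hs]; push_cast; rfl
  by_cases hu : u = 0
  · refine ⟨s₀, ⟨slitPlane_of_mem_region hΩ ((ofReal_mem_regionAlpha hΩ).2 hs), by simp, by simp [hu]⟩, fun s h => ?_⟩
    rcases h.2.1.eq_or_lt with him | him
    · exact (isDescentPoint_im_zero hK hΩ hs h0 h him.symm).1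
    · have := hlt s _ him (h.2.2.trans hcast)
      rw [hu] at this
      norm_num at this
  · obtain ⟨s, hsim, hsv⟩ := hex (alphaReal Ω lam s₀ - u ^ 2) (sub_lt_self _ (by positivity))
    refine ⟨s, ⟨slitPlane_of_im_pos hΩ hsim, hsim.le, hsv.trans hcast.symm⟩, fun s' h => ?_⟩
    rcases h.2.1.eq_or_lt with him | him
    · exact absurd (isDescentPoint_im_zero hK hΩ hs h0 h him.symm).2 hu
    · exact huniq s' s _ him hsim (h.2.2.trans hcast) hsv

theorem IsSteepestDescentPath.isDescentPoint {s₀ : ℝ} {p : ℝ → ℂ}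
    (hp : IsSteepestDescentPath Ω lam s₀ p) {u : ℝ} (hu : 0 ≤ u) :
    IsDescentPoint Ω lam s₀ u (p u) :=
  ⟨hp.mem_domain u, hp.im_nonneg u hu, hp.descent u hu⟩

theorem conj_mem_slitPlane {s : ℂ} {w : ℝ} (h : 1 + 2 * s * w ∈ Complex.slitPlane) :
    1 + 2 * (starRingEnd ℂ) s * w ∈ Complex.slitPlane := by
  rcases h with h | h
  · left; simpa using h
  · right; simpa using h

/-- Each nonnegative parameter determines its point and conjugation determines the rest, so
uniqueness requires no continuity of the path. -/
theorem existsUnique_path (hK : 0 < K) (hΩ : ∀ k, 0 < Ω k) (hlam : 0 < lam) {s₀ : ℝ}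
    (hs : s₀ ∈ realRegion Ω) (h0 : alphaDerivReal Ω lam s₀ = 0) :
    ∃! p : ℝ → ℂ, IsSteepestDescentPath Ω lam s₀ p := by
  choose q hq hqu using existsUnique_descentPoint hK hΩ hlam hs h0
  have hqu : ∀ u s, IsDescentPoint Ω lam s₀ u s → s = q u := hqu
  refine ⟨fun u => if 0 ≤ u then q u else (starRingEnd ℂ) (q (-u)), ?_, fun p hp => ?_⟩
  · constructor
    · intro u k
      split_ifs with hu
      · exact (hq u).1 k
      · exact conj_mem_slitPlane ((hq (-u)).1 k)
    · intro u hu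
      simp only [hu, if_true]
      exact (hq u).2.1
    · intro u hu
      simp only [hu, if_true]
      exact (hq u).2.2
    · intro u hu
      simp [not_le.2 hu, hu.le]
  · funext u
    split_ifs with hu
    · exact hqu _ _ (hp.isDescentPoint hu)
    · rw [hp.symm u (not_le.1 hu), hqu _ _ (hp.isDescentPoint (u := -u) (by linarith))]

end DescentPath

/-! ### The recursions as identities between power series -/

/-- In the coefficient `m + 1` of `F²` the index `m` occurs only in the two products with `F.coeff
1`, because `F.coeff 0 = 0`; solving for it is the recursion. -/
theorem coeff_eq_fCoeff {a : ℕ → ℝ} (ha : 0 < a 2) {F : PowerSeries ℂ}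
    (h0 : F.coeff 0 = 0) (h1 : F.coeff 1 = -Complex.I * (Real.sqrt (a 2) : ℂ))
    (h2 : ∀ m, 2 ≤ m → (F * F).coeff (m + 1) = -(a (m + 1) : ℂ)) (m : ℕ) :
    F.coeff m = fCoeff a m := by
  induction m using Nat.strong_induction_on with
  | _ m ih =>
    match m, ih with
    | 0, _ => rw [h0, fCoeff]
    | 1, _ => rw [h1, fCoeff]
    | r + 2, ih =>
      have hsq := h2 (r + 2) (by omega)
      -- Indices `0` and `r + 3` contribute nothing, indices `1` and `r + 2` give the unknown twice;
      -- these four are split off.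
      rw [PowerSeries.coeff_mul, Finset.Nat.sum_antidiagonal_eq_sum_range_succ_mk,
        Finset.sum_range_succ, Finset.sum_range_succ, Finset.sum_range_succ',
        Finset.sum_range_succ'] at hsq
      simp only [Nat.sub_self, h0, mul_zero, zero_mul, add_zero, zero_add, Nat.sub_zero] at hsq
      rw [show r + 2 + 1 - (r + 2) = 1 by omega, show r + 2 + 1 - 1 = r + 2 by omega] at hsq
      have hsum : ∑ j : Fin r, fCoeff a (j + 2) * fCoeff a (r + 1 - j) =
          ∑ k ∈ Finset.range r, F.coeff (k + 1 + 1) * F.coeff (r + 2 + 1 - (k + 1 + 1)) := by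
        rw [Fin.sum_univ_eq_sum_range (fun j => fCoeff a (j + 2) * fCoeff a (r + 1 - j))]
        refine Finset.sum_congr rfl fun j hj => ?_
        rw [Finset.mem_range] at hj
        rw [ih (j + 1 + 1) (by omega), ih (r + 2 + 1 - (j + 1 + 1)) (by omega)]
        congr 2
        omega
      have hne : F.coeff 1 ≠ 0 := by
        rw [h1]
        have : (Real.sqrt (a 2) : ℂ) ≠ 0 := by exact_mod_cast (Real.sqrt_pos.2 ha).ne'
        simp [Complex.I_ne_zero, this]
      rw [fCoeff, hsum, ← h1]
      field_simp
      linear_combination hsq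

/-- Comparing coefficients in `G (G^l)' = l G' G^l` expresses each coefficient of the power through
earlier ones. The shift between `f` and `G` reflects `F = X G`, so that `P_{l, l+N}` is the
coefficient `N` of `G^l`. -/
theorem coeff_pow_eq_powerAux {G : PowerSeries ℂ} (h0 : G.coeff 0 ≠ 0) {f : ℕ → ℂ}
    (hf : ∀ m, f (m + 1) = G.coeff m) (l N : ℕ) : (G ^ l).coeff N = powerAux f l N := by
  induction N using Nat.strong_induction_on with
  | _ N ih =>
    match N, ih with
    | 0, _ => rw [powerAux, hf]; simp
    | N + 1, ih =>
      have hder : G * PowerSeries.derivative ℂ (G ^ l) =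
          (l : PowerSeries ℂ) * (PowerSeries.derivative ℂ G * G ^ l) := by
        rw [Derivation.leibniz_pow]
        rcases l with _ | l
        · simp
        · simp only [nsmul_eq_mul, smul_eq_mul, Nat.add_sub_cancel]
          ring
      have hc := congrArg (PowerSeries.coeff N) hder
      have hnat : ((l : ℕ) : PowerSeries ℂ) = PowerSeries.C (l : ℂ) := by simp
      rw [hnat, PowerSeries.coeff_C_mul, PowerSeries.coeff_mul, PowerSeries.coeff_mul,
        Finset.Nat.sum_antidiagonal_eq_sum_range_succ_mk,
        Finset.Nat.sum_antidiagonal_eq_sum_range_succ_mk] at hc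
      simp only [PowerSeries.coeff_derivative] at hc
      rw [Finset.sum_range_succ'] at hc
      -- The added term `k = N` has the factor `N - k = 0`; both sums then have the same range.
      have hext : ∑ k ∈ Finset.range N, G.coeff (k + 1) *
          ((G ^ l).coeff (N - (k + 1) + 1) * (((N - (k + 1) : ℕ) : ℂ) + 1)) =
          ∑ k ∈ Finset.range (N + 1), G.coeff (k + 1) * ((G ^ l).coeff (N - k) * ((N : ℂ) - k)) := by
        rw [Finset.sum_range_succ _ N, sub_self, mul_zero, mul_zero, add_zero]
        refine Finset.sum_congr rfl fun k hk => ?_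
        rw [Finset.mem_range] at hk
        rw [show N - (k + 1) + 1 = N - k by omega, Nat.cast_sub (by omega)]
        push_cast
        ring
      rw [hext, Finset.mul_sum] at hc
      simp only [Nat.sub_zero] at hc
      have hN : (N : ℂ) + 1 ≠ 0 := Nat.cast_add_one_ne_zero N
      have hc' : (G ^ l).coeff (N + 1) = ∑ k ∈ Finset.range (N + 1),
          (((k : ℂ) + 1) * l - (N + 1) + (k + 1)) / (N + 1) * (G.coeff (k + 1) / G.coeff 0) *
            (G ^ l).coeff (N - k) := by
        have e1 : (G ^ l).coeff (N + 1) = ((N + 1) * G.coeff 0)⁻¹ *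
            (G.coeff 0 * ((G ^ l).coeff (N + 1) * ((N : ℂ) + 1))) := by
          field_simp
        rw [e1, eq_sub_of_add_eq' hc, ← Finset.sum_sub_distrib, Finset.mul_sum]
        refine Finset.sum_congr rfl fun k _ => ?_
        field_simp
        ring
      rw [hc', powerAux, Fin.sum_univ_eq_sum_range (fun j => (((j : ℂ) + 1) * l - (N + 1) + (j + 1)) /
        (N + 1) * (f (j + 2) / f 1) * powerAux f l (N - j))]
      refine Finset.sum_congr rfl fun k hk => ?_
      rw [ih (N - k) (by omega), hf (k + 1), hf 0]

/-- The hypothesis on the sums is the coefficient `m` of `Q ∘ F = id`, truncated because `X^l`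
divides `F^l`. The term `l = m` carries the factor `(F.coeff 1)^m` and can be solved for. -/
theorem coeff_eq_pCoeff {F Q : PowerSeries ℂ} {s₀ : ℝ} (hF0 : F.coeff 0 = 0)
    (hF1 : F.coeff 1 ≠ 0) (hQ0 : Q.coeff 0 = s₀) (hQ1 : Q.coeff 1 = 1 / F.coeff 1)
    (h : ∀ m, 2 ≤ m → ∑ l ∈ Finset.range (m + 1), Q.coeff l * (F ^ l).coeff m = 0) (m : ℕ) :
    Q.coeff m = pCoeff s₀ (fun k => F.coeff k) m := by
  obtain ⟨G, hG⟩ : PowerSeries.X ∣ F := by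
    rw [PowerSeries.X_dvd_iff, ← PowerSeries.coeff_zero_eq_constantCoeff_apply, hF0]
  have hGF : ∀ m, F.coeff (m + 1) = G.coeff m := fun m => by rw [hG, PowerSeries.coeff_succ_X_mul]
  have hG0 : G.coeff 0 ≠ 0 := by rw [← hGF]; exact hF1
  have hpow : ∀ l m, l ≤ m → (F ^ l).coeff m = powerCoeff (fun k => F.coeff k) l m := by
    intro l m hlm
    rw [powerCoeff, ← coeff_pow_eq_powerAux hG0 hGF, hG, mul_pow, PowerSeries.coeff_X_pow_mul',
      if_pos hlm]
  induction m using Nat.strong_induction_on with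
  | _ m ih =>
    match m, ih with
    | 0, _ => rw [hQ0, pCoeff]
    | 1, _ => rw [hQ1, pCoeff]
    | r + 2, ih =>
      have hm := h (r + 2) (by omega)
      rw [Finset.sum_range_succ, Finset.sum_range_succ', pow_zero, PowerSeries.coeff_one,
        if_neg (by omega), mul_zero, add_zero, hpow _ _ le_rfl, powerCoeff_self] at hm
      have hsum : ∑ j : Fin (r + 1), pCoeff s₀ (fun k => F.coeff k) (j + 1) *
          powerCoeff (fun k => F.coeff k) (j + 1) (r + 2) =
          ∑ k ∈ Finset.range (r + 1), Q.coeff (k + 1) * (F ^ (k + 1)).coeff (r + 2) := by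
        rw [Fin.sum_univ_eq_sum_range (fun j => pCoeff s₀ (fun k => F.coeff k) (j + 1) *
          powerCoeff (fun k => F.coeff k) (j + 1) (r + 2))]
        refine Finset.sum_congr rfl fun j hj => ?_
        rw [Finset.mem_range] at hj
        rw [ih (j + 1) (by omega), hpow _ _ (by omega)]
      rw [pCoeff, hsum]
      have := pow_ne_zero (r + 2) hF1
      field_simp
      linear_combination hm

/-- In the coefficient `m` of `Q' = Q C` the unknown occurs once, multiplied by `Q.coeff 0 = s₀ ≠
0`. -/
theorem coeff_eq_cCoeff {Q C : PowerSeries ℂ} {s₀ : ℝ} (hs : s₀ ≠ 0) (hQ0 : Q.coeff 0 = s₀)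
    (h : PowerSeries.derivative ℂ Q = Q * C) (m : ℕ) :
    C.coeff m = cCoeff s₀ (fun k => Q.coeff k) m := by
  have hs' : (s₀ : ℂ) ≠ 0 := by exact_mod_cast hs
  induction m using Nat.strong_induction_on with
  | _ m ih =>
    have hm := congrArg (PowerSeries.coeff m) h
    rw [PowerSeries.coeff_derivative, PowerSeries.coeff_mul,
      Finset.Nat.sum_antidiagonal_eq_sum_range_succ_mk, Finset.sum_range_succ', hQ0] at hm
    simp only [Nat.sub_zero] at hm
    have hsum : ∑ j : Fin m, Q.coeff (j + 1) * cCoeff s₀ (fun k => Q.coeff k) (m - (j + 1)) =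
        ∑ k ∈ Finset.range m, Q.coeff (k + 1) * C.coeff (m - (k + 1)) := by
      rw [Fin.sum_univ_eq_sum_range (fun j => Q.coeff (j + 1) *
        cCoeff s₀ (fun k => Q.coeff k) (m - (j + 1)))]
      refine Finset.sum_congr rfl fun j hj => ?_
      rw [Finset.mem_range] at hj
      rw [ih _ (by omega)]
    rw [cCoeff, hsum]
    field_simp
    linear_combination -hm

/-! ### Reality of the coefficients -/

/-- Products of two imaginary coefficients are real, and the recursion divides a real number by the
imaginary `2 f_1`. -/
theorem fCoeff_re (a : ℕ → ℝ) (m : ℕ) : (fCoeff a m).re = 0 := by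
  induction m using Nat.strong_induction_on with
  | _ m ih =>
    match m, ih with
    | 0, _ => rw [fCoeff]; simp
    | 1, _ => rw [fCoeff]; simp
    | r + 2, ih =>
      rw [fCoeff]
      have h1 : ∀ k < r + 2, fCoeff a k = ((fCoeff a k).im : ℂ) * Complex.I := fun k hk =>
        Complex.ext (by simpa using ih k hk) (by simp)
      have h2 : ∑ j : Fin r, fCoeff a (j + 2) * fCoeff a (r + 1 - j) =
          ((-∑ j : Fin r, (fCoeff a (j + 2)).im * (fCoeff a (r + 1 - j)).im : ℝ) : ℂ) := by
        push_cast
        rw [← Finset.sum_neg_distrib]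
        refine Finset.sum_congr rfl fun j _ => ?_
        rw [h1 (j + 2) (by omega), h1 (r + 1 - j) (by omega)]
        simp only [Complex.mul_im, Complex.ofReal_im, Complex.I_im, Complex.ofReal_re,
          Complex.I_re, mul_one, mul_zero, add_zero]
        linear_combination ((fCoeff a (j + 2)).im : ℂ) * (fCoeff a (r + 1 - j)).im * Complex.I_mul_I
      rw [h2, show -(1 / (2 * (-Complex.I * (Real.sqrt (a 2) : ℂ)))) =
        -((1 / (2 * Real.sqrt (a 2)) : ℝ) : ℂ) * Complex.I by
          push_cast
          rw [one_div, mul_inv, mul_inv, inv_neg, Complex.inv_I, one_div, mul_inv]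
          ring, ← Complex.ofReal_add]
      simp

/-- The real multiples of `w ^ m` and of its inverse. -/
theorem powerAux_real {f : ℕ → ℂ} (hf : ∀ m, ∃ r : ℝ, f m = r * f 1) (l N : ℕ) :
    ∃ r : ℝ, powerAux f l N = r * f 1 ^ l := by
  induction N using Nat.strong_induction_on with
  | _ N ih =>
    match N, ih with
    | 0, _ => exact ⟨1, by rw [powerAux]; simp⟩
    | N + 1, ih =>
      choose! g hg using ih
      choose h hh using hf
      -- The case distinction matches the convention that a quotient by `f 1 = 0` is `0`.
      refine ⟨∑ j : Fin (N + 1), (((j : ℝ) + 1) * l - (N + 1) + (j + 1)) / (N + 1) *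
        (if f 1 = 0 then 0 else h (j + 2)) * g (N - j), ?_⟩
      rw [powerAux]
      push_cast
      rw [Finset.sum_mul]
      refine Finset.sum_congr rfl fun j _ => ?_
      rw [hg (N - j) (by omega), hh (j + 2)]
      split_ifs with h1
      · simp [h1]
      · rw [mul_div_cancel_right₀ _ h1]; ring

/-- The recursion is homogeneous: in terms of the ratios `f_m / f_1`, only `f_1^{-m}` remains as a
factor that is not real. With imaginary `f_1` the parity of `m` decides between real and imaginary.
-/
theorem pCoeff_real {f : ℕ → ℂ} (hf1 : f 1 ≠ 0) (hf : ∀ m, ∃ r : ℝ, f m = r * f 1) (s₀ : ℝ)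
    (m : ℕ) : ∃ r : ℝ, pCoeff s₀ f m = r * (1 / f 1 ^ m) := by
  induction m using Nat.strong_induction_on with
  | _ m ih =>
    match m, ih with
    | 0, _ => exact ⟨s₀, by rw [pCoeff]; simp⟩
    | 1, _ => exact ⟨1, by rw [pCoeff]; simp⟩
    | r + 2, ih =>
      choose! g hg using ih
      have hp : ∀ l, ∃ t : ℝ, powerCoeff f l (r + 2) = t * f 1 ^ l := fun l => powerAux_real hf l _
      choose t ht using hp
      refine ⟨-∑ j : Fin (r + 1), g (j + 1) * t (j + 1), ?_⟩
      rw [pCoeff]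
      push_cast
      rw [neg_mul, neg_mul, mul_comm (1 / f 1 ^ (r + 2))]
      congr 2
      refine Finset.sum_congr rfl fun j _ => ?_
      rw [hg (j + 1) (by omega), ht (j + 1)]
      have := pow_ne_zero (j + 1 : ℕ) hf1
      field_simp

theorem cCoeff_real {w : ℂ} {p : ℕ → ℂ} (hp : ∀ m, ∃ r : ℝ, p m = r * (1 / w ^ m)) (s₀ : ℝ)
    (m : ℕ) : ∃ r : ℝ, cCoeff s₀ p m = r * (1 / w ^ (m + 1)) := by
  choose g hg using hp
  induction m using Nat.strong_induction_on with
  | _ m ih =>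
    choose! h hh using ih
    refine ⟨1 / s₀ * ((m + 1) * g (m + 1) - ∑ j : Fin m, g (j + 1) * h (m - (j + 1))), ?_⟩
    rw [cCoeff]
    push_cast
    rw [mul_assoc, sub_mul, Finset.sum_mul, hg (m + 1)]
    congr 2
    · ring
    · refine Finset.sum_congr rfl fun j _ => ?_
      rw [hg (j + 1), hh (m - (j + 1)) (by omega)]
      have hpow : w ^ (m + 1) = w ^ ((j : ℕ) + 1) * w ^ (m - (j + 1) + 1) := by
        rw [← pow_add]; congr 1; omega
      rw [hpow]
      simp only [one_div, mul_inv]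
      ring

theorem re_eq_zero_of_imag_pow {w : ℂ} (hw : w.re = 0) {m : ℕ} (r : ℝ) :
    (r * (1 / w ^ (2 * m + 1)) : ℂ).re = 0 ∧ (r * (1 / w ^ (2 * m)) : ℂ).im = 0 := by
  have h : w = (w.im : ℂ) * Complex.I := Complex.ext (by simpa using hw) (by simp)
  have h2 : w ^ (2 * m) = ((((-(w.im ^ 2)) ^ m : ℝ)) : ℂ) := by
    rw [pow_mul, h]
    push_cast
    rw [mul_pow, Complex.I_sq]
    simp
  constructor
  · rw [pow_succ, h2, h]
    simp only [one_div, mul_inv, Complex.inv_I]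
    rw [← Complex.ofReal_inv, ← Complex.ofReal_inv, Complex.re_ofReal_mul, Complex.re_ofReal_mul]
    simp
  · rw [h2, one_div, ← Complex.ofReal_inv, ← Complex.ofReal_mul, Complex.ofReal_im]

/-! ### Analytic germs and their power series -/

/-- `f` is the sum of the power series `A` around `z₀`. -/
def HasSeries (f : ℂ → ℂ) (z₀ : ℂ) (A : PowerSeries ℂ) : Prop :=
  ∀ᶠ z in 𝓝 z₀, HasSum (fun m => A.coeff m * (z - z₀) ^ m) (f z)

namespace HasSeries

variable {f g : ℂ → ℂ} {z₀ : ℂ} {A B : PowerSeries ℂ}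

theorem iff_hasFPowerSeriesAt : HasSeries f z₀ A ↔
    HasFPowerSeriesAt f (FormalMultilinearSeries.ofScalars ℂ fun m => A.coeff m) z₀ := by
  rw [hasFPowerSeriesAt_iff']
  simp only [FormalMultilinearSeries.coeff_ofScalars, smul_eq_mul]
  simp_rw [mul_comm ((_ - z₀) ^ _)]
  rfl

theorem analyticAt (h : HasSeries f z₀ A) : AnalyticAt ℂ f z₀ :=
  (iff_hasFPowerSeriesAt.1 h).analyticAt

theorem of_analyticAt (h : AnalyticAt ℂ f z₀) :
    HasSeries f z₀ (PowerSeries.mk fun m => iteratedDeriv m f z₀ / m.factorial) := by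
  rw [iff_hasFPowerSeriesAt]
  simpa using h.hasFPowerSeriesAt

theorem unique (h : HasSeries f z₀ A) (h' : HasSeries f z₀ B) : A = B := by
  have := (iff_hasFPowerSeriesAt.1 h).eq_formalMultilinearSeries (iff_hasFPowerSeriesAt.1 h')
  ext m
  have h2 := congrArg (fun p => FormalMultilinearSeries.coeff p m) this
  simpa only [FormalMultilinearSeries.coeff_ofScalars] using h2

theorem congr (h : HasSeries f z₀ A) (hfg : ∀ᶠ z in 𝓝 z₀, f z = g z) : HasSeries g z₀ A := by
  filter_upwards [h, hfg] with z hz he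
  rwa [← he]

theorem coeff_zero (h : HasSeries f z₀ A) : A.coeff 0 = f z₀ := by
  have := h.self_of_nhds
  simp only [sub_self] at this
  refine HasSum.unique ?_ this
  convert! hasSum_ite_eq 0 (A.coeff 0) using 2 with m
  rcases m with _ | m <;> simp

theorem deriv (h : HasSeries f z₀ A) : HasSeries (deriv f) z₀ (PowerSeries.derivative ℂ A) := by
  have h1 := of_analyticAt h.analyticAt.deriv
  have h2 := h.unique (of_analyticAt h.analyticAt)
  convert! h1 using 1
  ext m
  rw [PowerSeries.coeff_derivative, h2, PowerSeries.coeff_mk, PowerSeries.coeff_mk,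
    iteratedDeriv_succ', Nat.factorial_succ]
  have h3 : ((m : ℂ) + 1) ≠ 0 := Nat.cast_add_one_ne_zero m
  push_cast
  field_simp

theorem coeff_one (h : HasSeries f z₀ A) : A.coeff 1 = _root_.deriv f z₀ := by
  have := h.deriv.coeff_zero
  rw [PowerSeries.coeff_derivative] at this
  simpa using this

theorem add (h : HasSeries f z₀ A) (h' : HasSeries g z₀ B) :
    HasSeries (fun z => f z + g z) z₀ (A + B) := by
  filter_upwards [h, h'] with z hz hz'
  simpa [add_mul] using hz.add hz'

theorem mul (h : HasSeries f z₀ A) (h' : HasSeries g z₀ B) :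
    HasSeries (fun z => f z * g z) z₀ (A * B) := by
  filter_upwards [h, h'] with z hz hz'
  have e : (fun m => (A * B).coeff m * (z - z₀) ^ m) = fun m =>
      ∑ kl ∈ Finset.HasAntidiagonal.antidiagonal m, (A.coeff kl.1 * (z - z₀) ^ kl.1) *
        (B.coeff kl.2 * (z - z₀) ^ kl.2) := by
    funext m
    rw [PowerSeries.coeff_mul, Finset.sum_mul]
    refine Finset.sum_congr rfl fun kl hkl => ?_
    rw [Finset.HasAntidiagonal.mem_antidiagonal] at hkl
    rw [← hkl, pow_add]
    ring
  rw [e, ← hz.tsum_eq, ← hz'.tsum_eq, tsum_mul_tsum_eq_tsum_sum_antidiagonal_of_summable_norm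
    hz.summable.norm hz'.summable.norm]
  exact (summable_norm_sum_mul_antidiagonal_of_summable_norm
    hz.summable.norm hz'.summable.norm).of_norm.hasSum

theorem const (c z₀ : ℂ) : HasSeries (fun _ => c) z₀ (PowerSeries.C c) := by
  refine Eventually.of_forall fun z => ?_
  convert! hasSum_ite_eq 0 c using 2 with m
  rcases m with _ | m <;> simp [PowerSeries.coeff_C]

theorem sub_self_center (z₀ : ℂ) : HasSeries (fun z => z - z₀) z₀ PowerSeries.X := by
  refine Eventually.of_forall fun z => ?_
  convert! hasSum_ite_eq 1 (z - z₀) using 2 with m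
  rw [PowerSeries.coeff_X]
  split_ifs with h <;> simp [h]

theorem pow (h : HasSeries f z₀ A) (l : ℕ) : HasSeries (fun z => f z ^ l) z₀ (A ^ l) := by
  induction l with
  | zero => simpa using const 1 z₀
  | succ l ih => simpa only [pow_succ] using ih.mul h

theorem sum {ι : Type*} {t : Finset ι} {f : ι → ℂ → ℂ} {A : ι → PowerSeries ℂ}
    (h : ∀ i ∈ t, HasSeries (f i) z₀ (A i)) :
    HasSeries (fun z => ∑ i ∈ t, f i z) z₀ (∑ i ∈ t, A i) := by
  classical
  induction t using Finset.induction_on with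
  | empty => simpa using const 0 z₀
  | insert i t hi ih =>
    simp only [Finset.sum_insert hi]
    exact (h i (Finset.mem_insert_self i t)).add
      (ih fun j hj => h j (Finset.mem_insert_of_mem hj))

/-- The Taylor polynomial with analytic remainder. -/
theorem exists_remainder (h : HasSeries f z₀ A) (M : ℕ) : ∃ R : ℂ → ℂ, AnalyticAt ℂ R z₀ ∧
    ∀ᶠ z in 𝓝 z₀, f z = ∑ l ∈ Finset.range M, A.coeff l * (z - z₀) ^ l + (z - z₀) ^ M * R z := by
  induction M with
  | zero => exact ⟨f, h.analyticAt, Eventually.of_forall fun z => by simp⟩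
  | succ M ih =>
    obtain ⟨R, hR, he⟩ := ih
    have hRs := (iff_hasFPowerSeriesAt.1 (of_analyticAt hR)).has_fpower_series_dslope_fslope
    have hd : ∀ z, R z = R z₀ + (z - z₀) * dslope R z₀ z := fun z => by
      have := sub_smul_dslope R z₀ z
      rw [smul_eq_mul] at this
      rw [this]; ring
    have hc : A.coeff M = R z₀ := by
      obtain ⟨S, hS⟩ : ∃ S, HasSeries R z₀ S := ⟨_, of_analyticAt hR⟩
      have h2 : HasSeries f z₀ (∑ l ∈ Finset.range M, PowerSeries.C (A.coeff l) * PowerSeries.X ^ l +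
          PowerSeries.X ^ M * S) :=
        ((sum fun l _ => (const (A.coeff l) z₀).mul ((sub_self_center z₀).pow l)).add
          (((sub_self_center z₀).pow M).mul hS)).congr (he.mono fun z hz => hz.symm)
      rw [← hS.coeff_zero]
      have h3 := congrArg (PowerSeries.coeff M) (h.unique h2)
      rw [h3, map_add, map_sum, PowerSeries.coeff_X_pow_mul', if_pos le_rfl, Nat.sub_self,
        Finset.sum_eq_zero, zero_add]
      intro l hl
      rw [Finset.mem_range] at hl
      rw [PowerSeries.coeff_C_mul, PowerSeries.coeff_X_pow, if_neg (by omega), mul_zero]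
    refine ⟨dslope R z₀, hRs.analyticAt, he.mono fun z hz => ?_⟩
    rw [hz, Finset.sum_range_succ, hc, hd z]
    ring

end HasSeries

/-- Formal substitution is avoided by replacing `q` with its Taylor polynomial of degree `m` and an
analytic remainder. The remainder enters with the factor `F^(m+1)`, divisible by `X^(m+1)`, and the
identity has no coefficients of order at least `2`. -/
theorem HasSeries.comp_left_inverse {f q : ℂ → ℂ} {z₀ : ℂ} {F Q : PowerSeries ℂ}
    (hf : HasSeries f z₀ F) (hf0 : f z₀ = 0) (hq : HasSeries q 0 Q)
    (h : ∀ᶠ z in 𝓝 z₀, q (f z) = z) {m : ℕ} (hm : 2 ≤ m) :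
    ∑ l ∈ Finset.range (m + 1), Q.coeff l * (F ^ l).coeff m = 0 := by
  obtain ⟨R, hR, he⟩ := hq.exists_remainder (m + 1)
  have hfc : Tendsto f (𝓝 z₀) (𝓝 0) := by
    have := hf.analyticAt.continuousAt.tendsto
    rwa [hf0] at this
  have hRf : AnalyticAt ℂ (fun z => R (f z)) z₀ :=
    AnalyticAt.fun_comp (by rwa [hf0]) hf.analyticAt
  obtain ⟨S, hS⟩ : ∃ S, HasSeries (fun z => R (f z)) z₀ S := ⟨_, HasSeries.of_analyticAt hRf⟩
  have h1 : HasSeries (fun z => z) z₀ (∑ l ∈ Finset.range (m + 1), PowerSeries.C (Q.coeff l) * F ^ l +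
      F ^ (m + 1) * S) := by
    refine ((HasSeries.sum fun l _ => (HasSeries.const (Q.coeff l) z₀).mul (hf.pow l)).add
      ((hf.pow (m + 1)).mul hS)).congr ?_
    filter_upwards [hfc.eventually he, h] with z hz hz'
    rw [hz'] at hz
    simpa using hz.symm
  have h2 : HasSeries (fun z => z) z₀ (PowerSeries.X + PowerSeries.C z₀) := by
    simpa using (HasSeries.sub_self_center z₀).add (HasSeries.const z₀ z₀)
  have h3 := congrArg (PowerSeries.coeff m) (h1.unique h2)
  obtain ⟨G, hG⟩ : PowerSeries.X ∣ F := by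
    rw [PowerSeries.X_dvd_iff, ← PowerSeries.coeff_zero_eq_constantCoeff_apply, hf.coeff_zero, hf0]
  rw [map_add, map_sum, map_add, PowerSeries.coeff_X, if_neg (by omega), PowerSeries.coeff_C,
    if_neg (by omega)] at h3
  nth_rewrite 2 [hG] at h3
  rw [mul_pow, mul_assoc, PowerSeries.coeff_X_pow_mul', if_neg (by omega)] at h3
  simpa [PowerSeries.coeff_C_mul] using h3

/-! ### The local form of the steepest descent path -/

/-- Near a nondegenerate saddle point with real Taylor coefficients `a`, the function `φ s₀ - φ` is
the square of a local coordinate `f` with local inverse `q`. -/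
theorem exists_local_path {φ : ℂ → ℂ} {s₀ : ℝ} {a : ℕ → ℝ} (h1 : a 1 = 0) (h2 : 0 < a 2)
    (hφ : HasSeries φ s₀ (PowerSeries.mk fun m => (a m : ℂ))) :
    ∃ f q : ℂ → ℂ, HasSeries f s₀ (PowerSeries.mk (fCoeff a)) ∧
      HasSeries q 0 (PowerSeries.mk (pCoeff s₀ (fCoeff a))) ∧
      (∀ᶠ s in 𝓝 (s₀ : ℂ), q (f s) = s) ∧ (∀ᶠ u in 𝓝 (0 : ℂ), f (q u) = u) ∧
      (∀ᶠ s in 𝓝 (s₀ : ℂ), f s ^ 2 = φ s₀ - φ s) := by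
  obtain ⟨ψ, hψ, he⟩ := hφ.exists_remainder 2
  obtain ⟨S, hS⟩ : ∃ S, HasSeries ψ s₀ S := ⟨_, HasSeries.of_analyticAt hψ⟩
  have hφ0 : φ s₀ = a 0 := by rw [← hφ.coeff_zero, PowerSeries.coeff_mk]
  have he' : ∀ᶠ z in 𝓝 (s₀ : ℂ), φ z = a 0 + (z - s₀) ^ 2 * ψ z := by
    filter_upwards [he] with z hz
    rw [hz, Finset.sum_range_succ, Finset.sum_range_one]
    simp [h1]
  have hψ0 : ψ s₀ = a 2 := by
    rw [← hS.coeff_zero]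
    have h3 : HasSeries φ s₀ (PowerSeries.C (a 0 : ℂ) + PowerSeries.X ^ 2 * S) :=
      ((HasSeries.const (a 0 : ℂ) s₀).add (((HasSeries.sub_self_center (s₀ : ℂ)).pow 2).mul
        hS)).congr (he'.mono fun z hz => hz.symm)
    have h4 := congrArg (PowerSeries.coeff 2) (hφ.unique h3)
    rw [PowerSeries.coeff_mk, map_add, PowerSeries.coeff_C, if_neg (by omega),
      PowerSeries.coeff_X_pow_mul', if_pos le_rfl, zero_add] at h4
    exact h4.symm
  have hsqrt : (Real.sqrt (a 2) : ℂ) ≠ 0 := by exact_mod_cast (Real.sqrt_pos.2 h2).ne'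
  have hslit : ψ s₀ ∈ Complex.slitPlane := by rw [hψ0]; exact Complex.ofReal_mem_slitPlane.2 h2
  -- As `ψ s₀ = a 2 > 0`, the principal root of `ψ` is analytic near `s₀`.
  set g : ℂ → ℂ := fun s => Complex.exp (Complex.log (ψ s) / 2) with hg
  have hga : AnalyticAt ℂ g s₀ := by
    refine AnalyticAt.cexp ?_
    exact (hψ.clog hslit).div analyticAt_const two_ne_zero
  have hg0 : g s₀ = Real.sqrt (a 2) := by
    rw [hg]
    simp only
    rw [hψ0, ← Complex.ofReal_log h2.le, Real.sqrt_eq_rpow, Real.rpow_def_of_pos h2]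
    push_cast
    congr 1
    ring
  have hgsq : ∀ᶠ s in 𝓝 (s₀ : ℂ), g s ^ 2 = ψ s := by
    filter_upwards [hψ.continuousAt.eventually_ne (Complex.slitPlane_ne_zero hslit)] with s hs
    rw [hg]
    simp only
    rw [← Complex.exp_nat_mul]
    push_cast
    rw [mul_div_cancel₀ _ (two_ne_zero' ℂ), Complex.exp_log hs]
  -- The factor `-I` gives `f² = φ(s₀) - φ` and picks the branch whose inverse leaves `s₀` upwards
  -- for `u > 0`.
  set f : ℂ → ℂ := fun s => (s - s₀) * (-Complex.I * g s) with hf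
  have hfa : AnalyticAt ℂ f s₀ := by fun_prop
  have hf0 : f s₀ = 0 := by simp [hf]
  have hfsq : ∀ᶠ s in 𝓝 (s₀ : ℂ), f s ^ 2 = φ s₀ - φ s := by
    filter_upwards [hgsq, he'] with s hs hs'
    rw [hf, hs', hφ0]
    simp only
    linear_combination -(s - s₀) ^ 2 * hs + (s - s₀) ^ 2 * g s ^ 2 * Complex.I_sq
  have hfd : deriv f s₀ = -Complex.I * (Real.sqrt (a 2) : ℂ) := by
    have hd : HasDerivAt f (1 * (-Complex.I * g s₀) + ((s₀ : ℂ) - s₀) *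
        deriv (fun s => -Complex.I * g s) s₀) s₀ :=
      ((hasDerivAt_id (s₀ : ℂ)).sub_const (s₀ : ℂ)).mul
        (by fun_prop : DifferentiableAt ℂ (fun s => -Complex.I * g s) s₀).hasDerivAt
    rw [hd.deriv, hg0]
    simp
  have hfd0 : deriv f s₀ ≠ 0 := by rw [hfd]; simp [Complex.I_ne_zero, hsqrt]
  obtain ⟨F, hF⟩ : ∃ F, HasSeries f s₀ F := ⟨_, HasSeries.of_analyticAt hfa⟩
  have hFc : F = PowerSeries.mk (fCoeff a) := by
    ext m
    rw [PowerSeries.coeff_mk]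
    refine coeff_eq_fCoeff h2 (by rw [hF.coeff_zero, hf0]) (by rw [hF.coeff_one, hfd])
      (fun m hm => ?_) m
    have h5 : HasSeries φ s₀ (PowerSeries.C (a 0 : ℂ) + PowerSeries.C (-1) * (F * F)) := by
      refine ((HasSeries.const (a 0 : ℂ) s₀).add ((HasSeries.const (-1) _).mul
        (hF.mul hF))).congr ?_
      filter_upwards [hfsq] with s hs
      rw [← pow_two, hs, hφ0]
      ring
    have h6 := congrArg (PowerSeries.coeff (m + 1)) (hφ.unique h5)
    rw [PowerSeries.coeff_mk, map_add, PowerSeries.coeff_C, if_neg (by omega),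
      PowerSeries.coeff_C_mul] at h6
    rw [h6]
    ring
  set q := hfa.hasStrictDerivAt.localInverse _ _ _ hfd0 with hq
  have hqa : AnalyticAt ℂ q 0 := by
    have := hfa.analyticAt_localInverse hfd0
    rwa [hf0] at this
  have hqf : ∀ᶠ s in 𝓝 (s₀ : ℂ), q (f s) = s :=
    HasStrictDerivAt.eventually_left_inverse hfa.hasStrictDerivAt hfd0
  have hfq : ∀ᶠ u in 𝓝 (0 : ℂ), f (q u) = u := by
    have := HasStrictDerivAt.eventually_right_inverse hfa.hasStrictDerivAt hfd0
    rwa [hf0] at this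
  have hqd : deriv q 0 = (deriv f s₀)⁻¹ := by
    have := (HasStrictDerivAt.to_localInverse hfa.hasStrictDerivAt hfd0).hasDerivAt.deriv
    rwa [hf0] at this
  obtain ⟨Q, hQ⟩ : ∃ Q, HasSeries q 0 Q := ⟨_, HasSeries.of_analyticAt hqa⟩
  have hq0 : q 0 = s₀ := by rw [← hf0]; exact hqf.self_of_nhds
  have hfun : (fun k => F.coeff k) = fCoeff a := by funext k; rw [hFc, PowerSeries.coeff_mk]
  have hQc : Q = PowerSeries.mk (pCoeff s₀ (fCoeff a)) := by
    ext m
    rw [PowerSeries.coeff_mk, ← hfun]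
    refine coeff_eq_pCoeff (by rw [hF.coeff_zero, hf0]) (by rwa [hF.coeff_one])
      (by rw [hQ.coeff_zero, hq0]) (by rw [hQ.coeff_one, hF.coeff_one, hqd, one_div])
      (fun m hm => hF.comp_left_inverse hf0 hQ hqf hm) m
  exact ⟨f, q, hFc ▸ hF, hQc ▸ hQ, hqf, hfq, hfsq⟩

theorem fCoeff_one_ne_zero {a : ℕ → ℝ} (h : 0 < a 2) : fCoeff a 1 ≠ 0 := by
  have hsqrt : (Real.sqrt (a 2) : ℂ) ≠ 0 := by exact_mod_cast (Real.sqrt_pos.2 h).ne'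
  rw [fCoeff_one]
  simp [Complex.I_ne_zero, hsqrt]

theorem fCoeff_real_mul {a : ℕ → ℝ} (h : 0 < a 2) (m : ℕ) :
    ∃ r : ℝ, fCoeff a m = r * fCoeff a 1 := by
  have h1 : fCoeff a 1 = ((fCoeff a 1).im : ℂ) * Complex.I :=
    Complex.ext (by simp [fCoeff_re]) (by simp)
  have h2 : (fCoeff a 1).im ≠ 0 := fun h0 => fCoeff_one_ne_zero h (by rw [h1, h0]; simp)
  refine ⟨(fCoeff a m).im / (fCoeff a 1).im, ?_⟩
  refine Complex.ext ?_ ?_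
  · rw [fCoeff_re, Complex.re_ofReal_mul, fCoeff_re, mul_zero]
  · rw [Complex.im_ofReal_mul, div_mul_cancel₀ _ h2]

/-- A path that solves `φ (p u) = φ s₀ - u ^ 2` has near `u = 0` the computed Taylor series. -/
theorem pathSeries_of_solution {φ : ℂ → ℂ} {s₀ : ℝ} {a : ℕ → ℝ} {p : ℝ → ℂ} (h1 : a 1 = 0)
    (hsign : ∀ m, 2 ≤ m → 0 < (-1) ^ m * a m)
    (hφ : HasSeries φ s₀ (PowerSeries.mk fun m => (a m : ℂ))) (hp0 : p 0 = s₀)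
    (hpφ : ∀ u, φ (p u) = φ s₀ - (u : ℂ) ^ 2) (hpim : ∀ u, u ≠ 0 → 0 < u * (p u).im)
    (huniq : ∀ᶠ s in 𝓝 (s₀ : ℂ), ∀ u : ℝ, 0 < u * s.im → φ s = φ s₀ - (u : ℂ) ^ 2 → s = p u) :
    PathSeries φ s₀ a p ∧ ∃ q : ℂ → ℂ, HasSeries q 0 (PowerSeries.mk (pCoeff s₀ (fCoeff a))) ∧
      ∀ᶠ u : ℝ in 𝓝 0, p u = q u := by
  have h2 : 0 < a 2 := by simpa using hsign 2 le_rfl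
  obtain ⟨f, q, hf, hq, hqf, hfq, hfsq⟩ := exists_local_path h1 h2 hφ
  have hq0 : q 0 = s₀ := by rw [← hq.coeff_zero, PowerSeries.coeff_mk, pCoeff]
  have hqc : Tendsto q (𝓝 0) (𝓝 (s₀ : ℂ)) := by
    have := hq.analyticAt.continuousAt.tendsto
    rwa [hq0] at this
  have hofR : Tendsto (fun u : ℝ => (u : ℂ)) (𝓝 0) (𝓝 (0 : ℂ)) := by
    simpa using Complex.continuous_ofReal.tendsto 0
  -- The derivative of `q` at `0` is `i / √(a 2)`. The resulting sign of `Im q` is what identifies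
  -- `q u` with `p u` and excludes `p (-u)`, which satisfies the same equation.
  have hqim : ∀ᶠ u : ℝ in 𝓝 0, u ≠ 0 → 0 < u * (q u).im := by
    have hd : HasDerivAt q (1 / fCoeff a 1) 0 := by
      have := hq.coeff_one
      rw [PowerSeries.coeff_mk, pCoeff] at this
      rw [this]
      exact hq.analyticAt.differentiableAt.hasDerivAt
    have hdr : HasDerivAt (fun u : ℝ => q u) (1 / fCoeff a 1) 0 :=
      HasDerivAt.comp_ofReal (by simpa only [Complex.ofReal_zero] using hd)
    have hd' : HasDerivAt (fun u : ℝ => (q u).im) (1 / fCoeff a 1).im 0 :=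
      Complex.imCLM.hasFDerivAt.comp_hasDerivAt (0 : ℝ) hdr
    have hpos : 0 < (1 / fCoeff a 1).im := by
      rw [fCoeff_one]
      have := Real.sqrt_pos.2 h2
      simp only [one_div, mul_inv, inv_neg, Complex.inv_I, neg_neg]
      rw [← Complex.ofReal_inv, Complex.im_mul_ofReal, Complex.I_im]
      positivity
    have := (hd'.tendsto_slope_zero).eventually (lt_mem_nhds hpos)
    rw [eventually_nhdsWithin_iff] at this
    filter_upwards [this] with u hu hu0
    have h3 := hu hu0
    simp only [zero_add, Complex.ofReal_zero, hq0, Complex.ofReal_im, sub_zero, smul_eq_mul] at h3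
    have h4 : u * (q u).im = u ^ 2 * (u⁻¹ * (q u).im) := by field_simp
    rw [h4]
    positivity
  have hpq : ∀ᶠ u : ℝ in 𝓝 0, p u = q u := by
    filter_upwards [hqim, hofR.eventually hfq, hofR.eventually (hqc.eventually hfsq),
      hofR.eventually (hqc.eventually huniq)] with u h3 h4 h5 h6
    by_cases hu : u = 0
    · rw [hu, hp0, Complex.ofReal_zero, hq0]
    · rw [h4] at h5
      exact (h6 u (h3 hu) (by rw [h5]; ring)).symm
  have hreal := pCoeff_real (fCoeff_one_ne_zero h2) (fCoeff_real_mul h2) s₀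
  have hinv : ∀ u, descentInverse φ s₀ (p u) = u := by
    intro u
    have h3 : (φ s₀ - φ (p u)).re = u ^ 2 := by
      rw [hpφ, sub_sub_cancel, ← Complex.ofReal_pow, Complex.ofReal_re]
    rw [descentInverse, h3, Real.sqrt_sq_eq_abs]
    rcases lt_trichotomy u 0 with hu | hu | hu
    · have := neg_of_mul_pos_right (hpim u hu.ne) hu.le
      rw [sign_neg this, abs_of_neg hu]; simp
    · simp [hu]
    · have := pos_of_mul_pos_right (hpim u hu.ne') hu.le
      rw [sign_pos this, abs_of_pos hu]; simp
  refine ⟨⟨?_, hsign, hinv, ?_, fCoeff_re a, ?_, fun m => ?_, fun m => ?_⟩, q, hq, hpq⟩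
  · simpa only [HasSeries, PowerSeries.coeff_mk] using hφ
  · rw [eventually_nhdsWithin_iff]
    obtain ⟨ε, hε, hball⟩ := Metric.eventually_nhds_iff.1 (hpq.and (hofR.eventually hfq))
    have hφc : Tendsto (fun s => φ s₀ - φ s) (𝓝 (s₀ : ℂ)) (𝓝 0) := by
      have := (hφ.analyticAt.continuousAt.tendsto).const_sub (φ s₀)
      rwa [sub_self] at this
    -- A point of the range near `s₀` might belong to a large parameter; this is excluded by `u² =
    -- φ(s₀) - φ(p u)`, which is small there.
    have hsmall := hφc.eventually (Metric.ball_mem_nhds (0 : ℂ) (by positivity : 0 < ε ^ 2))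
    filter_upwards [hf, hsmall] with s hs hsm
    rintro ⟨u, rfl⟩
    rw [hinv]
    rw [hpφ, sub_sub_cancel, dist_zero_right, norm_pow, Complex.norm_real,
      Real.norm_eq_abs] at hsm
    have hu : |u| < ε := lt_of_pow_lt_pow_left₀ 2 hε.le hsm
    obtain ⟨h3, h4⟩ := hball (y := u) (by rwa [Real.dist_eq, sub_zero])
    have h5 : f (p u) = u := by rw [h3, h4]
    rw [h5] at hs
    simpa only [PowerSeries.coeff_mk] using hs
  · have hq' : ∀ᶠ z in 𝓝 (0 : ℂ), HasSum (fun m => pCoeff s₀ (fCoeff a) m * z ^ m) (q z) := by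
      simpa only [HasSeries, PowerSeries.coeff_mk, sub_zero] using hq
    filter_upwards [hpq, hofR.eventually hq'] with u h3 h4
    rwa [h3]
  · obtain ⟨r, hr⟩ := hreal (2 * m)
    rw [hr]
    exact (re_eq_zero_of_imag_pow (fCoeff_re a 1) r).2
  · obtain ⟨r, hr⟩ := hreal (2 * m + 1)
    rw [hr]
    exact (re_eq_zero_of_imag_pow (fCoeff_re a 1) r).1

/-- Near `0` the path is the restriction of the analytic germ `q`, and `q 0 = s₀ ≠ 0` makes `q' / q`
analytic. The complex series in the second conclusion supplies the Taylor remainder for `watson`. -/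
theorem logDerivSeries_of_path {s₀ : ℝ} (hs : s₀ ≠ 0) {a : ℕ → ℝ} (h2 : 0 < a 2) {p : ℝ → ℂ}
    {q : ℂ → ℂ} (hq : HasSeries q 0 (PowerSeries.mk (pCoeff s₀ (fCoeff a))))
    (hpq : ∀ᶠ u : ℝ in 𝓝 0, p u = q u) :
    LogDerivSeries p (cCoeff s₀ (pCoeff s₀ (fCoeff a))) ∧
      HasSeries (fun u => deriv q u / q u) 0
        (PowerSeries.mk (cCoeff s₀ (pCoeff s₀ (fCoeff a)))) := by
  have hq0 : q 0 = s₀ := by rw [← hq.coeff_zero, PowerSeries.coeff_mk, pCoeff]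
  have hq0' : q 0 ≠ 0 := by rw [hq0]; exact_mod_cast hs
  have hofR : Tendsto (fun u : ℝ => (u : ℂ)) (𝓝 0) (𝓝 (0 : ℂ)) := by
    simpa using Complex.continuous_ofReal.tendsto 0
  have hca : AnalyticAt ℂ (fun u => deriv q u / q u) 0 := hq.analyticAt.deriv.div hq.analyticAt hq0'
  obtain ⟨C, hC⟩ : ∃ C, HasSeries (fun u => deriv q u / q u) 0 C := ⟨_, HasSeries.of_analyticAt hca⟩
  have hCc : C = PowerSeries.mk (cCoeff s₀ (pCoeff s₀ (fCoeff a))) := by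
    ext m
    have h3 : (fun k => (PowerSeries.mk (pCoeff s₀ (fCoeff a))).coeff k) =
        pCoeff s₀ (fCoeff a) := by funext k; rw [PowerSeries.coeff_mk]
    rw [PowerSeries.coeff_mk, ← h3]
    refine coeff_eq_cCoeff hs (by rw [hq.coeff_zero, hq0]) ?_ m
    refine hq.deriv.unique ((hq.mul hC).congr ?_)
    filter_upwards [hq.analyticAt.continuousAt.eventually_ne hq0'] with u hu
    rw [mul_div_cancel₀ _ hu]
  have hreal := cCoeff_real (pCoeff_real (fCoeff_one_ne_zero h2) (fCoeff_real_mul h2) s₀) s₀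
  refine ⟨⟨?_, fun m => ?_, fun m => ?_⟩, hCc ▸ hC⟩
  · have hC' : ∀ᶠ z in 𝓝 (0 : ℂ), HasSum (fun m => cCoeff s₀ (pCoeff s₀ (fCoeff a)) m * z ^ m)
        (deriv q z / q z) := by
      simpa only [HasSeries, PowerSeries.coeff_mk, sub_zero, hCc] using hC
    filter_upwards [hpq.eventually_nhds, hofR.eventually hC',
      hofR.eventually hq.analyticAt.eventually_analyticAt] with u h3 h4 h5
    have h6 : deriv p u = deriv q u :=
      ((h5.differentiableAt.hasDerivAt.comp_ofReal).congr_of_eventuallyEq h3).deriv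
    rwa [logDerivPath, h6, h3.self_of_nhds]
  · obtain ⟨r, hr⟩ := hreal (2 * m)
    rw [hr]
    exact (re_eq_zero_of_imag_pow (fCoeff_re a 1) r).1
  · obtain ⟨r, hr⟩ := hreal (2 * m + 1)
    rw [hr]
    exact (re_eq_zero_of_imag_pow (m := m + 1) (fCoeff_re a 1) r).2

section Series

/-! ### Taylor series of the exponents -/

variable {K : ℕ} {Ω : Fin K → ℝ} {lam : ℝ}

theorem exponentCoeff_sign (hK : 0 < K) (hΩ : ∀ k, 0 < Ω k) {s₀ : ℝ} (hs : s₀ ∈ realRegion Ω)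
    (m : ℕ) : 0 < (-1) ^ m * exponentCoeff Ω s₀ m := by
  have : Nonempty (Fin K) := ⟨⟨0, hK⟩⟩
  have e : (-1) ^ m * exponentCoeff Ω s₀ m = 1 / (K : ℝ) * ∑ k, ((1 + Ω k) / Ω k /
      (1 + 2 * s₀ * Ω k) + 1 / (m : ℝ)) * (2 * Ω k / (1 + 2 * s₀ * Ω k)) ^ m := by
    rw [exponentCoeff, mul_left_comm, Finset.mul_sum]
    congr 1
    refine Finset.sum_congr rfl fun k _ => ?_
    rw [mul_left_comm, ← mul_pow]
    congr 2
    ring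
  rw [e]
  refine mul_pos (by positivity) (Finset.sum_pos (fun k _ => ?_) Finset.univ_nonempty)
  have := hs k
  have := hΩ k
  positivity

/-- The coefficient formula at `m = 1` lacks only the linear term of `α`; at a saddle the two
cancel, which justifies `a_1 = 0`. -/
theorem exponentCoeff_one (hΩ : ∀ k, 0 < Ω k) {s₀ : ℝ} (hs : s₀ ∈ realRegion Ω) :
    2 * lam + exponentCoeff Ω s₀ 1 = alphaDerivReal Ω lam s₀ := by
  rw [exponentCoeff, alphaDerivReal, sub_eq_add_neg, ← mul_neg, ← Finset.sum_neg_distrib]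
  congr 2
  refine Finset.sum_congr rfl fun k _ => ?_
  have h1 := (hs k).ne'
  have := (hΩ k).ne'
  generalize 1 + 2 * s₀ * Ω k = z at h1 ⊢
  field_simp
  ring

/-- Writing `1 + 2 s Ω_k = z₀ (1 - w (s - s₀))` with `z₀ = 1 + 2 s₀ Ω_k` and `w = -2 Ω_k / z₀` turns
each summand into a constant minus a geometric series and a logarithmic series in `w (s - s₀)`. -/
theorem hasSeries_alpha (hΩ : ∀ k, 0 < Ω k) {s₀ : ℝ} (hs : s₀ ∈ realRegion Ω)
    (h0 : alphaDerivReal Ω lam s₀ = 0) :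
    HasSeries (alpha Ω lam) s₀ (PowerSeries.mk fun m => (aCoeff Ω lam s₀ m : ℂ)) := by
  set c : ℂ := 2 * lam * s₀ - 1 / (K : ℂ) *
    ∑ k, (((1 + Ω k) / Ω k : ℝ) + (Real.log (1 + 2 * s₀ * Ω k) : ℂ)) with hc
  have key : HasSeries (alpha Ω lam) s₀ (PowerSeries.C c + PowerSeries.C (2 * lam : ℂ) *
      PowerSeries.X + PowerSeries.mk fun m => (exponentCoeff Ω s₀ m : ℂ)) := by
    have hexp : HasSeries (fun s => 1 / (K : ℂ) * ∑ k, ((((1 + Ω k) / Ω k / (1 + 2 * s₀ * Ω k) : ℝ) : ℂ) *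
        (1 - ((-2 * Ω k / (1 + 2 * s₀ * Ω k) : ℝ) : ℂ) * (s - s₀))⁻¹ +
        -Complex.log (1 - ((-2 * Ω k / (1 + 2 * s₀ * Ω k) : ℝ) : ℂ) * (s - s₀)))) s₀
        (PowerSeries.mk fun m => (exponentCoeff Ω s₀ m : ℂ)) := by
      have hsm : ∀ᶠ s : ℂ in 𝓝 (s₀ : ℂ), ∀ k,
          ‖((-2 * Ω k / (1 + 2 * s₀ * Ω k) : ℝ) : ℂ) * (s - s₀)‖ < 1 := eventually_all.2 fun k => by
        have : ContinuousAt (fun s : ℂ => ‖((-2 * Ω k / (1 + 2 * s₀ * Ω k) : ℝ) : ℂ) * (s - s₀)‖)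
          s₀ := by fun_prop
        exact this.eventually (gt_mem_nhds (by simp))
      filter_upwards [hsm] with s hsk
      have hk := fun k => (((hasSum_geometric_of_norm_lt_one (hsk k)).mul_left
        (((1 + Ω k) / Ω k / (1 + 2 * s₀ * Ω k) : ℝ) : ℂ)).add
        (Complex.hasSum_taylorSeries_neg_log (hsk k)))
      have h := (hasSum_sum (s := Finset.univ) fun k _ => hk k).mul_left (1 / (K : ℂ))
      -- At `m = 0` the logarithmic series and `exponentCoeff` agree because both contain `1 / 0 =
      -- 0`.
      convert! h using 1
      funext m
      rw [PowerSeries.coeff_mk, exponentCoeff]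
      push_cast
      rw [mul_assoc, Finset.sum_mul]
      congr 1
      refine Finset.sum_congr rfl fun k _ => ?_
      rw [mul_pow]
      ring
    refine ((((HasSeries.const c s₀).add ((HasSeries.const (2 * lam : ℂ) s₀).mul
      (HasSeries.sub_self_center (s₀ : ℂ)))).add hexp).congr ?_)
    have hslit : ∀ᶠ s : ℂ in 𝓝 (s₀ : ℂ), ∀ k, 1 + 2 * s * Ω k ∈ Complex.slitPlane :=
      eventually_all.2 fun k => ContinuousAt.eventually_mem
        (f := fun z : ℂ => 1 + 2 * z * Ω k) (by fun_prop) (Complex.isOpen_slitPlane.mem_nhds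
          (slitPlane_of_mem_region hΩ ((ofReal_mem_regionAlpha hΩ).2 hs) k))
    filter_upwards [hslit] with s hslit
    rw [alpha, hc]
    have hterm : ∀ k, (2 * s * (1 + Ω k) / (1 + 2 * s * Ω k) + Complex.log (1 + 2 * s * Ω k) : ℂ) =
        (((1 + Ω k) / Ω k : ℝ) + (Real.log (1 + 2 * s₀ * Ω k) : ℂ)) -
        ((((1 + Ω k) / Ω k / (1 + 2 * s₀ * Ω k) : ℝ) : ℂ) *
        (1 - ((-2 * Ω k / (1 + 2 * s₀ * Ω k) : ℝ) : ℂ) * (s - s₀))⁻¹ +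
        -Complex.log (1 - ((-2 * Ω k / (1 + 2 * s₀ * Ω k) : ℝ) : ℂ) * (s - s₀))) := by
      intro k
      have hz := hs k
      have hzC : ((1 + 2 * s₀ * Ω k : ℝ) : ℂ) ≠ 0 := by exact_mod_cast hz.ne'
      have hz1 := Complex.slitPlane_ne_zero (hslit k)
      have hOC : (Ω k : ℂ) ≠ 0 := by exact_mod_cast (hΩ k).ne'
      have hzs : (2 * s : ℂ) = ((1 + 2 * s * Ω k) - 1) / Ω k := by field_simp; ring
      have hx : ((1 + 2 * s₀ * Ω k : ℝ) : ℂ) = 1 + 2 * s₀ * Ω k := by push_cast; rfl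
      have e1 : (1 - ((-2 * Ω k / (1 + 2 * s₀ * Ω k) : ℝ) : ℂ) * (s - s₀)) =
          (1 + 2 * s * Ω k) / ((1 + 2 * s₀ * Ω k : ℝ) : ℂ) := by
        rw [eq_div_iff hzC, Complex.ofReal_div, sub_mul, mul_right_comm (_ / _),
          div_mul_cancel₀ _ hzC, hx]
        push_cast
        ring
      -- Since `z₀` is a positive real number, the principal logarithm splits without a multiple of
      -- `2πi`.
      have e3 : Complex.log (1 + 2 * s * Ω k) = (Real.log (1 + 2 * s₀ * Ω k) : ℂ) +
          Complex.log ((1 + 2 * s * Ω k) / ((1 + 2 * s₀ * Ω k : ℝ) : ℂ)) := by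
        rw [← Complex.log_ofReal_mul hz (div_ne_zero hz1 hzC), mul_div_cancel₀ _ hzC]
      rw [e1, e3, hzs, Complex.ofReal_div _ (1 + 2 * s₀ * Ω k)]
      generalize ((1 + 2 * s₀ * Ω k : ℝ) : ℂ) = x at hzC ⊢
      generalize (1 + 2 * s * Ω k : ℂ) = z at hz1 ⊢
      have hz2 : ((z - 1) / Ω k * Ω k : ℂ) = z - 1 := div_mul_cancel₀ _ hOC
      rw [hz2, add_sub_cancel]
      push_cast
      field_simp
      ring
    have hsum := Finset.sum_congr (s₁ := Finset.univ) rfl fun k _ => hterm k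
    rw [hsum, Finset.sum_sub_distrib]
    ring
  have hcoef : (PowerSeries.C c + PowerSeries.C (2 * lam : ℂ) *
      PowerSeries.X + PowerSeries.mk fun m => (exponentCoeff Ω s₀ m : ℂ)) =
      PowerSeries.mk fun m => (aCoeff Ω lam s₀ m : ℂ) := by
    ext m
    match m with
    | 0 =>
      rw [key.coeff_zero, PowerSeries.coeff_mk, aCoeff, alpha_ofReal hs, Complex.ofReal_re]
    | 1 =>
      rw [PowerSeries.coeff_mk, aCoeff, map_add, map_add, PowerSeries.coeff_C, if_neg one_ne_zero,
        PowerSeries.coeff_C_mul, PowerSeries.coeff_one_X, PowerSeries.coeff_mk, ← h0,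
        ← exponentCoeff_one hΩ hs]
      push_cast
      ring
    | m + 2 =>
      rw [PowerSeries.coeff_mk, aCoeff, map_add, map_add, PowerSeries.coeff_C, if_neg (by omega),
        PowerSeries.coeff_C_mul, PowerSeries.coeff_X, if_neg (by omega), PowerSeries.coeff_mk]
      ring
  rwa [hcoef] at key

theorem beta_eq (s : ℂ) : beta Ω lam s = alpha Ω lam (s + 1 / 2) +
    ((2 * Real.log 2 * capacity Ω + 1 - lam : ℝ) : ℂ) := by
  rw [beta]; push_cast; ring

theorem hasSeries_beta (hΩ : ∀ k, 0 < Ω k) {sα sβ : ℝ} (hs : sα ∈ realRegion Ω)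
    (h0 : alphaDerivReal Ω lam sα = 0) (hβ : sβ = sα - 1 / 2) :
    HasSeries (beta Ω lam) sβ (PowerSeries.mk fun m => (bCoeff Ω lam sα sβ m : ℂ)) := by
  have hα := hasSeries_alpha hΩ hs h0
  have hc : (sβ : ℂ) + 1 / 2 = sα := by rw [hβ]; push_cast; ring
  have ht : Tendsto (fun s : ℂ => s + 1 / 2) (𝓝 (sβ : ℂ)) (𝓝 (sα : ℂ)) := by
    rw [← hc]; exact (continuous_id.add continuous_const).tendsto _
  have h1 : HasSeries (fun s => alpha Ω lam (s + 1 / 2)) sβ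
      (PowerSeries.mk fun m => (aCoeff Ω lam sα m : ℂ)) := by
    filter_upwards [ht.eventually hα] with s hs
    convert! hs using 4
    rw [← hc]; ring
  have h2 : HasSeries (beta Ω lam) sβ _ := (h1.add (HasSeries.const
    ((2 * Real.log 2 * capacity Ω + 1 - lam : ℝ) : ℂ) _)).congr
      (Eventually.of_forall fun s => (beta_eq s).symm)
  convert! h2 using 1
  ext m
  rw [PowerSeries.coeff_mk, map_add, PowerSeries.coeff_mk, PowerSeries.coeff_C]
  match m with
  | 0 =>
    rw [bCoeff, aCoeff, beta_eq, hc, alpha_ofReal hs, if_pos rfl, ← Complex.ofReal_add,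
      Complex.ofReal_re, Complex.ofReal_re, Complex.ofReal_add]
  | 1 => simp [bCoeff, aCoeff]
  | m + 2 => simp [bCoeff]

theorem aCoeff_sign (hK : 0 < K) (hΩ : ∀ k, 0 < Ω k) {s₀ : ℝ} (hs : s₀ ∈ realRegion Ω) (m : ℕ)
    (hm : 2 ≤ m) : 0 < (-1) ^ m * aCoeff Ω lam s₀ m := by
  obtain ⟨m, rfl⟩ : ∃ r, m = r + 2 := ⟨m - 2, by omega⟩
  exact exponentCoeff_sign hK hΩ hs _

theorem bCoeff_sign (hK : 0 < K) (hΩ : ∀ k, 0 < Ω k) {sα sβ : ℝ} (hs : sα ∈ realRegion Ω) (m : ℕ)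
    (hm : 2 ≤ m) : 0 < (-1) ^ m * bCoeff Ω lam sα sβ m := by
  obtain ⟨m, rfl⟩ : ∃ r, m = r + 2 := ⟨m - 2, by omega⟩
  exact exponentCoeff_sign hK hΩ hs _

/-! ### The series of the steepest descent paths -/

section Path

variable {sα : ℝ} {p : ℝ → ℂ}

theorem path_zero (hK : 0 < K) (hΩ : ∀ k, 0 < Ω k) (hlam : 0 < lam) (hs : sα ∈ realRegion Ω)
    (h0 : alphaDerivReal Ω lam sα = 0) (hp : IsSteepestDescentPath Ω lam sα p) : p 0 = sα :=
  (existsUnique_descentPoint hK hΩ hlam hs h0 0).unique (hp.isDescentPoint le_rfl)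
    ⟨slitPlane_of_mem_region hΩ ((ofReal_mem_regionAlpha hΩ).2 hs), by simp, by simp⟩

theorem alpha_path (hs : sα ∈ realRegion Ω) (hp : IsSteepestDescentPath Ω lam sα p) (u : ℝ) :
    alpha Ω lam (p u) = alpha Ω lam sα - (u : ℂ) ^ 2 := by
  rcases le_or_gt 0 u with hu | hu
  · exact hp.descent u hu
  · rw [hp.symm u hu, alpha_conj (hp.mem_domain _), hp.descent (-u) (by linarith),
      alpha_ofReal hs]
    simp

theorem path_im (hK : 0 < K) (hΩ : ∀ k, 0 < Ω k) (hs : sα ∈ realRegion Ω)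
    (h0 : alphaDerivReal Ω lam sα = 0) (hp : IsSteepestDescentPath Ω lam sα p) (u : ℝ)
    (hu : u ≠ 0) : 0 < u * (p u).im := by
  have key : ∀ v : ℝ, 0 < v → 0 < (p v).im := fun v hv => by
    refine lt_of_le_of_ne (hp.im_nonneg v hv.le) fun h => ?_
    exact hv.ne' (isDescentPoint_im_zero hK hΩ hs h0 (hp.isDescentPoint hv.le) h.symm).2
  rcases lt_or_gt_of_ne hu with h | h
  · have := key (-u) (by linarith)
    rw [hp.symm u h, Complex.conj_im]
    nlinarith
  · exact mul_pos h (key u h)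

theorem eq_path (hK : 0 < K) (hΩ : ∀ k, 0 < Ω k) (hlam : 0 < lam) (hs : sα ∈ realRegion Ω)
    (h0 : alphaDerivReal Ω lam sα = 0) (hp : IsSteepestDescentPath Ω lam sα p) {s : ℂ} {u : ℝ}
    (hdom : ∀ k, 1 + 2 * s * Ω k ∈ Complex.slitPlane)
    (hu : 0 < u * s.im) (h : alpha Ω lam s = alpha Ω lam sα - (u : ℂ) ^ 2) : s = p u := by
  rcases le_or_gt 0 u with hu0 | hu0
  · exact (existsUnique_descentPoint hK hΩ hlam hs h0 u).unique
      ⟨hdom, (pos_of_mul_pos_right hu hu0).le, h⟩ (hp.isDescentPoint hu0)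
  · have him : s.im < 0 := neg_of_mul_pos_right hu hu0.le
    have h1 : IsDescentPoint Ω lam sα (-u) ((starRingEnd ℂ) s) :=
      ⟨fun k => conj_mem_slitPlane (hdom k), by rw [Complex.conj_im]; linarith, by
        rw [alpha_conj hdom, h, alpha_ofReal hs]; simp⟩
    rw [hp.symm u hu0, ← (existsUnique_descentPoint hK hΩ hlam hs h0 (-u)).unique h1
      (hp.isDescentPoint (by linarith)), Complex.conj_conj]

theorem eventually_slitPlane (hΩ : ∀ k, 0 < Ω k) (hs : sα ∈ realRegion Ω) :
    ∀ᶠ s : ℂ in 𝓝 (sα : ℂ), ∀ k, 1 + 2 * s * Ω k ∈ Complex.slitPlane :=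
  eventually_all.2 fun k => ContinuousAt.eventually_mem
    (f := fun z : ℂ => 1 + 2 * z * Ω k) (by fun_prop) (Complex.isOpen_slitPlane.mem_nhds
      (slitPlane_of_mem_region hΩ ((ofReal_mem_regionAlpha hΩ).2 hs) k))

theorem pathSeries_alpha (hK : 0 < K) (hΩ : ∀ k, 0 < Ω k) (hlam : 0 < lam)
    (hs : sα ∈ realRegion Ω) (h0 : alphaDerivReal Ω lam sα = 0)
    (hp : IsSteepestDescentPath Ω lam sα p) :
    PathSeries (alpha Ω lam) sα (aCoeff Ω lam sα) p ∧ ∃ q : ℂ → ℂ,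
      HasSeries q 0 (PowerSeries.mk (pCoeff sα (fCoeff (aCoeff Ω lam sα)))) ∧
      ∀ᶠ u : ℝ in 𝓝 0, p u = q u := by
  refine pathSeries_of_solution rfl (aCoeff_sign hK hΩ hs) (hasSeries_alpha hΩ hs h0)
    (path_zero hK hΩ hlam hs h0 hp) (alpha_path hs hp) (path_im hK hΩ hs h0 hp) ?_
  filter_upwards [eventually_slitPlane hΩ hs] with s hdom u hu h
  exact eq_path hK hΩ hlam hs h0 hp hdom hu h

theorem pathSeries_beta (hK : 0 < K) (hΩ : ∀ k, 0 < Ω k) (hlam : 0 < lam)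
    (hs : sα ∈ realRegion Ω) (h0 : alphaDerivReal Ω lam sα = 0)
    (hp : IsSteepestDescentPath Ω lam sα p) {sβ : ℝ} (hβ : sβ = sα - 1 / 2) {pβ : ℝ → ℂ}
    (hpβ : ∀ u, pβ u = p u - 1 / 2) :
    PathSeries (beta Ω lam) sβ (bCoeff Ω lam sα sβ) pβ ∧ ∃ q : ℂ → ℂ,
      HasSeries q 0 (PowerSeries.mk (pCoeff sβ (fCoeff (bCoeff Ω lam sα sβ)))) ∧
      ∀ᶠ u : ℝ in 𝓝 0, pβ u = q u := by
  have hc : (sβ : ℂ) + 1 / 2 = sα := by rw [hβ]; push_cast; ring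
  refine pathSeries_of_solution rfl (bCoeff_sign hK hΩ hs) (hasSeries_beta hΩ hs h0 hβ)
    ?_ (fun u => ?_) (fun u hu => ?_) ?_
  · rw [hpβ, path_zero hK hΩ hlam hs h0 hp, hβ]; push_cast; ring
  · rw [beta_eq, beta_eq, hpβ, sub_add_cancel, hc, alpha_path hs hp]
    ring
  · have : (pβ u).im = (p u).im := by rw [hpβ]; simp
    rw [this]
    exact path_im hK hΩ hs h0 hp u hu
  · have ht : Tendsto (fun s : ℂ => s + 1 / 2) (𝓝 (sβ : ℂ)) (𝓝 (sα : ℂ)) := by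
      rw [← hc]; exact (continuous_id.add continuous_const).tendsto _
    filter_upwards [ht.eventually (eventually_slitPlane hΩ hs)] with s hdom u hu h
    rw [beta_eq, beta_eq, hc] at h
    have him : (s + 1 / 2).im = s.im := by simp
    rw [hpβ, ← eq_path hK hΩ hlam hs h0 hp hdom (by rwa [him])
      (by linear_combination h)]
    ring

end Path

end Series

/-! ### Inversion of the Laplace transform of a distribution -/

/-- The exponentially tilted step function with Laplace transform `1 / γ`. -/
def expStep (γ t : ℝ) : ℂ :=
  if 0 < γ then (Set.Ioi 0).indicator (fun t : ℝ => Complex.exp (-γ * t)) t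
  else (Set.Iic 0).indicator (fun t : ℝ => -Complex.exp (-γ * t)) t

theorem measurable_expStep (γ : ℝ) : Measurable (expStep γ) := by
  unfold expStep
  split_ifs
  · exact (by fun_prop : Measurable fun t : ℝ => Complex.exp (-γ * t)).indicator measurableSet_Ioi
  · exact (by fun_prop : Measurable fun t : ℝ => -Complex.exp (-γ * t)).indicator measurableSet_Iic

theorem integral_expStep {γ : ℝ} (hγ : γ ≠ 0) (ω : ℝ) :
    Integrable (fun t : ℝ => Complex.exp (-(ω * Complex.I) * t) * expStep γ t) ∧
    ∫ t : ℝ, Complex.exp (-(ω * Complex.I) * t) * expStep γ t = 1 / (γ + ω * Complex.I) := by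
  have hz : (γ + ω * Complex.I : ℂ) ≠ 0 := fun h => hγ (by simpa using congrArg Complex.re h)
  rcases lt_or_gt_of_ne hγ with h | h
  · have he : (fun t : ℝ => Complex.exp (-(ω * Complex.I) * t) * expStep γ t) =
        (Set.Iic 0).indicator fun t : ℝ => -Complex.exp (-(γ + ω * Complex.I) * t) := by
      funext t
      rw [expStep, if_neg (not_lt.2 h.le)]
      by_cases ht : t ∈ Set.Iic 0
      · rw [Set.indicator_of_mem ht, Set.indicator_of_mem ht, mul_neg, ← Complex.exp_add]
        congr 2; ring
      · rw [Set.indicator_of_notMem ht, Set.indicator_of_notMem ht, mul_zero]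
    have hre : 0 < (-(γ + ω * Complex.I) : ℂ).re := by simpa using h
    rw [he]
    refine ⟨(integrable_indicator_iff measurableSet_Iic).2
      (integrableOn_exp_mul_complex_Iic hre 0).neg, ?_⟩
    rw [integral_indicator measurableSet_Iic, integral_neg, integral_exp_mul_complex_Iic hre]
    rw [Complex.ofReal_zero, mul_zero, Complex.exp_zero]
    field_simp
  · have he : (fun t : ℝ => Complex.exp (-(ω * Complex.I) * t) * expStep γ t) =
        (Set.Ioi 0).indicator fun t : ℝ => Complex.exp (-(γ + ω * Complex.I) * t) := by
      funext t
      rw [expStep, if_pos h]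
      by_cases ht : t ∈ Set.Ioi 0
      · rw [Set.indicator_of_mem ht, Set.indicator_of_mem ht, ← Complex.exp_add]
        congr 1; ring
      · rw [Set.indicator_of_notMem ht, Set.indicator_of_notMem ht, mul_zero]
    have hre : (-(γ + ω * Complex.I) : ℂ).re < 0 := by simpa using h
    rw [he]
    refine ⟨(integrable_indicator_iff measurableSet_Ioi).2
      (integrableOn_exp_mul_complex_Ioi hre 0), ?_⟩
    rw [integral_indicator measurableSet_Ioi, integral_exp_mul_complex_Ioi hre]
    rw [Complex.ofReal_zero, mul_zero, Complex.exp_zero]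
    field_simp

theorem integrable_expStep {γ : ℝ} (hγ : γ ≠ 0) : Integrable (expStep γ) := by
  simpa using (integral_expStep hγ 0).1

/-- For `γ < 0` integrability demands the step minus the constant `1`, and this constant is the
origin of the unit step in the expansions. The last bracket only accounts for the default branch at
`γ = 0`. -/
theorem exp_mul_expStep (γ τ t : ℝ) : Complex.exp (-γ * τ) * expStep γ (t - τ) =
    Complex.exp (-γ * t) * ((if τ < t then 1 else 0) - unitStep (-γ) + (if γ = 0 then -1 else 0)) := by
  have e : Complex.exp (-γ * τ) * Complex.exp (-γ * (t - τ : ℝ)) = Complex.exp (-γ * t) := by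
    rw [← Complex.exp_add]; congr 1; push_cast; ring
  unfold expStep unitStep
  by_cases ht : τ < t
  · have h1 : t - τ ∈ Set.Ioi (0 : ℝ) := sub_pos.2 ht
    have h2 : t - τ ∉ Set.Iic (0 : ℝ) := not_le.2 (sub_pos.2 ht)
    rw [Set.indicator_of_mem h1, Set.indicator_of_notMem h2]
    rcases lt_trichotomy γ 0 with h | h | h
    · simp [ht, h, h.ne, not_lt.2 h.le]
    · simp [ht, h]
    · simpa [ht, h, h.ne', not_lt.2 h.le] using e
  · have h1 : t - τ ∉ Set.Ioi (0 : ℝ) := fun h => ht (sub_pos.1 h)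
    have h2 : t - τ ∈ Set.Iic (0 : ℝ) := sub_nonpos.2 (not_lt.1 ht)
    rw [Set.indicator_of_notMem h1, Set.indicator_of_mem h2]
    rcases lt_trichotomy γ 0 with h | h | h
    · simpa [ht, h, h.ne, not_lt.2 h.le] using e
    · simp [ht, h]
    · simp [ht, h, h.ne', not_lt.2 h.le]

/-- The function `g(t) = e^{-γ t} (P[T < t] - 1(-γ))` is an average of translates of `expStep`,
hence integrable, and by Fubini its Fourier transform is the Laplace transform of `T` divided by `γ
+ iω`. Absence of an atom makes `g` continuous at `c`, so pointwise Fourier inversion applies there.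
-/
theorem laplace_inversion {E : Type*} [MeasurableSpace E] (ν : Measure E) [IsProbabilityMeasure ν]
    {T : E → ℝ} (hT : Measurable T) {γ : ℝ} (hγ : γ ≠ 0) (c : ℝ)
    (hexp : Integrable (fun x => Real.exp (-γ * T x)) ν) (hatom : ν {x | T x = c} = 0)
    (hφ : Integrable fun ω : ℝ => (∫ x, Complex.exp (-(γ + ω * Complex.I) * T x) ∂ν) /
      (γ + ω * Complex.I)) :
    (ν.real {x | T x ≤ c} : ℂ) = unitStep (-γ) + 1 / (2 * Real.pi) *
      ∫ ω : ℝ, Complex.exp ((γ + ω * Complex.I) * c) *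
        ((∫ x, Complex.exp (-(γ + ω * Complex.I) * T x) ∂ν) / (γ + ω * Complex.I)) := by
  set k : ℝ → E → ℂ := fun t x => Complex.exp (-γ * T x) * expStep γ (t - T x) with hk
  have hkstep : ∀ t x, k t x = Complex.exp (-γ * t) * ((if T x < t then 1 else 0) - unitStep (-γ)) :=
    fun t x => by rw [hk]; simp only; rw [exp_mul_expStep, if_neg hγ, add_zero]
  set g : ℝ → ℂ := fun t => ∫ x, k t x ∂ν with hg
  have hstepmeas : ∀ t : ℝ, MeasurableSet {x | T x < t} := fun t => hT measurableSet_Iio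
  have hgval : ∀ t, g t = Complex.exp (-γ * t) * ((ν.real {x | T x < t} : ℂ) - unitStep (-γ)) := by
    intro t
    rw [hg]
    simp only [hkstep]
    rw [integral_const_mul]
    congr 1
    have he : (fun x => (if T x < t then (1 : ℂ) else 0)) = {x | T x < t}.indicator fun _ => 1 := by
      funext x; simp [Set.indicator_apply]
    have hi : Integrable (fun x => if T x < t then (1 : ℂ) else 0) ν := by
      rw [he]; exact (integrable_const _).indicator (hstepmeas t)
    rw [integral_sub hi (integrable_const _), he, integral_indicator_const _ (hstepmeas t)]
    simp
  -- the joint integrability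
  have hJ := integrable_expStep hγ
  have hkm : Measurable (Function.uncurry k) := by
    rw [hk]
    refine Measurable.mul (f := fun q : ℝ × E => Complex.exp (-γ * T q.2)) (by fun_prop) ?_
    exact (measurable_expStep γ).comp (measurable_fst.sub (hT.comp measurable_snd))
  -- The norm is `e^{-γ T(x)} |expStep γ (t - T x)|`; by translation invariance its `t`-integral is
  -- `e^{-γ T(x)}` times a constant.
  have hH : ∀ w : ℝ, Integrable (fun q : ℝ × E => Complex.exp (-(w * Complex.I) * q.1) *
      k q.1 q.2) (volume.prod ν) := by
    intro w
    have hm : Measurable fun q : ℝ × E => Complex.exp (-(w * Complex.I) * q.1) * k q.1 q.2 :=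
      (by fun_prop : Measurable fun q : ℝ × E => Complex.exp (-(w * Complex.I) * q.1)).mul hkm
    have hn : ∀ (t : ℝ) x, ‖Complex.exp (-(w * Complex.I) * t) * k t x‖ =
        Real.exp (-γ * T x) * ‖expStep γ (t - T x)‖ := by
      intro t x
      rw [hk, norm_mul, norm_mul, Complex.norm_exp, Complex.norm_exp]
      simp
    rw [integrable_prod_iff' hm.aestronglyMeasurable]
    refine ⟨Eventually.of_forall fun x => ?_, ?_⟩
    · refine ((hJ.comp_sub_right (T x)).norm.const_mul (Real.exp (-γ * T x))).mono'
        (hm.comp measurable_prodMk_right).aestronglyMeasurable (Eventually.of_forall fun t => ?_)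
      exact (hn t x).le
    · simp only [hn]
      simp_rw [integral_const_mul]
      have : ∀ x, ∫ t, ‖expStep γ (t - T x)‖ = ∫ t, ‖expStep γ t‖ := fun x =>
        integral_sub_right_eq_self (fun t => ‖expStep γ t‖) (T x)
      simp_rw [this]
      exact hexp.mul_const _
  have hgi : Integrable g := by
    have := (hH 0).integral_prod_left
    simpa using this
  -- the Fourier transform
  have hF : ∀ w : ℝ, ∫ t : ℝ, Complex.exp (-(w * Complex.I) * t) * g t =
      (∫ x, Complex.exp (-(γ + w * Complex.I) * T x) ∂ν) / (γ + w * Complex.I) := by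
    intro w
    have h1 : ∀ t : ℝ, Complex.exp (-(w * Complex.I) * t) * g t =
        ∫ x, Complex.exp (-(w * Complex.I) * t) * k t x ∂ν := fun t => by
      rw [hg, integral_const_mul]
    simp_rw [h1]
    rw [integral_integral_swap (f := fun (t : ℝ) x => Complex.exp (-(w * Complex.I) * t) * k t x)
      (hH w), ← integral_div]
    congr 1
    funext x
    have h2 : ∀ t : ℝ, Complex.exp (-(w * Complex.I) * t) * k t x =
        Complex.exp (-(γ + w * Complex.I) * T x) *
          (Complex.exp (-(w * Complex.I) * (t - T x : ℝ)) * expStep γ (t - T x)) := by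
      intro t
      rw [hk]
      simp only
      rw [← mul_assoc, ← mul_assoc, ← Complex.exp_add, ← Complex.exp_add]
      congr 2
      push_cast
      ring
    simp_rw [h2]
    rw [integral_const_mul, integral_sub_right_eq_self
      (fun t : ℝ => Complex.exp (-(w * Complex.I) * t) * expStep γ t) (T x),
      (integral_expStep hγ w).2, mul_one_div]
  have hFourier : ∀ w : ℝ, FourierTransform.fourier g w =
      (∫ x, Complex.exp (-(γ + ((2 * Real.pi * w : ℝ) : ℂ) * Complex.I) * T x) ∂ν) /
        (γ + ((2 * Real.pi * w : ℝ) : ℂ) * Complex.I) := by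
    intro w
    rw [← hF, Real.fourier_eq']
    congr 1
    funext t
    rw [smul_eq_mul]
    congr 2
    simp
    ring
  have hcont : ContinuousAt g c := by
    have hM : ContinuousAt (fun t : ℝ => Real.exp (-γ * t)) c := by fun_prop
    refine continuousAt_of_dominated (bound := fun _ => (Real.exp (-γ * c) + 1) * 2)
      (Eventually.of_forall fun t => (hkm.comp measurable_prodMk_left).aestronglyMeasurable) ?_
      (integrable_const _) ?_
    · filter_upwards [hM.eventually (gt_mem_nhds (lt_add_one _))] with t ht
      refine Eventually.of_forall fun x => ?_
      rw [hkstep, norm_mul, Complex.norm_exp]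
      have h1 : (-(γ : ℂ) * t).re = -γ * t := by simp
      rw [h1]
      refine mul_le_mul ht.le ?_ (norm_nonneg _) (by positivity)
      refine (norm_sub_le _ _).trans ?_
      have h2 : ‖(if T x < t then (1 : ℂ) else 0)‖ ≤ 1 := by split_ifs <;> simp
      have h3 : ‖((unitStep (-γ) : ℝ) : ℂ)‖ ≤ 1 := by unfold unitStep; split_ifs <;> simp
      linarith
    · have : ∀ᵐ x ∂ν, T x ≠ c := by rw [ae_iff]; simpa using hatom
      filter_upwards [this] with x hx
      simp only [hkstep]
      refine ContinuousAt.mul (by fun_prop) (ContinuousAt.sub ?_ continuousAt_const)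
      rcases lt_or_gt_of_ne hx with h | h
      · refine continuousAt_const.congr (f := fun _ => (1 : ℂ)) ?_
        filter_upwards [lt_mem_nhds h] with t ht
        rw [if_pos ht]
      · refine continuousAt_const.congr (f := fun _ => (0 : ℂ)) ?_
        filter_upwards [gt_mem_nhds h] with t ht
        rw [if_neg ht.not_gt]
  have hFi : Integrable (FourierTransform.fourier g) := by
    have h1 := hφ.comp_mul_left' (R := 2 * Real.pi) (by positivity)
    exact h1.congr (Eventually.of_forall fun w => (hFourier w).symm)
  have hinv := hgi.fourierInv_fourier_eq hFi hcont
  rw [Real.fourierInv_eq', hgval] at hinv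
  have hle : ν.real {x | T x ≤ c} = ν.real {x | T x < c} := by
    refine measureReal_congr ?_
    have : ∀ᵐ x ∂ν, T x ≠ c := by rw [ae_iff]; simpa using hatom
    filter_upwards [this] with x hx
    exact propext ⟨fun h => lt_of_le_of_ne h hx, fun h => le_of_lt h⟩
  set M : ℝ → ℂ := fun ω => (∫ x, Complex.exp (-(γ + ω * Complex.I) * T x) ∂ν) /
      (γ + ω * Complex.I) with hMdef
  -- The substitution `ω = 2π w` accounts for the normalization of the Fourier transform.
  have hchange : ∫ w : ℝ, Complex.exp ((2 * Real.pi * inner ℝ w c : ℝ) * Complex.I) •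
      FourierTransform.fourier g w =
      1 / (2 * Real.pi) * ∫ ω : ℝ, Complex.exp (ω * Complex.I * c) * M ω := by
    have h1 : ∀ w : ℝ, Complex.exp ((2 * Real.pi * inner ℝ w c : ℝ) * Complex.I) •
        FourierTransform.fourier g w = (fun ω : ℝ => Complex.exp (ω * Complex.I * c) * M ω)
          (2 * Real.pi * w) := by
      intro w
      rw [hFourier, hMdef, smul_eq_mul]
      simp only
      congr 2
      simp
      ring
    rw [integral_congr_ae (Eventually.of_forall h1), Measure.integral_comp_mul_left
      (fun ω : ℝ => Complex.exp (ω * Complex.I * c) * M ω), abs_of_pos (by positivity), Complex.real_smul]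
    push_cast
    rw [one_div]
  rw [hchange] at hinv
  have hfin : ∀ ω : ℝ, Complex.exp ((γ + ω * Complex.I) * c) * M ω =
      Complex.exp (γ * c) * (Complex.exp (ω * Complex.I * c) * M ω) := fun ω => by
    rw [add_mul, Complex.exp_add, mul_assoc]
  have hexp1 : Complex.exp (γ * c) * Complex.exp (-γ * c) = 1 := by
    rw [← Complex.exp_add]; simp
  change _ = _ + 1 / (2 * (Real.pi : ℂ)) *
    ∫ ω : ℝ, Complex.exp ((γ + ω * Complex.I) * c) * M ω
  simp_rw [hfin]
  rw [integral_const_mul, hle]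
  linear_combination (-Complex.exp (γ * c)) * hinv -
    ((ν.real {x | T x < c} : ℂ) - unitStep (-γ)) * hexp1

section ErrorProbabilities

/-! ### The test statistic and its Laplace transforms -/

/-- The statistic `∑ k, Ω k / (1 + Ω k) * ‖b k / σ k - (1 + Ω k) / Ω k • a k / σ k‖ ^ 2`. -/
def testStatistic {K d : ℕ} (Ω σ : Fin K → ℝ) (a b : Fin K → Fin d → ℝ) : ℝ :=
  ∑ k, ∑ j, Ω k / (1 + Ω k) * (b k j / σ k - (1 + Ω k) / Ω k * (a k j / σ k)) ^ 2

variable {K d : ℕ} {P σ Ω : Fin K → ℝ} {lam : ℝ}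

theorem two_mul_log_two_mul_capacity (Ω : Fin K → ℝ) :
    2 * Real.log 2 * capacity Ω = 1 / (K : ℝ) * ∑ k, Real.log (1 + Ω k) := by
  have h2 : Real.log 2 ≠ 0 := (Real.log_pos one_lt_two).ne'
  rw [capacity, mul_left_comm, Finset.mul_sum]
  congr 1
  refine Finset.sum_congr rfl fun k _ => ?_
  rw [Real.logb]
  field_simp

theorem outputDensity_pos (hΩ : ∀ k, 0 < snr P σ k) (hσ : ∀ k, 0 < σ k) (b : Fin K → Fin d → ℝ) :
    0 < outputDensity P σ b := by
  refine Finset.prod_pos fun k _ => mul_pos (one_div_pos.2 (Real.rpow_pos_of_pos ?_ _))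
    (Real.exp_pos _)
  have := hΩ k
  have := hσ k
  have := Real.pi_pos
  positivity

theorem measurable_outputDensity : Measurable (outputDensity (d := d) P σ) := by
  unfold outputDensity; fun_prop

theorem measurable_transitionDensity (a : Fin K → Fin d → ℝ) :
    Measurable (transitionDensity σ a) := by
  unfold transitionDensity; fun_prop

theorem measurable_testStatistic (a : Fin K → Fin d → ℝ) : Measurable (testStatistic Ω σ a) := by
  unfold testStatistic; fun_prop

/-- Expand the squares: the codeword enters through the inner products with `b`, which `T` absorbs,
and through its block norms, which the power constraint fixes. The explicit factor `exp(-T / 2)` is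
the tilt that relates the two laws. -/
theorem transitionDensity_eq (hK : 0 < K) (hΩ : ∀ k, 0 < Ω k) (hσ : ∀ k, 0 < σ k)
    (hsnr : Ω = snr P σ) {a : Fin K → Fin d → ℝ} (ha : a ∈ codewordSet P d)
    (b : Fin K → Fin d → ℝ) : transitionDensity σ a b = outputDensity P σ b *
      Real.exp (((K * d : ℕ) : ℝ) / 2 * (1 + 2 * Real.log 2 * capacity Ω) -
        testStatistic Ω σ a b / 2) := by
  have hK' : (K : ℝ) ≠ 0 := by positivity
  have hexp : ((K * d : ℕ) : ℝ) / 2 * (1 + 2 * Real.log 2 * capacity Ω) -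
      testStatistic Ω σ a b / 2 = ∑ k, ((d : ℝ) / 2 * (1 + Real.log (1 + Ω k)) -
        (∑ j, Ω k / (1 + Ω k) * (b k j / σ k - (1 + Ω k) / Ω k * (a k j / σ k)) ^ 2) / 2) := by
    rw [two_mul_log_two_mul_capacity, testStatistic, Finset.sum_sub_distrib, ← Finset.sum_div,
      ← Finset.mul_sum, Finset.sum_add_distrib]
    simp only [Finset.sum_const, Finset.card_univ, Fintype.card_fin, nsmul_eq_mul, mul_one]
    push_cast
    field_simp
  rw [hexp, Real.exp_sum, transitionDensity, outputDensity, ← Finset.prod_mul_distrib]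
  refine Finset.prod_congr rfl fun k _ => ?_
  have hw := hΩ k
  have hs := hσ k
  have hPk : P k = Ω k * σ k ^ 2 := by rw [hsnr, snr]; field_simp
  have hA : ∑ j, a k j ^ 2 = d * (Ω k * σ k ^ 2) := by rw [← hPk]; exact ha k
  rw [← hsnr]
  have hpow : (1 / (2 * Real.pi * σ k ^ 2) ^ ((d : ℝ) / 2)) =
      1 / (2 * Real.pi * σ k ^ 2 * (1 + Ω k)) ^ ((d : ℝ) / 2) *
        Real.exp ((d : ℝ) / 2 * Real.log (1 + Ω k)) := by
    have h1 := Real.rpow_pos_of_pos (by positivity : 0 < 1 + Ω k) ((d : ℝ) / 2)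
    rw [Real.mul_rpow (x := 2 * Real.pi * σ k ^ 2) (y := 1 + Ω k)
      (by have := Real.pi_pos; positivity) (by positivity), mul_comm ((d : ℝ) / 2) (Real.log _),
      ← Real.rpow_def_of_pos (by positivity : 0 < 1 + Ω k), one_div, one_div, mul_inv,
      inv_mul_cancel_right₀ h1.ne']
  rw [hpow, mul_assoc, ← Real.exp_add, mul_assoc (1 / _), ← Real.exp_add]
  congr 2
  set X := ∑ j, b k j * a k j with hX
  set B := ∑ j, b k j ^ 2 with hB
  have h1 : ∑ j, (b k j - a k j) ^ 2 = B - 2 * X + d * (Ω k * σ k ^ 2) := by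
    rw [← hA, hB, hX, Finset.mul_sum, ← Finset.sum_sub_distrib, ← Finset.sum_add_distrib]
    exact Finset.sum_congr rfl fun j _ => by ring
  have h2 : ∑ j, Ω k / (1 + Ω k) * (b k j / σ k - (1 + Ω k) / Ω k * (a k j / σ k)) ^ 2 =
      Ω k / (1 + Ω k) / σ k ^ 2 * B - 2 / σ k ^ 2 * X +
        (1 + Ω k) / Ω k / σ k ^ 2 * (d * (Ω k * σ k ^ 2)) := by
    rw [← hA, hB, hX, Finset.mul_sum, Finset.mul_sum, Finset.mul_sum, ← Finset.sum_sub_distrib,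
      ← Finset.sum_add_distrib]
    refine Finset.sum_congr rfl fun j _ => ?_
    field_simp
    ring
  rw [h1, h2]
  field_simp
  ring

theorem logLikelihood_eq (hK : 0 < K) (hd : 0 < d) (hΩ : ∀ k, 0 < Ω k) (hσ : ∀ k, 0 < σ k)
    (hsnr : Ω = snr P σ) {a : Fin K → Fin d → ℝ} (ha : a ∈ codewordSet P d)
    (b : Fin K → Fin d → ℝ) : logLikelihood P σ a b = (1 + 2 * Real.log 2 * capacity Ω) / 2 -
      testStatistic Ω σ a b / (2 * ((K * d : ℕ) : ℝ)) := by
  have hpos := outputDensity_pos (d := d) (P := P) (σ := σ) (hsnr ▸ hΩ) hσ b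
  have hn : (0 : ℝ) < ((K * d : ℕ) : ℝ) := by exact_mod_cast Nat.mul_pos hK hd
  rw [logLikelihood, transitionDensity_eq hK hΩ hσ hsnr ha, mul_div_cancel_left₀ _ hpos.ne',
    Real.log_exp]
  field_simp

theorem threshold_le_iff (hK : 0 < K) (hd : 0 < d) (hΩ : ∀ k, 0 < Ω k) (hσ : ∀ k, 0 < σ k)
    (hsnr : Ω = snr P σ) {a : Fin K → Fin d → ℝ} (ha : a ∈ codewordSet P d)
    (b : Fin K → Fin d → ℝ) : threshold Ω lam ≤ logLikelihood P σ a b ↔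
      testStatistic Ω σ a b ≤ ((K * d : ℕ) : ℝ) * lam := by
  have hn : (0 : ℝ) < ((K * d : ℕ) : ℝ) := by exact_mod_cast Nat.mul_pos hK hd
  rw [logLikelihood_eq hK hd hΩ hσ hsnr ha, threshold]
  have h1 : testStatistic Ω σ a b / (2 * ((K * d : ℕ) : ℝ)) =
    testStatistic Ω σ a b / ((K * d : ℕ) : ℝ) / 2 := by field_simp
  rw [h1, ← div_le_iff₀' hn]
  constructor <;> intro h <;> linarith

/-- One coordinate of the Laplace transform. -/
theorem integral_coordinate {w t : ℝ} (hw : 0 < w) (ht : 0 < t) (x : ℝ) {s : ℂ}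
    (hs : 0 < 1 + 2 * s.re * w) :
    ∫ y : ℝ, ((1 / (2 * Real.pi * t ^ 2 * (1 + w)) ^ ((1 : ℝ) / 2) *
      Real.exp (-(y ^ 2) / (2 * t ^ 2 * (1 + w))) : ℝ) : ℂ) *
      Complex.exp (-s * (w / (1 + w) * (y / t - (1 + w) / w * (x / t)) ^ 2 : ℝ)) =
    Complex.exp (-(1 / 2) * Complex.log (1 + 2 * s * w) -
      s * ((1 + w) / w / t ^ 2 * x ^ 2 : ℝ) / (1 + 2 * s * w)) := by
  have hzre : 0 < (1 + 2 * s * w).re := by rwa [re_one_add_two_mul]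
  set z : ℂ := 1 + 2 * s * w with hz
  have hz0 : z ≠ 0 := fun h => by rw [h] at hzre; simp at hzre
  have hv : 0 < t ^ 2 * (1 + w) := by positivity
  have htC : (t : ℂ) ≠ 0 := by exact_mod_cast ht.ne'
  have hwC : (w : ℂ) ≠ 0 := by exact_mod_cast hw.ne'
  have hw1C : (1 + w : ℂ) ≠ 0 := by exact_mod_cast (by positivity : (1 + w) ≠ 0)
  have hzw : 2 * s * w = z - 1 := by rw [hz]; ring
  have hsz : s = (z - 1) / (2 * w) := by rw [← hzw]; field_simp
  set B : ℂ := -(((1 / (2 * (t ^ 2 * (1 + w))) : ℝ) : ℂ) * z) with hB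
  have hBre : B.re < 0 := by
    rw [hB, Complex.neg_re, Complex.re_ofReal_mul]
    have := mul_pos (by positivity : 0 < 1 / (2 * (t ^ 2 * (1 + w)))) hzre
    linarith
  have hint : ∀ y : ℝ, ((1 / (2 * Real.pi * t ^ 2 * (1 + w)) ^ ((1 : ℝ) / 2) *
      Real.exp (-(y ^ 2) / (2 * t ^ 2 * (1 + w))) : ℝ) : ℂ) *
      Complex.exp (-s * (w / (1 + w) * (y / t - (1 + w) / w * (x / t)) ^ 2 : ℝ)) =
      ((1 / (2 * Real.pi * t ^ 2 * (1 + w)) ^ ((1 : ℝ) / 2) : ℝ) : ℂ) *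
        Complex.exp (B * (y : ℂ) ^ 2 + (2 * s * x / t ^ 2) * y +
          -(s * ((1 + w) / w / t ^ 2 * x ^ 2))) := by
    intro y
    rw [Complex.ofReal_mul, mul_assoc, Complex.ofReal_exp, ← Complex.exp_add]
    congr 2
    rw [hB, hsz]
    push_cast
    field_simp
    ring
  simp_rw [hint]
  rw [integral_const_mul, integral_cexp_quadratic hBre]
  -- Here `π / (-B)` is a positive number times `z⁻¹` with `Re z > 0`, so the root supplied by the
  -- Gaussian integral is the one with the principal logarithm of `z`.
  have hroot : (Real.pi / -B : ℂ) ^ (1 / 2 : ℂ) =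
      (((2 * Real.pi * t ^ 2 * (1 + w)) ^ ((1 : ℝ) / 2) : ℝ) : ℂ) *
        Complex.exp (-(1 / 2) * Complex.log z) := by
    have hpi := Real.pi_pos
    have hpiC : (Real.pi : ℂ) ≠ 0 := by exact_mod_cast hpi.ne'
    have h1 : (Real.pi / -B : ℂ) = ((2 * Real.pi * t ^ 2 * (1 + w) : ℝ) : ℂ) * z⁻¹ := by
      rw [hB]; push_cast; field_simp
    have h2 : z⁻¹ ≠ 0 := inv_ne_zero hz0
    rw [h1, Complex.cpow_def_of_ne_zero (mul_ne_zero (by exact_mod_cast (by positivity)) h2),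
      Complex.log_ofReal_mul (by positivity) h2,
      Complex.log_inv _ (Complex.slitPlane_arg_ne_pi (Or.inl hzre)), add_mul, Complex.exp_add,
      Real.rpow_def_of_pos (by positivity)]
    push_cast
    congr 2
    ring
  have hpos : (0 : ℝ) < (2 * Real.pi * t ^ 2 * (1 + w)) ^ ((1 : ℝ) / 2) :=
    Real.rpow_pos_of_pos (by have := Real.pi_pos; positivity) _
  rw [hroot, ← mul_assoc, ← mul_assoc, ← Complex.ofReal_mul, one_div_mul_cancel hpos.ne',
    Complex.ofReal_one, one_mul, ← Complex.exp_add]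
  congr 1
  rw [hB, hsz]
  push_cast
  field_simp
  ring

/-- The integrand factors over all coordinates, and the product of the coordinate integrals depends
on the codeword only through its fixed block norms. Subtracting `2 λ s` cancels the linear term of
`α`, so the threshold does not really occur. -/
theorem integral_outputDensity (hK : 0 < K) (hΩ : ∀ k, 0 < Ω k) (hσ : ∀ k, 0 < σ k)
    (hsnr : Ω = snr P σ) {a : Fin K → Fin d → ℝ} (ha : a ∈ codewordSet P d) {s : ℂ}
    (hs : s ∈ regionAlpha Ω) :
    ∫ b : Fin K → Fin d → ℝ, (outputDensity P σ b : ℂ) *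
      Complex.exp (-s * testStatistic Ω σ a b) =
    Complex.exp (((K * d : ℕ) : ℂ) / 2 * (alpha Ω lam s - 2 * lam * s)) := by
  have hK' : (K : ℂ) ≠ 0 := by exact_mod_cast hK.ne'
  set G : (k : Fin K) → (j : Fin d) → ℝ → ℂ := fun k j y =>
    ((1 / (2 * Real.pi * σ k ^ 2 * (1 + Ω k)) ^ ((1 : ℝ) / 2) *
      Real.exp (-(y ^ 2) / (2 * σ k ^ 2 * (1 + Ω k))) : ℝ) : ℂ) *
      Complex.exp (-s * (Ω k / (1 + Ω k) * (y / σ k - (1 + Ω k) / Ω k * (a k j / σ k)) ^ 2 : ℝ))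
    with hG
  have hfac : ∀ b : Fin K → Fin d → ℝ, (outputDensity P σ b : ℂ) *
      Complex.exp (-s * testStatistic Ω σ a b) = ∏ k, ∏ j, G k j (b k j) := by
    intro b
    have h1 : outputDensity P σ b = ∏ k, ∏ j,
        (1 / (2 * Real.pi * σ k ^ 2 * (1 + Ω k)) ^ ((1 : ℝ) / 2) *
          Real.exp (-(b k j ^ 2) / (2 * σ k ^ 2 * (1 + Ω k)))) := by
      rw [outputDensity, ← hsnr]
      refine Finset.prod_congr rfl fun k _ => ?_
      rw [Finset.prod_mul_distrib, ← Real.exp_sum, Finset.prod_const, Finset.card_univ,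
        Fintype.card_fin, ← Finset.sum_div, Finset.sum_neg_distrib, one_div_pow,
        ← Real.rpow_natCast _ d, ← Real.rpow_mul (by have := Real.pi_pos; have := hΩ k; positivity)]
      congr 4
      ring
    have h2 : Complex.exp (-s * testStatistic Ω σ a b) = ∏ k, ∏ j,
        Complex.exp (-s * (Ω k / (1 + Ω k) *
          (b k j / σ k - (1 + Ω k) / Ω k * (a k j / σ k)) ^ 2 : ℝ)) := by
      simp_rw [← Complex.exp_sum, ← Finset.mul_sum]
      rw [testStatistic]
      push_cast
      rfl
    rw [h1, h2, Complex.ofReal_prod, ← Finset.prod_mul_distrib]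
    refine Finset.prod_congr rfl fun k _ => ?_
    rw [Complex.ofReal_prod, ← Finset.prod_mul_distrib]
  simp_rw [hfac]
  rw [integral_fintype_prod_volume_eq_prod (fun k (bk : Fin d → ℝ) => ∏ j, G k j (bk j))]
  have hone : ∀ k, ∫ bk : Fin d → ℝ, ∏ j, G k j (bk j) =
      Complex.exp (-((d : ℂ) / 2) * (2 * s * (1 + Ω k) / (1 + 2 * s * Ω k) +
        Complex.log (1 + 2 * s * Ω k))) := by
    intro k
    rw [integral_fintype_prod_volume_eq_prod (fun j y => G k j y)]
    have hz := (mem_regionAlpha_iff hΩ).1 hs k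
    have hw := hΩ k
    have ht := hσ k
    simp_rw [hG, integral_coordinate hw ht _ hz]
    rw [← Complex.exp_sum]
    congr 1
    have hPk : P k = Ω k * σ k ^ 2 := by rw [hsnr, snr]; field_simp
    have hA : ∑ j, ((1 + Ω k) / Ω k / σ k ^ 2 * a k j ^ 2) = d * (1 + Ω k) := by
      rw [← Finset.mul_sum, ha k, hPk]; field_simp
    have hAC : ∑ j, s * (((1 + Ω k) / Ω k / σ k ^ 2 * a k j ^ 2 : ℝ) : ℂ) =
        s * ((d * (1 + Ω k) : ℝ) : ℂ) := by
      rw [← Finset.mul_sum, ← Complex.ofReal_sum, hA]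
    rw [Finset.sum_sub_distrib, ← Finset.sum_div, hAC]
    simp only [Finset.sum_const, Finset.card_univ, Fintype.card_fin, nsmul_eq_mul]
    push_cast
    ring
  simp_rw [hone]
  rw [← Complex.exp_sum, ← Finset.mul_sum, alpha]
  congr 1
  push_cast
  field_simp
  ring

/-- The tilt `exp(-T / 2)` replaces `s` by `s + 1/2` in the transform under `p_y`; the constant of
the tilt is the one in `β`. -/
theorem integral_transitionDensity (hK : 0 < K) (hΩ : ∀ k, 0 < Ω k) (hσ : ∀ k, 0 < σ k)
    (hsnr : Ω = snr P σ) {a : Fin K → Fin d → ℝ} (ha : a ∈ codewordSet P d) {s : ℂ}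
    (hs : s ∈ regionBeta Ω) :
    ∫ b : Fin K → Fin d → ℝ, (transitionDensity σ a b : ℂ) *
      Complex.exp (-s * testStatistic Ω σ a b) =
    Complex.exp (((K * d : ℕ) : ℂ) / 2 * (beta Ω lam s - 2 * lam * s)) := by
  have h1 : ∀ b, (transitionDensity σ a b : ℂ) * Complex.exp (-s * testStatistic Ω σ a b) =
      Complex.exp (((K * d : ℕ) : ℂ) / 2 * (1 + 2 * Real.log 2 * capacity Ω)) *
      ((outputDensity P σ b : ℂ) * Complex.exp (-(s + 1 / 2) * testStatistic Ω σ a b)) := by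
    intro b
    rw [transitionDensity_eq hK hΩ hσ hsnr ha, Complex.ofReal_mul, mul_left_comm, mul_assoc,
      Complex.ofReal_exp, ← Complex.exp_add, ← Complex.exp_add]
    congr 2
    push_cast
    ring
  simp_rw [h1]
  rw [integral_const_mul, integral_outputDensity (lam := lam) hK hΩ hσ hsnr ha hs,
    ← Complex.exp_add, beta]
  congr 1
  ring

theorem alpha_zero : alpha Ω lam 0 = 0 := by simp [alpha]

/-- This is the total mass of the transition density. At `1/2` each rational term of `α` equals `1`,
and the logarithms average to `2 log 2 * C`. -/
theorem beta_zero (hK : 0 < K) (hΩ : ∀ k, 0 < Ω k) : beta Ω lam 0 = 0 := by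
  have hK' : (K : ℂ) ≠ 0 := by exact_mod_cast hK.ne'
  have h1 : ∀ k, (2 * (1 / 2) * (1 + Ω k) / (1 + 2 * (1 / 2) * Ω k) +
      Complex.log (1 + 2 * (1 / 2) * Ω k) : ℂ) = 1 + (Real.log (1 + Ω k) : ℂ) := by
    intro k
    have hpos : (0 : ℝ) < 1 + Ω k := by have := hΩ k; positivity
    have : (1 + Ω k : ℂ) ≠ 0 := by exact_mod_cast hpos.ne'
    rw [show (2 * (1 / 2) : ℂ) = 1 by norm_num, one_mul, one_mul, div_self this,
      Complex.ofReal_log hpos.le]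
    push_cast
    rfl
  have h2 := two_mul_log_two_mul_capacity Ω
  have h3 : (2 * (Real.log 2 : ℂ) * (capacity Ω : ℂ)) =
      1 / (K : ℂ) * ∑ k, (Real.log (1 + Ω k) : ℂ) := by
    have h4 := congrArg (fun x : ℝ => (x : ℂ)) h2
    simpa only [Complex.ofReal_mul, Complex.ofReal_sum, Complex.ofReal_div, Complex.ofReal_one,
      Complex.ofReal_natCast, Complex.ofReal_ofNat] using h4
  rw [beta, alpha, zero_add, Finset.sum_congr rfl fun k _ => h1 k, h3, Finset.sum_add_distrib]
  simp only [Finset.sum_const, Finset.card_univ, Fintype.card_fin, nsmul_eq_mul, mul_one]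
  field_simp
  ring

/-- The level set lies on the frontier of a convex sublevel set, and frontiers of convex sets are
null. -/
theorem volume_testStatistic_eq (hΩ : ∀ k, 0 < Ω k) (hσ : ∀ k, 0 < σ k)
    (a : Fin K → Fin d → ℝ) {c : ℝ} (hc : 0 < c) :
    volume {b | testStatistic Ω σ a b = c} = 0 := by
  set S : Set (Fin K → Fin d → ℝ) := {b | testStatistic Ω σ a b ≤ c} with hS
  have hconv : Convex ℝ S := by
    intro x hx y hy p q hp hq hpq
    have hx : testStatistic Ω σ a x ≤ c := hx
    have hy : testStatistic Ω σ a y ≤ c := hy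
    have : testStatistic Ω σ a (p • x + q • y) ≤
        p * testStatistic Ω σ a x + q * testStatistic Ω σ a y := by
      simp only [testStatistic, Finset.mul_sum, ← Finset.sum_add_distrib]
      refine Finset.sum_le_sum fun k _ => Finset.sum_le_sum fun j _ => ?_
      have hw := hΩ k
      simp only [Pi.add_apply, Pi.smul_apply, smul_eq_mul]
      set m := (1 + Ω k) / Ω k * (a k j / σ k)
      set u := x k j / σ k - m with hu
      set v := y k j / σ k - m with hv
      have e : (p * x k j + q * y k j) / σ k - m = p * u + q * v := by
        rw [hu, hv]; linear_combination (m : ℝ) * hpq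
      have h1 : (p * u + q * v) ^ 2 ≤ p * u ^ 2 + q * v ^ 2 := by
        have : p * u ^ 2 + q * v ^ 2 - (p * u + q * v) ^ 2 = p * q * (u - v) ^ 2 := by
          have hq' : q = 1 - p := by linarith
          rw [hq']; ring
        have := mul_nonneg (mul_nonneg hp hq) (sq_nonneg (u - v))
        linarith
      rw [e]
      have := mul_le_mul_of_nonneg_left h1 (by positivity : 0 ≤ Ω k / (1 + Ω k))
      linarith
    have h2 : p * testStatistic Ω σ a x + q * testStatistic Ω σ a y ≤ c := by
      calc _ ≤ p * c + q * c := add_le_add (mul_le_mul_of_nonneg_left hx hp)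
            (mul_le_mul_of_nonneg_left hy hq)
        _ = c := by rw [← add_mul, hpq, one_mul]
    exact this.trans h2
  refine measure_mono_null (t := frontier S) (fun b hb => ?_) (hconv.addHaar_frontier volume)
  have hb : testStatistic Ω σ a b = c := hb
  refine ⟨subset_closure (show testStatistic Ω σ a b ≤ c from hb.le), fun hint => ?_⟩
  -- This is the centre of the ellipsoid: dilation about it by `r` multiplies the statistic by `r²`.
  -- As `c > 0`, a dilation with `r > 1` leaves the sublevel set, so `b` is not interior.
  set m : Fin K → Fin d → ℝ := fun k j => (1 + Ω k) / Ω k * a k j with hm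
  have hscale : ∀ r : ℝ, testStatistic Ω σ a (m + r • (b - m)) = r ^ 2 * c := by
    intro r
    rw [← hb, testStatistic, testStatistic, Finset.mul_sum]
    refine Finset.sum_congr rfl fun k _ => ?_
    rw [Finset.mul_sum]
    refine Finset.sum_congr rfl fun j _ => ?_
    have := (hσ k).ne'
    simp only [hm, Pi.add_apply, Pi.smul_apply, Pi.sub_apply, smul_eq_mul]
    ring
  have hcont : ContinuousAt (fun r : ℝ => m + r • (b - m)) 1 := by fun_prop
  have hmem : S ∈ 𝓝 (m + (1 : ℝ) • (b - m)) := by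
    rw [one_smul, add_sub_cancel]; exact mem_interior_iff_mem_nhds.1 hint
  have h1 : ∀ᶠ r : ℝ in 𝓝[>] 1, m + r • (b - m) ∈ S :=
    nhdsWithin_le_nhds (hcont.eventually_mem hmem)
  obtain ⟨r, hr, hr1⟩ := (h1.and self_mem_nhdsWithin).exists
  have hr1 : 1 < r := hr1
  have h2 : testStatistic Ω σ a (m + r • (b - m)) ≤ c := hr
  rw [hscale] at h2
  have h3 : 1 < r ^ 2 := one_lt_pow₀ hr1 two_ne_zero
  have h4 := mul_lt_mul_of_pos_right h3 hc
  linarith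

/-- The inversion formula for a density whose Laplace transform on a line is known. -/
theorem prob_eq_of_density {E : Type*} [MeasureSpace E] [SFinite (volume : Measure E)]
    {ρ T : E → ℝ} (hρ0 : ∀ b, 0 ≤ ρ b) (hρ : Measurable ρ) (hT : Measurable T) {φ : ℂ → ℂ}
    {n lam γ : ℝ} (hγ : γ ≠ 0) (hone : ∫ b, (ρ b : ℂ) * Complex.exp (-0 * T b) = 1)
    (hφ : ∀ ω : ℝ, ∫ b, (ρ b : ℂ) * Complex.exp (-(γ + ω * Complex.I) * T b) =
      Complex.exp (n / 2 * (φ (γ + ω * Complex.I) - 2 * lam * (γ + ω * Complex.I))))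
    (hatom : volume {b | T b = n * lam} = 0)
    (hint : Integrable fun ω : ℝ => Complex.exp (n / 2 * φ (γ + ω * Complex.I)) /
      (γ + ω * Complex.I)) :
    IsProbabilityMeasure (volume.withDensity fun b => ENNReal.ofReal (ρ b)) ∧
    ((volume.withDensity fun b => ENNReal.ofReal (ρ b)).real {b | T b ≤ n * lam} : ℂ) =
      unitStep (-γ) + 1 / (2 * Real.pi) *
        ∫ ω : ℝ, Complex.exp (n / 2 * φ (γ + ω * Complex.I)) / (γ + ω * Complex.I) := by
  set ν := (volume : Measure E).withDensity fun b => ENNReal.ofReal (ρ b) with hν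
  have hνint : ∀ g : E → ℂ, ∫ b, g b ∂ν = ∫ b, (ρ b : ℂ) * g b := by
    intro g
    rw [hν, integral_withDensity_eq_integral_toReal_smul hρ.ennreal_ofReal
      (Eventually.of_forall fun b => ENNReal.ofReal_lt_top)]
    congr 1
    funext b
    rw [ENNReal.toReal_ofReal (hρ0 b), Complex.real_smul]
  have hρone : ∫ b, (ρ b : ℂ) = 1 := by simpa using hone
  -- A function that is not integrable has integral `0`, so a nonzero value of the integral proves
  -- integrability; the same device gives `hexp` below.
  have hρint : Integrable ρ := by
    by_contra h
    have h1 : ¬ Integrable (fun b => (ρ b : ℂ)) := fun h2 => h (by simpa using h2.re)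
    rw [integral_undef h1] at hρone
    exact zero_ne_one hρone
  have hprob : IsProbabilityMeasure ν := by
    constructor
    rw [hν, withDensity_apply _ MeasurableSet.univ, Measure.restrict_univ,
      ← ofReal_integral_eq_lintegral_ofReal hρint (Eventually.of_forall hρ0)]
    have : ∫ b, ρ b = 1 := by
      have h1 : ((∫ b, ρ b : ℝ) : ℂ) = 1 := by rw [← hρone, integral_complex_ofReal]
      exact_mod_cast h1
    rw [this, ENNReal.ofReal_one]
  refine ⟨hprob, ?_⟩
  have hM : ∀ ω : ℝ, ∫ b, Complex.exp (-(γ + ω * Complex.I) * T b) ∂ν =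
      Complex.exp (n / 2 * (φ (γ + ω * Complex.I) - 2 * lam * (γ + ω * Complex.I))) := fun ω => by
    rw [hνint, hφ]
  have hexp : Integrable (fun b => Real.exp (-γ * T b)) ν := by
    by_contra h
    have h0 := hM 0
    have he : (fun b => Complex.exp (-(γ + (0 : ℝ) * Complex.I) * T b)) =
        fun b => ((Real.exp (-γ * T b) : ℝ) : ℂ) := by
      funext b; push_cast; simp
    rw [he, integral_undef fun h2 => h (by simpa [← Complex.ofReal_exp] using h2.re)] at h0
    exact Complex.exp_ne_zero _ h0.symm
  have hatomν : ν {b | T b = n * lam} = 0 := (withDensity_absolutelyContinuous _ _) hatom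
  have hshift : ∀ ω : ℝ, Complex.exp ((γ + ω * Complex.I) * (n * lam : ℝ)) *
      ((∫ b, Complex.exp (-(γ + ω * Complex.I) * T b) ∂ν) / (γ + ω * Complex.I)) =
      Complex.exp (n / 2 * φ (γ + ω * Complex.I)) / (γ + ω * Complex.I) := by
    intro ω
    rw [hM, mul_div_assoc', ← Complex.exp_add]
    congr 2
    push_cast
    ring
  have hφi : Integrable fun ω : ℝ => (∫ b, Complex.exp (-(γ + ω * Complex.I) * T b) ∂ν) /
      (γ + ω * Complex.I) := by
    have hm : Continuous fun ω : ℝ => Complex.exp (-((γ + ω * Complex.I) * (n * lam : ℝ))) := by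
      fun_prop
    have h1 : (fun ω : ℝ => (∫ b, Complex.exp (-(γ + ω * Complex.I) * T b) ∂ν) /
      (γ + ω * Complex.I)) = fun ω : ℝ => Complex.exp (-((γ + ω * Complex.I) * (n * lam : ℝ))) *
        (Complex.exp (n / 2 * φ (γ + ω * Complex.I)) / (γ + ω * Complex.I)) := by
      funext ω
      rw [← hshift, ← mul_assoc, ← Complex.exp_add]
      simp
    rw [h1]
    refine hint.bdd_mul (c := Real.exp (-(γ * (n * lam)))) hm.aestronglyMeasurable
      (Eventually.of_forall fun ω => ?_)
    rw [Complex.norm_exp]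
    simp
  rw [laplace_inversion ν hT hγ (n * lam) hexp hatomν hφi]
  simp_rw [hshift]

end ErrorProbabilities

/-! ### Watson's lemma on a symmetric interval -/

/-- The Gaussian moment `∫ u ^ (2 * k) * exp (- n * u ^ 2 / 2)`. -/
def gaussMoment (n : ℝ) (k : ℕ) : ℝ :=
  Real.sqrt (2 * Real.pi / n) * ((2 * k).factorial / (k.factorial * (2 * n) ^ k))

theorem integrable_pow_mul_gauss {n : ℝ} (hn : 0 < n) (m : ℕ) :
    Integrable fun u : ℝ => u ^ m * Real.exp (-(n / 2) * u ^ 2) := by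
  have h := integrable_rpow_mul_exp_neg_mul_sq (b := n / 2) (by positivity) (s := m)
    (by have : (0 : ℝ) ≤ m := Nat.cast_nonneg m
        linarith)
  simpa only [Real.rpow_natCast] using h

theorem integral_even_pow_mul_gauss {n : ℝ} (hn : 0 < n) (k : ℕ) :
    ∫ u : ℝ, u ^ (2 * k) * Real.exp (-(n / 2) * u ^ 2) = gaussMoment n k := by
  have h1 : ∫ u : ℝ, u ^ (2 * k) * Real.exp (-(n / 2) * u ^ 2) =
      ∫ u : ℝ, (fun x : ℝ => x ^ (2 * k) * Real.exp (-(n / 2) * x ^ 2)) |u| := by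
    congr 1
    funext u
    simp only [sq_abs]
    rw [(even_two_mul k).pow_abs]
  have h2 := integral_rpow_mul_exp_neg_mul_rpow (p := 2) (q := (2 * k : ℕ)) (b := n / 2) two_pos
    (by have : (0 : ℝ) ≤ (2 * k : ℕ) := Nat.cast_nonneg _
        linarith) (by positivity)
  have h3 : (((2 * k : ℕ) : ℝ) + 1) / 2 = k + 1 / 2 := by push_cast; ring
  simp only [Real.rpow_natCast, Real.rpow_two] at h2
  rw [h1, integral_comp_abs (f := fun x : ℝ => x ^ (2 * k) * Real.exp (-(n / 2) * x ^ 2)), h2, neg_div, h3,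
    Real.Gamma_nat_add_half, gaussMoment]
  have h4 : (n / 2) ^ (-((k : ℝ) + 1 / 2)) = ((n / 2) ^ k)⁻¹ * (Real.sqrt (n / 2))⁻¹ := by
    rw [Real.rpow_neg (by positivity), Real.rpow_add (by positivity), Real.rpow_natCast,
      ← Real.sqrt_eq_rpow, mul_inv]
  have h5 : Real.sqrt (2 * Real.pi / n) = Real.sqrt Real.pi * (Real.sqrt (n / 2))⁻¹ := by
    rw [← Real.sqrt_inv, ← Real.sqrt_mul Real.pi_pos.le]
    congr 1
    field_simp
  have h6 : ((2 * k).factorial : ℝ) = 2 ^ k * k.factorial * (2 * k - 1).doubleFactorial := by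
    rcases k with _ | k
    · simp
    · have := Nat.factorial_eq_mul_doubleFactorial (2 * k + 1)
      rw [show 2 * k + 1 + 1 = 2 * (k + 1) by ring, Nat.doubleFactorial_two_mul] at this
      rw [this, show 2 * (k + 1) - 1 = 2 * k + 1 by omega]
      push_cast
      ring
  have h7 : (k.factorial : ℝ) ≠ 0 := by positivity
  have h8 : Real.sqrt (n / 2) ≠ 0 := (Real.sqrt_pos.2 (by positivity)).ne'
  rw [h4, h5, h6, mul_pow, div_pow]
  field_simp

theorem integral_odd_pow_mul_gauss (n : ℝ) (k : ℕ) :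
    ∫ u : ℝ, u ^ (2 * k + 1) * Real.exp (-(n / 2) * u ^ 2) = 0 := by
  have h := integral_neg_eq_self (fun u : ℝ => u ^ (2 * k + 1) * Real.exp (-(n / 2) * u ^ 2)) volume
  have h2 : ∀ u : ℝ, (-u) ^ (2 * k + 1) * Real.exp (-(n / 2) * (-u) ^ 2) =
      -(u ^ (2 * k + 1) * Real.exp (-(n / 2) * u ^ 2)) := fun u => by
    rw [(odd_two_mul_add_one k).neg_pow, neg_sq, neg_mul]
  simp_rw [h2, integral_neg] at h
  linarith

theorem sum_range_two_mul (f : ℕ → ℂ) (N : ℕ) (hf : ∀ k, f (2 * k + 1) = 0) :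
    ∑ m ∈ Finset.range (2 * N), f m = ∑ k ∈ Finset.range N, f (2 * k) := by
  induction N with
  | zero => simp
  | succ N ih =>
    rw [show 2 * (N + 1) = 2 * N + 1 + 1 by ring, Finset.sum_range_succ, Finset.sum_range_succ, ih,
      Finset.sum_range_succ, hf, add_zero]

/-- The Taylor polynomial is integrated over the whole line, where odd moments vanish. The
difference of the integrands is then dominated everywhere by a constant times `u^(2N) e^{-n u²/2}`,
whose integral is the first omitted moment; the constant does not depend on `n`. -/
theorem watson {c : ℝ → ℂ} {coef : ℕ → ℂ} {ε M : ℝ} (hε : 0 < ε) (N : ℕ)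
    (hc : ContinuousOn c (Set.Icc (-ε) ε))
    (hM : ∀ u ∈ Set.Icc (-ε) ε,
      ‖c u - ∑ m ∈ Finset.range (2 * N), coef m * (u : ℂ) ^ m‖ ≤ M * u ^ (2 * N)) :
    ∃ C : ℝ, ∀ n : ℝ, 0 < n →
      ‖(∫ u in (-ε)..ε, (Real.exp (-(n / 2) * u ^ 2) : ℂ) * c u) -
        ∑ k ∈ Finset.range N, coef (2 * k) * gaussMoment n k‖ ≤ C * gaussMoment n N := by
  -- The first summand serves inside the interval. Outside, `|u| ≥ ε` gives `|u|^m ≤ ε^{-(2N-m)}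
  -- u^{2N}`, which is the second.
  set M' : ℝ := |M| + ∑ m ∈ Finset.range (2 * N), ‖coef m‖ * (ε ^ (2 * N - m))⁻¹ with hM'
  have hS0 : 0 ≤ ∑ m ∈ Finset.range (2 * N), ‖coef m‖ * (ε ^ (2 * N - m))⁻¹ :=
    Finset.sum_nonneg fun m _ => by positivity
  refine ⟨M', fun n hn => ?_⟩
  set e : ℝ → ℝ := fun u => Real.exp (-(n / 2) * u ^ 2) with he
  have he0 : ∀ u, 0 < e u := fun u => Real.exp_pos _
  set c' : ℝ → ℂ := (Set.Ioc (-ε) ε).indicator fun u => (e u : ℂ) * c u with hc'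
  have hc'int : Integrable c' := by
    rw [hc', integrable_indicator_iff measurableSet_Ioc]
    refine IntegrableOn.mono_set (ContinuousOn.integrableOn_Icc ?_) Set.Ioc_subset_Icc_self
    exact ContinuousOn.mul (by fun_prop) hc
  have h1 : (∫ u in (-ε)..ε, (Real.exp (-(n / 2) * u ^ 2) : ℂ) * c u) = ∫ u, c' u := by
    rw [intervalIntegral.integral_of_le (by linarith), hc', integral_indicator measurableSet_Ioc]
  have hpi : ∀ m, Integrable fun u : ℝ => coef m * ((u ^ m * e u : ℝ) : ℂ) := fun m =>
    ((integrable_pow_mul_gauss hn m).ofReal).const_mul _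
  have h2 : ∑ k ∈ Finset.range N, coef (2 * k) * gaussMoment n k =
      ∫ u : ℝ, ∑ m ∈ Finset.range (2 * N), coef m * ((u ^ m * e u : ℝ) : ℂ) := by
    rw [integral_finsetSum _ fun m _ => hpi m]
    simp_rw [integral_const_mul, integral_complex_ofReal]
    rw [sum_range_two_mul]
    · refine Finset.sum_congr rfl fun k _ => ?_
      rw [he, integral_even_pow_mul_gauss hn]
    · intro k
      rw [he, integral_odd_pow_mul_gauss]
      simp
  rw [h1, h2, ← integral_sub hc'int (integrable_finsetSum _ fun m _ => hpi m),
    ← integral_even_pow_mul_gauss hn, ← integral_const_mul]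
  refine norm_integral_le_of_norm_le ((integrable_pow_mul_gauss hn (2 * N)).const_mul M')
    (Eventually.of_forall fun u => ?_)
  have hsum : ∑ m ∈ Finset.range (2 * N), coef m * ((u ^ m * e u : ℝ) : ℂ) =
      (e u : ℂ) * ∑ m ∈ Finset.range (2 * N), coef m * (u : ℂ) ^ m := by
    rw [Finset.mul_sum]
    refine Finset.sum_congr rfl fun m _ => ?_
    push_cast
    ring
  have hpow : (0 : ℝ) ≤ u ^ (2 * N) := (even_two_mul N).pow_nonneg u
  have hnorm : ‖(e u : ℂ)‖ = e u := by rw [Complex.norm_real, Real.norm_of_nonneg (he0 u).le]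
  rw [hsum]
  by_cases hu : u ∈ Set.Ioc (-ε) ε
  · rw [hc', Set.indicator_of_mem hu, ← mul_sub, norm_mul, hnorm]
    have h3 := hM u (Set.Ioc_subset_Icc_self hu)
    have h4 : M * u ^ (2 * N) ≤ M' * u ^ (2 * N) :=
      mul_le_mul_of_nonneg_right ((le_abs_self M).trans (by rw [hM']; linarith)) hpow
    calc e u * ‖_‖ ≤ e u * (M' * u ^ (2 * N)) :=
          mul_le_mul_of_nonneg_left (h3.trans h4) (he0 u).le
      _ = M' * (u ^ (2 * N) * Real.exp (-(n / 2) * u ^ 2)) := by rw [he]; ring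
  · rw [hc', Set.indicator_of_notMem hu, zero_sub, norm_neg, norm_mul, hnorm]
    have hεu : ε ≤ |u| := by
      by_contra hcon
      have := abs_lt.1 (not_le.1 hcon)
      exact hu ⟨this.1, this.2.le⟩
    have h3 : ‖∑ m ∈ Finset.range (2 * N), coef m * (u : ℂ) ^ m‖ ≤ M' * u ^ (2 * N) := by
      refine (norm_sum_le _ _).trans ?_
      have h4 : ∑ m ∈ Finset.range (2 * N), ‖coef m * (u : ℂ) ^ m‖ ≤
          (∑ m ∈ Finset.range (2 * N), ‖coef m‖ * (ε ^ (2 * N - m))⁻¹) * u ^ (2 * N) := by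
        rw [Finset.sum_mul]
        refine Finset.sum_le_sum fun m hm => ?_
        rw [Finset.mem_range] at hm
        rw [norm_mul, norm_pow, Complex.norm_real, Real.norm_eq_abs, mul_assoc]
        refine mul_le_mul_of_nonneg_left ?_ (norm_nonneg _)
        rw [← (even_two_mul N).pow_abs, ← Nat.sub_add_cancel hm.le, pow_add, Nat.sub_add_cancel hm.le,
          ← mul_assoc]
        refine le_mul_of_one_le_left (by positivity) ?_
        rw [← div_eq_inv_mul, one_le_div (by positivity)]
        exact pow_le_pow_left₀ hε.le hεu _
      refine h4.trans (mul_le_mul_of_nonneg_right ?_ hpow)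
      rw [hM']; linarith [abs_nonneg M]
    calc e u * ‖_‖ ≤ e u * (M' * u ^ (2 * N)) := mul_le_mul_of_nonneg_left h3 (he0 u).le
      _ = M' * (u ^ (2 * N) * Real.exp (-(n / 2) * u ^ 2)) := by rw [he]; ring

theorem exists_pow_le {θ : ℝ} (h0 : 0 ≤ θ) (h1 : θ < 1) (N : ℕ) :
    ∀ᶠ n : ℕ in atTop, θ ^ n ≤ 1 / (Real.sqrt n * (n : ℝ) ^ N) := by
  have h := tendsto_pow_const_mul_const_pow_of_abs_lt_one (N + 1) (by rwa [abs_of_nonneg h0] : |θ| < 1)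
  filter_upwards [h.eventually (gt_mem_nhds one_pos), eventually_ge_atTop 1] with n hn hn1
  have hn1' : (1 : ℝ) ≤ n := by exact_mod_cast hn1
  have hn0 : (0 : ℝ) < n := by linarith
  rw [le_div_iff₀ (by positivity)]
  have h2 : Real.sqrt n ≤ n := by
    rw [Real.sqrt_le_left hn0.le]; nlinarith
  calc θ ^ n * (Real.sqrt n * (n : ℝ) ^ N) ≤ θ ^ n * (n * (n : ℝ) ^ N) := by gcongr
    _ = (n : ℝ) ^ (N + 1) * θ ^ n := by ring
    _ ≤ 1 := hn.le

theorem gaussMoment_eq {n : ℝ} (hn : 0 < n) (N : ℕ) : gaussMoment n N =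
    Real.sqrt (2 * Real.pi) * ((2 * N).factorial / (N.factorial * 2 ^ N)) /
      (Real.sqrt n * n ^ N) := by
  rw [gaussMoment, Real.sqrt_div (by have := Real.pi_pos; positivity), mul_pow]
  have h1 : Real.sqrt n ≠ 0 := (Real.sqrt_pos.2 hn).ne'
  field_simp

/-! ### The integral over a vertical line -/

theorem integrable_inv_one_add_mul_sq {κ : ℝ} (hκ : 0 < κ) :
    Integrable fun ω : ℝ => (1 + κ * ω ^ 2)⁻¹ := by
  have h := integrable_inv_one_add_sq.comp_mul_left' (R := Real.sqrt κ) (Real.sqrt_pos.2 hκ).ne'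
  refine h.congr (Eventually.of_forall fun ω => ?_)
  simp only
  rw [mul_pow, Real.sq_sqrt hκ.le]

section Line

variable {φ : ℂ → ℂ} {s₀ κ : ℝ}

/-- The decay gives `(1 + κ ω²)^{-n/4}`. Four of the `n` factors are set aside to form an integrable
function; the others give a bound geometric in `n` away from the saddle. -/
theorem norm_exp_line_le (hκ : 0 < κ)
    (hdecay : ∀ ω : ℝ, (φ (s₀ + ω * Complex.I)).re ≤
      (φ s₀).re - 1 / 2 * Real.log (1 + κ * ω ^ 2)) (hs : s₀ ≠ 0) (n : ℕ) (hn : 4 ≤ n) (ω : ℝ) :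
    ‖Complex.exp ((n : ℂ) / 2 * φ (s₀ + ω * Complex.I)) / (s₀ + ω * Complex.I)‖ ≤
      Real.exp ((n : ℝ) / 2 * (φ s₀).re) * |s₀|⁻¹ *
        (((1 + κ * ω ^ 2) ^ (-(1 / 4) : ℝ)) ^ (n - 4) * (1 + κ * ω ^ 2)⁻¹) := by
  have hpos : 0 < 1 + κ * ω ^ 2 := by positivity
  have hden : |s₀| ≤ ‖(s₀ + ω * Complex.I : ℂ)‖ := by
    simpa using Complex.abs_re_le_norm (s₀ + ω * Complex.I)
  have hs0 : 0 < |s₀| := abs_pos.2 hs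
  have hre : ((n : ℂ) / 2 * φ (s₀ + ω * Complex.I)).re =
      (n : ℝ) / 2 * (φ (s₀ + ω * Complex.I)).re := by
    have : ((n : ℂ) / 2) = ((n / 2 : ℝ) : ℂ) := by push_cast; rfl
    rw [this, Complex.re_ofReal_mul]
  have hpow : ((1 + κ * ω ^ 2) ^ (-(1 / 4) : ℝ)) ^ (n - 4) * (1 + κ * ω ^ 2)⁻¹ =
      Real.exp (-((n : ℝ) / 4) * Real.log (1 + κ * ω ^ 2)) := by
    rw [← Real.rpow_natCast, ← Real.rpow_mul hpos.le, ← Real.rpow_neg_one, ← Real.rpow_add hpos,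
      Real.rpow_def_of_pos hpos, Nat.cast_sub hn]
    congr 1
    push_cast
    ring
  rw [hpow, norm_div, Complex.norm_exp, hre, mul_right_comm, ← Real.exp_add, ← div_eq_mul_inv]
  gcongr
  have := mul_le_mul_of_nonneg_left (hdecay ω) (by positivity : 0 ≤ (n : ℝ) / 2)
  linarith

theorem integrable_line (hκ : 0 < κ) (hcont : Continuous fun ω : ℝ => φ (s₀ + ω * Complex.I))
    (hdecay : ∀ ω : ℝ, (φ (s₀ + ω * Complex.I)).re ≤
      (φ s₀).re - 1 / 2 * Real.log (1 + κ * ω ^ 2)) (hs : s₀ ≠ 0) (n : ℕ) (hn : 4 ≤ n) :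
    Integrable fun ω : ℝ => Complex.exp ((n : ℂ) / 2 * φ (s₀ + ω * Complex.I)) /
      (s₀ + ω * Complex.I) := by
  have hz : ∀ ω : ℝ, (s₀ + ω * Complex.I : ℂ) ≠ 0 := fun ω h =>
    hs (by simpa using congrArg Complex.re h)
  have hm : Continuous fun ω : ℝ => Complex.exp ((n : ℂ) / 2 * φ (s₀ + ω * Complex.I)) /
      (s₀ + ω * Complex.I) :=
    Continuous.div (Complex.continuous_exp.comp (continuous_const.mul hcont)) (by fun_prop) hz
  refine ((integrable_inv_one_add_mul_sq hκ).const_mul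
    (Real.exp ((n : ℝ) / 2 * (φ s₀).re) * |s₀|⁻¹)).mono' hm.aestronglyMeasurable
    (Eventually.of_forall fun ω => (norm_exp_line_le hκ hdecay hs n hn ω).trans ?_)
  have h1 : (1 + κ * ω ^ 2) ^ (-(1 / 4) : ℝ) ≤ 1 :=
    Real.rpow_le_one_of_one_le_of_nonpos (by have : 0 ≤ κ * ω ^ 2 := by positivity
                                             linarith) (by norm_num)
  have h2 : ((1 + κ * ω ^ 2) ^ (-(1 / 4) : ℝ)) ^ (n - 4) ≤ 1 :=
    pow_le_one₀ (Real.rpow_nonneg (by positivity) _) h1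
  have h3 : (0 : ℝ) ≤ (1 + κ * ω ^ 2)⁻¹ := by positivity
  exact mul_le_mul_of_nonneg_left (mul_le_of_le_one_left h3 h2) (by positivity)

/-- Outside of a neighbourhood of the saddle point the integral is exponentially smaller. -/
theorem exists_tail_bound (hκ : 0 < κ) (hcont : Continuous fun ω : ℝ => φ (s₀ + ω * Complex.I))
    (hdecay : ∀ ω : ℝ, (φ (s₀ + ω * Complex.I)).re ≤
      (φ s₀).re - 1 / 2 * Real.log (1 + κ * ω ^ 2)) (hs : s₀ ≠ 0) {δ : ℝ} (hδ : 0 < δ) :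
    ∃ C θ : ℝ, 0 ≤ C ∧ 0 ≤ θ ∧ θ < 1 ∧ ∀ n : ℕ, 4 ≤ n →
      ‖(∫ ω : ℝ, Complex.exp ((n : ℂ) / 2 * φ (s₀ + ω * Complex.I)) / (s₀ + ω * Complex.I)) -
        ∫ ω in (-δ)..δ, Complex.exp ((n : ℂ) / 2 * φ (s₀ + ω * Complex.I)) /
          (s₀ + ω * Complex.I)‖ ≤ C * (Real.exp ((n : ℝ) / 2 * (φ s₀).re) * θ ^ n) := by
  set θ : ℝ := (1 + κ * δ ^ 2) ^ (-(1 / 4) : ℝ) with hθ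
  have hκδ : 0 < κ * δ ^ 2 := by positivity
  have hθ0 : 0 < θ := Real.rpow_pos_of_pos (by positivity) _
  have hθ1 : θ < 1 := Real.rpow_lt_one_of_one_lt_of_neg (by linarith) (by norm_num)
  have hInn : 0 ≤ ∫ ω : ℝ, (1 + κ * ω ^ 2)⁻¹ := integral_nonneg fun ω => by positivity
  refine ⟨|s₀|⁻¹ * (θ ^ 4)⁻¹ * ∫ ω : ℝ, (1 + κ * ω ^ 2)⁻¹, θ, by positivity, hθ0.le, hθ1,
    fun n hn => ?_⟩
  have hint := integrable_line hκ hcont hdecay hs n hn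
  set F : ℝ → ℂ := fun ω => Complex.exp ((n : ℂ) / 2 * φ (s₀ + ω * Complex.I)) /
    (s₀ + ω * Complex.I) with hF
  have hsplit : (∫ ω, F ω) - ∫ ω in (-δ)..δ, F ω = ∫ ω in (Set.Ioc (-δ) δ)ᶜ, F ω := by
    rw [intervalIntegral.integral_of_le (by linarith),
      ← integral_add_compl (measurableSet_Ioc (a := -δ) (b := δ)) hint, add_sub_cancel_left]
  rw [hsplit]
  have hbound : ∀ ω ∈ (Set.Ioc (-δ) δ)ᶜ, ‖F ω‖ ≤ Real.exp ((n : ℝ) / 2 * (φ s₀).re) * |s₀|⁻¹ *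
      θ ^ (n - 4) * (1 + κ * ω ^ 2)⁻¹ := by
    intro ω hω
    refine (norm_exp_line_le hκ hdecay hs n hn ω).trans ?_
    rw [mul_assoc _ (θ ^ (n - 4))]
    have hδω : δ ^ 2 ≤ ω ^ 2 := by
      by_contra hcon
      have := abs_lt_of_sq_lt_sq (not_le.1 hcon) hδ.le
      exact hω ⟨(abs_lt.1 this).1, (abs_lt.1 this).2.le⟩
    have h1 : (1 + κ * ω ^ 2) ^ (-(1 / 4) : ℝ) ≤ θ :=
      Real.rpow_le_rpow_of_nonpos (by positivity) (by gcongr) (by norm_num)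
    have h2 : 0 ≤ (1 + κ * ω ^ 2) ^ (-(1 / 4) : ℝ) := Real.rpow_nonneg (by positivity) _
    gcongr
  have hInt := (integrable_inv_one_add_mul_sq hκ).const_mul
    (Real.exp ((n : ℝ) / 2 * (φ s₀).re) * |s₀|⁻¹ * θ ^ (n - 4))
  calc ‖∫ ω in (Set.Ioc (-δ) δ)ᶜ, F ω‖ ≤ ∫ ω in (Set.Ioc (-δ) δ)ᶜ,
        Real.exp ((n : ℝ) / 2 * (φ s₀).re) * |s₀|⁻¹ * θ ^ (n - 4) * (1 + κ * ω ^ 2)⁻¹ :=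
        norm_integral_le_of_norm_le hInt.integrableOn
          ((ae_restrict_iff' measurableSet_Ioc.compl).2 (Eventually.of_forall hbound))
    _ ≤ ∫ ω : ℝ, Real.exp ((n : ℝ) / 2 * (φ s₀).re) * |s₀|⁻¹ * θ ^ (n - 4) * (1 + κ * ω ^ 2)⁻¹ :=
        setIntegral_le_integral hInt (Eventually.of_forall fun ω => by positivity)
    _ = _ := by
        rw [integral_const_mul]
        have : θ ^ (n - 4) = θ ^ n * (θ ^ 4)⁻¹ := by
          rw [eq_mul_inv_iff_mul_eq₀ (by positivity), ← pow_add, Nat.sub_add_cancel hn]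
        rw [this]
        ring

end Line

/-! ### Local analysis at the saddle point -/

/-- On the disc `F` has a primitive, so only the endpoints of the curves count. Corresponding
endpoints lie in a common convex set where `F` is small, and the mean value inequality bounds the
difference of the primitive there. -/
theorem norm_contour_sub_le {F : ℂ → ℂ} {s₀ : ℂ} {ρ : ℝ}
    (hF : DifferentiableOn ℂ F (Metric.ball s₀ ρ)) {γ₁ γ₂ γ₁' γ₂' : ℝ → ℂ} {a b c d B : ℝ}
    (h1 : ∀ u ∈ Set.uIcc a b, HasDerivAt γ₁ (γ₁' u) u ∧ γ₁ u ∈ Metric.ball s₀ ρ)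
    (h2 : ∀ u ∈ Set.uIcc c d, HasDerivAt γ₂ (γ₂' u) u ∧ γ₂ u ∈ Metric.ball s₀ ρ)
    (hc1 : ContinuousOn γ₁' (Set.uIcc a b)) (hc2 : ContinuousOn γ₂' (Set.uIcc c d))
    {S T : Set ℂ} (hS : Convex ℝ S) (hT : Convex ℝ T) (hSb : S ⊆ Metric.ball s₀ ρ)
    (hTb : T ⊆ Metric.ball s₀ ρ) (hSF : ∀ z ∈ S, ‖F z‖ ≤ B) (hTF : ∀ z ∈ T, ‖F z‖ ≤ B)
    (hb : γ₁ b ∈ S) (hd : γ₂ d ∈ S) (ha : γ₁ a ∈ T) (hc : γ₂ c ∈ T) :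
    ‖(∫ u in a..b, γ₁' u • F (γ₁ u)) - ∫ u in c..d, γ₂' u • F (γ₂ u)‖ ≤
      2 * (B * (2 * ρ)) := by
  obtain ⟨G, hG⟩ := hF.isExactOn_ball
  have key : ∀ {γ γ' : ℝ → ℂ} {a b : ℝ},
      (∀ u ∈ Set.uIcc a b, HasDerivAt γ (γ' u) u ∧ γ u ∈ Metric.ball s₀ ρ) →
      ContinuousOn γ' (Set.uIcc a b) →
      ∫ u in a..b, γ' u • F (γ u) = G (γ b) - G (γ a) := by
    intro γ γ' a b h hc
    refine intervalIntegral.integral_eq_sub_of_hasDerivAt (f := G ∘ γ)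
      (fun u hu => (hG _ (h u hu).2).scomp u (h u hu).1) (ContinuousOn.intervalIntegrable ?_)
    exact hc.smul (hF.continuousOn.comp (fun u hu => (h u hu).1.continuousAt.continuousWithinAt)
      fun u hu => (h u hu).2)
  have hseg : ∀ {S : Set ℂ}, Convex ℝ S → S ⊆ Metric.ball s₀ ρ → (∀ z ∈ S, ‖F z‖ ≤ B) →
      ∀ z ∈ S, ∀ w ∈ S, ‖G w - G z‖ ≤ B * (2 * ρ) := by
    intro S hS hSb hSF z hz w hw
    refine (hS.norm_image_sub_le_of_norm_hasDerivWithin_le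
      (fun x hx => (hG x (hSb hx)).hasDerivWithinAt) hSF hz hw).trans ?_
    have hB : 0 ≤ B := (norm_nonneg _).trans (hSF z hz)
    refine mul_le_mul_of_nonneg_left ?_ hB
    have := dist_triangle_right w z s₀
    have h1 := Metric.mem_ball.1 (hSb hz)
    have h2 := Metric.mem_ball.1 (hSb hw)
    rw [← dist_eq_norm]
    linarith
  rw [key h1 hc1, key h2 hc2]
  calc ‖G (γ₁ b) - G (γ₁ a) - (G (γ₂ d) - G (γ₂ c))‖
      = ‖(G (γ₁ b) - G (γ₂ d)) - (G (γ₁ a) - G (γ₂ c))‖ := by congr 1; ring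
    _ ≤ _ := (norm_sub_le _ _).trans (by
        have := hseg hS hSb hSF _ hd _ hb
        have := hseg hT hTb hTF _ hc _ ha
        linarith)

/-- For `t = s - s₀` in this double cone `Re t² ≤ -¾ (Im t)²`, while the cubic remainder is at most
`(a 2 / 5) |t|² ≤ (a 2 / 4) (Im t)²`. What remains is `-(a 2 / 2) (Im t)²`. -/
theorem eventually_re_le_of_cone {φ : ℂ → ℂ} {s₀ : ℝ} {a : ℕ → ℝ} (h1 : a 1 = 0) (h2 : 0 < a 2)
    (hφ : HasSeries φ s₀ (PowerSeries.mk fun m => (a m : ℂ))) :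
    ∀ᶠ s : ℂ in 𝓝 (s₀ : ℂ), |s.re - s₀| ≤ |s.im| / 2 →
      (φ s).re ≤ (φ s₀).re - a 2 / 2 * s.im ^ 2 := by
  obtain ⟨R, hR, he⟩ := hφ.exists_remainder 3
  have h0 : (a 0 : ℂ) = φ s₀ := by simpa using hφ.coeff_zero
  have hlim : Tendsto (fun s : ℂ => ‖(s - s₀) * R s‖) (𝓝 (s₀ : ℂ)) (𝓝 0) := by
    have : ContinuousAt (fun s : ℂ => ‖(s - s₀) * R s‖) (s₀ : ℂ) :=
      ((continuousAt_id.sub continuousAt_const).mul hR.continuousAt).norm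
    simpa [ContinuousAt] using this
  filter_upwards [he, hlim.eventually (gt_mem_nhds (by positivity : 0 < a 2 / 5))] with s hs hb hc
  set t : ℂ := s - s₀ with ht
  have hre : t.re = s.re - s₀ := by simp [ht]
  have him : t.im = s.im := by simp [ht]
  rw [← hre] at hc
  have hexp : φ s = φ s₀ + a 2 * t ^ 2 + t ^ 2 * (t * R s) := by
    rw [hs]
    simp [Finset.sum_range_succ, h1, h0]
    ring
  have hsq : t.re ^ 2 ≤ t.im ^ 2 / 4 := by
    rw [him]
    have := pow_le_pow_left₀ (abs_nonneg _) hc 2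
    rw [sq_abs, div_pow, sq_abs] at this
    linarith
  have hn : ‖t‖ ^ 2 = t.re ^ 2 + t.im ^ 2 := by
    rw [Complex.sq_norm, Complex.normSq_apply]; ring
  have hr : (t ^ 2 * (t * R s)).re ≤ ‖t‖ ^ 2 * (a 2 / 5) := by
    refine (Complex.re_le_norm _).trans ?_
    rw [norm_mul, norm_pow]
    exact mul_le_mul_of_nonneg_left hb.le (by positivity)
  have hq : ((a 2 : ℂ) * t ^ 2).re = a 2 * (t.re ^ 2 - t.im ^ 2) := by
    rw [Complex.re_ofReal_mul, sq, Complex.mul_re]; ring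
  rw [hexp, Complex.add_re, Complex.add_re, hq, ← him]
  rw [hn] at hr
  nlinarith

/-- The tangent is vertical. A relative error of one quarter leaves `|Im q| ≥ ¾ r |u|`, which puts
the curve inside the cone of `eventually_re_le_of_cone`. -/
theorem eventually_direction {q : ℂ → ℂ} {s₀ r : ℝ} (hr : 0 < r) (h0 : q 0 = s₀)
    (hq : HasDerivAt q (r * Complex.I) 0) :
    ∀ᶠ u : ℝ in 𝓝 0, |(q u).re - s₀| ≤ r / 4 * |u| ∧ |(q u).im - r * u| ≤ r / 4 * |u| := by
  have h := (hasDerivAt_iff_isLittleO.1 hq).def (by positivity : 0 < r / 4)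
  have hc : Tendsto (fun u : ℝ => (u : ℂ)) (𝓝 0) (𝓝 0) := by
    simpa using Complex.continuous_ofReal.tendsto 0
  filter_upwards [hc.eventually h] with u hu
  simp only [sub_zero, h0, smul_eq_mul, Complex.norm_real, Real.norm_eq_abs] at hu
  have h1 := (Complex.abs_re_le_norm _).trans hu
  have h2 := (Complex.abs_im_le_norm _).trans hu
  simp at h1 h2
  exact ⟨h1, by rwa [mul_comm u r] at h2⟩

/-- The endpoints, the disc and the constants of the local contour deformation. -/
theorem exists_local_bound {φ : ℂ → ℂ} {s₀ : ℝ} {a : ℕ → ℝ} (h1 : a 1 = 0) (h2 : 0 < a 2)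
    (hφ : HasSeries φ s₀ (PowerSeries.mk fun m => (a m : ℂ))) {q : ℂ → ℂ}
    (hq : HasSeries q 0 (PowerSeries.mk (pCoeff s₀ (fCoeff a)))) (hs : s₀ ≠ 0)
    {Q : ℝ → Prop} (hQ : ∀ᶠ u : ℝ in 𝓝 0, Q u) :
    ∃ δ ε κ C : ℝ, 0 < δ ∧ 0 < ε ∧ 0 < κ ∧ 0 ≤ C ∧
      (∀ u ∈ Set.Icc (-ε) ε, Q u ∧ AnalyticAt ℂ q u ∧ q u ≠ 0) ∧
      ∀ n : ℕ, ‖(∫ ω in (-δ)..δ, Complex.I * (Complex.exp ((n : ℂ) / 2 * φ (s₀ + ω * Complex.I)) /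
          (s₀ + ω * Complex.I))) -
        ∫ u in (-ε)..ε, deriv q u * (Complex.exp ((n : ℂ) / 2 * φ (q u)) / q u)‖ ≤
        C * Real.exp ((n : ℝ) / 2 * ((φ s₀).re - κ)) := by
  set r : ℝ := (Real.sqrt (a 2))⁻¹ with hr
  have hr0 : 0 < r := inv_pos.2 (Real.sqrt_pos.2 h2)
  have hq0 : q 0 = s₀ := by
    rw [← hq.coeff_zero, PowerSeries.coeff_mk, pCoeff]
  have hq1 : HasDerivAt q (r * Complex.I) 0 := by
    have h := hq.analyticAt.differentiableAt.hasDerivAt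
    have h3 : (Real.sqrt (a 2) : ℂ) ≠ 0 := by
      exact_mod_cast (Real.sqrt_pos.2 h2).ne'
    rw [← hq.coeff_one, PowerSeries.coeff_mk, pCoeff, fCoeff_one] at h
    have e : 1 / (-Complex.I * (Real.sqrt (a 2) : ℂ)) = r * Complex.I := by
      rw [hr]
      push_cast
      field_simp
      simp
    rwa [e] at h
  have hs0 : 0 < |s₀| := abs_pos.2 hs
  have hnear : ∀ᶠ s : ℂ in 𝓝 (s₀ : ℂ), |s₀| / 2 < ‖s‖ :=
    continuous_norm.continuousAt.eventually (lt_mem_nhds (by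
      beta_reduce
      rw [Complex.norm_real, Real.norm_eq_abs]; linarith))
  obtain ⟨ρ, hρ, hball⟩ := Metric.eventually_nhds_iff_ball.1
    ((hφ.analyticAt.eventually_analyticAt.and hnear).and (eventually_re_le_of_cone h1 h2 hφ))
  have hcr : Tendsto (fun u : ℝ => (u : ℂ)) (𝓝 0) (𝓝 0) := by
    simpa using Complex.continuous_ofReal.tendsto 0
  have hqball : ∀ᶠ u : ℂ in 𝓝 0, q u ∈ Metric.ball (s₀ : ℂ) ρ := by
    have := hq.analyticAt.continuousAt
    rw [ContinuousAt, hq0] at this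
    exact this.eventually (Metric.ball_mem_nhds _ hρ)
  obtain ⟨ε', hε', hreal⟩ := Metric.eventually_nhds_iff_ball.1
    ((hQ.and (hcr.eventually (hq.analyticAt.eventually_analyticAt.and hqball))).and
      (eventually_direction hr0 hq0 hq1))
  set ε := ε' / 2 with hε
  have hε0 : 0 < ε := by positivity
  have hIcc : ∀ u ∈ Set.Icc (-ε) ε, u ∈ Metric.ball (0 : ℝ) ε' := fun u hu => by
    rw [mem_ball_zero_iff, Real.norm_eq_abs]
    exact (abs_le.2 hu).trans_lt (by linarith)
  set δ := ρ / 2 with hδ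
  have hδ0 : 0 < δ := by positivity
  -- A height reached by all four endpoints; the real part of `φ` has dropped there by at least `κ`.
  set m := min δ (r * ε / 2) with hm
  have hm0 : 0 < m := lt_min hδ0 (by positivity)
  set κ := a 2 / 2 * m ^ 2 with hκ
  have hκ0 : 0 < κ := by positivity
  refine ⟨δ, ε, κ, 2 * (2 / |s₀| * (2 * ρ)), hδ0, hε0, hκ0, by positivity, fun u hu => ?_,
    fun n => ?_⟩
  · obtain ⟨⟨hQu, hau, hbu⟩, -⟩ := hreal u (hIcc u hu)
    refine ⟨hQu, hau, norm_pos_iff.1 (lt_trans (by positivity) (hball _ hbu).1.2)⟩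
  set F : ℂ → ℂ := fun s => Complex.exp ((n : ℂ) / 2 * φ s) / s with hF
  have hFd : DifferentiableOn ℂ F (Metric.ball (s₀ : ℂ) ρ) := fun s hs => by
    have h := hball s hs
    exact ((h.1.1.differentiableAt.const_mul _).cexp.div differentiableAt_id
      (norm_pos_iff.1 (lt_trans (by positivity) h.1.2))).differentiableWithinAt
  set B := Real.exp ((n : ℝ) / 2 * ((φ s₀).re - κ)) * (2 / |s₀|) with hB
  have hbound : ∀ s ∈ Metric.ball (s₀ : ℂ) ρ, |s.re - s₀| ≤ |s.im| / 2 → m ≤ |s.im| →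
      ‖F s‖ ≤ B := by
    intro s hsb hcone hms
    obtain ⟨⟨-, hn⟩, hc⟩ := hball s hsb
    have hre := hc hcone
    have hm2 : m ^ 2 ≤ s.im ^ 2 := by
      rw [← sq_abs s.im]; exact pow_le_pow_left₀ hm0.le hms 2
    have hcast : ((n : ℂ) / 2 * φ s).re = (n : ℝ) / 2 * (φ s).re := by
      rw [← Complex.re_ofReal_mul]; push_cast; rfl
    rw [hF, norm_div, Complex.norm_exp, hcast, div_eq_mul_inv, hB]
    have h3 : (φ s).re ≤ (φ s₀).re - κ := by
      rw [hκ]; nlinarith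
    have h4 : ‖s‖⁻¹ ≤ 2 / |s₀| := by
      rw [← inv_div]
      exact inv_anti₀ (by positivity) hn.le
    gcongr
  -- The sign `ς` selects the upper or the lower half of the truncated double cone; each half is
  -- convex and contains the two endpoints on its side.
  have hcone : ∀ ς : ℝ, Convex ℝ {s : ℂ | s ∈ Metric.ball (s₀ : ℂ) ρ ∧ |s.re - s₀| ≤ ς * s.im / 2 ∧
      m ≤ ς * s.im} := by
    intro ς
    rintro x ⟨hxb, hx1, hx2⟩ y ⟨hyb, hy1, hy2⟩ α β hα hβ hαβ
    refine ⟨convex_ball _ _ hxb hyb hα hβ hαβ, ?_, ?_⟩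
    · rw [abs_le] at hx1 hy1 ⊢
      have e1 : (α • x + β • y).re - s₀ = α * (x.re - s₀) + β * (y.re - s₀) := by
        simp
        linear_combination s₀ * hαβ
      have e2 : ς * (α • x + β • y).im / 2 = α * (ς * x.im / 2) + β * (ς * y.im / 2) := by
        simp; ring
      rw [e1, e2]
      constructor <;> nlinarith
    · have e2 : ς * (α • x + β • y).im = α * (ς * x.im) + β * (ς * y.im) := by
        simp; ring
      rw [e2]
      have : m = α * m + β * m := by rw [← add_mul, hαβ, one_mul]
      nlinarith
  have hline : ∀ ω ∈ Set.Icc (-δ) δ, (s₀ + ω * Complex.I : ℂ) ∈ Metric.ball (s₀ : ℂ) ρ := by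
    intro ω hω
    rw [mem_ball_iff_norm, add_sub_cancel_left, norm_mul, Complex.norm_I, mul_one,
      Complex.norm_real, Real.norm_eq_abs]
    exact (abs_le.2 hω).trans_lt (by linarith)
  have hu1 : Set.uIcc (-δ) δ = Set.Icc (-δ) δ := Set.uIcc_of_le (by linarith)
  have hu2 : Set.uIcc (-ε) ε = Set.Icc (-ε) ε := Set.uIcc_of_le (by linarith)
  have habs : ∀ (ς : ℝ) (hς : |ς| = 1) (s : ℂ), m ≤ ς * s.im → ς * s.im = |s.im| := by
    intro ς hς s h
    rw [← abs_of_nonneg (hm0.le.trans h), abs_mul, hς, one_mul]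
  have hFB : ∀ ς : ℝ, |ς| = 1 → ∀ s ∈ {s : ℂ | s ∈ Metric.ball (s₀ : ℂ) ρ ∧
      |s.re - s₀| ≤ ς * s.im / 2 ∧ m ≤ ς * s.im}, ‖F s‖ ≤ B := by
    rintro ς hς s ⟨hsb, hc, hms⟩
    rw [habs ς hς s hms] at hc hms
    exact hbound s hsb hc hms
  have hδl : -δ ∈ Set.Icc (-δ) δ := ⟨le_rfl, by linarith⟩
  have hδr : δ ∈ Set.Icc (-δ) δ := ⟨by linarith, le_rfl⟩
  have hεl : -ε ∈ Set.Icc (-ε) ε := ⟨le_rfl, by linarith⟩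
  have hεr : ε ∈ Set.Icc (-ε) ε := ⟨by linarith, le_rfl⟩
  have hmδ : m ≤ δ := min_le_left _ _
  have hmε : m ≤ r * ε / 2 := min_le_right _ _
  have h := norm_contour_sub_le (γ₁ := fun ω : ℝ => s₀ + ω * Complex.I) (γ₁' := fun _ => Complex.I)
    (γ₂ := fun u : ℝ => q u) (γ₂' := fun u : ℝ => deriv q u) (a := -δ) (b := δ) (c := -ε) (d := ε)
    hFd ?_ ?_ continuousOn_const ?_ (hcone 1) (hcone (-1)) (fun s hs => hs.1) (fun s hs => hs.1)
    (hFB 1 (by simp)) (hFB (-1) (by simp)) ?_ ?_ ?_ ?_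
  · refine h.trans (le_of_eq ?_)
    rw [hB]; ring
  · intro ω hω
    rw [hu1] at hω
    refine ⟨?_, hline ω hω⟩
    simpa using ((Complex.ofRealCLM.hasDerivAt (x := ω)).mul_const Complex.I).const_add (s₀ : ℂ)
  · intro u hu
    rw [hu2] at hu
    obtain ⟨⟨-, hau, hbu⟩, -⟩ := hreal u (hIcc u hu)
    exact ⟨hau.differentiableAt.hasDerivAt.comp_ofReal, hbu⟩
  · intro u hu
    rw [hu2] at hu
    obtain ⟨⟨-, hau, -⟩, -⟩ := hreal u (hIcc u hu)
    exact (hau.deriv.continuousAt.comp Complex.continuous_ofReal.continuousAt).continuousWithinAt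
  · exact ⟨hline δ hδr, by simp; linarith, by simpa using hmδ⟩
  · obtain ⟨⟨-, -, hbu⟩, hd1, hd2⟩ := hreal ε (hIcc ε hεr)
    rw [abs_of_pos hε0] at hd1 hd2
    have := (abs_le.1 hd2).1
    have := mul_pos hr0 hε0
    exact ⟨hbu, by linarith, by linarith⟩
  · exact ⟨hline (-δ) hδl, by simp; linarith, by simpa using hmδ⟩
  · obtain ⟨⟨-, -, hbu⟩, hd1, hd2⟩ := hreal (-ε) (hIcc (-ε) hεl)
    rw [abs_neg, abs_of_pos hε0] at hd1 hd2
    have := (abs_le.1 hd2).2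
    have := mul_pos hr0 hε0
    exact ⟨hbu, by linarith, by linarith⟩

/-- The normalizations match because `√(2π / n) = 2π / √(2π n)`; the factor `1 / (2π)` is that of
the inversion formula. -/
theorem expansionSum_eq {n : ℕ} (hn : 0 < n) (φ₀ : ℂ) (c : ℕ → ℂ) (N : ℕ) :
    expansionSum n φ₀ c Complex.I N = 1 / (2 * Real.pi) * (Complex.exp ((n : ℂ) / 2 * φ₀) *
      (∑ k ∈ Finset.range N, c (2 * k) * gaussMoment n k) / Complex.I) := by
  have hn0 : (0 : ℝ) < n := by exact_mod_cast hn
  have h2 : Real.sqrt (2 * Real.pi / n) = 2 * Real.pi / Real.sqrt (2 * Real.pi * n) := by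
    have h3 : (0 : ℝ) < 2 * Real.pi * n := by have := Real.pi_pos; positivity
    rw [eq_div_iff (Real.sqrt_pos.2 h3).ne', ← Real.sqrt_mul (by have := Real.pi_pos; positivity)]
    rw [show 2 * Real.pi / n * (2 * Real.pi * n) = (2 * Real.pi) ^ 2 by field_simp]
    exact Real.sqrt_sq (by have := Real.pi_pos; positivity)
  have hpi : (Real.pi : ℂ) ≠ 0 := by exact_mod_cast Real.pi_ne_zero
  rw [expansionSum, Finset.mul_sum, Finset.mul_sum, Finset.sum_div, Finset.mul_sum]
  refine Finset.sum_congr rfl fun k _ => ?_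
  rw [gaussMoment, h2]
  push_cast
  field_simp

/-- The asymptotic expansion of the integral over the vertical line through the saddle point. -/
theorem exists_expansion_bound {φ : ℂ → ℂ} {s₀ κ : ℝ} {a : ℕ → ℝ} (h1 : a 1 = 0) (h2 : 0 < a 2)
    (hφ : HasSeries φ s₀ (PowerSeries.mk fun m => (a m : ℂ))) {q : ℂ → ℂ}
    (hq : HasSeries q 0 (PowerSeries.mk (pCoeff s₀ (fCoeff a))))
    (hqφ : ∀ᶠ u : ℝ in 𝓝 0, φ (q u) = φ s₀ - (u : ℂ) ^ 2) (hs : s₀ ≠ 0) (hκ : 0 < κ)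
    (hcont : Continuous fun ω : ℝ => φ (s₀ + ω * Complex.I))
    (hdecay : ∀ ω : ℝ, (φ (s₀ + ω * Complex.I)).re ≤
      (φ s₀).re - 1 / 2 * Real.log (1 + κ * ω ^ 2)) (N : ℕ) :
    ∃ C : ℝ, ∀ᶠ n : ℕ in atTop,
      ‖1 / (2 * Real.pi) * (∫ ω : ℝ, Complex.exp ((n : ℂ) / 2 * φ (s₀ + ω * Complex.I)) /
          (s₀ + ω * Complex.I)) -
        expansionSum n (φ s₀) (cCoeff s₀ (pCoeff s₀ (fCoeff a))) Complex.I N‖ ≤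
        C * expansionError n (φ s₀) N := by
  set c := cCoeff s₀ (pCoeff s₀ (fCoeff a)) with hc
  have hser := (logDerivSeries_of_path (p := fun u => q u) hs h2 hq (Eventually.of_forall fun _ => rfl)).2
  obtain ⟨R, hR, hRe⟩ := hser.exists_remainder (2 * N)
  have hcr : Tendsto (fun u : ℝ => (u : ℂ)) (𝓝 0) (𝓝 0) := by
    simpa using Complex.continuous_ofReal.tendsto 0
  have hRb : ∀ᶠ z in 𝓝 (0 : ℂ), ‖R z‖ < ‖R 0‖ + 1 :=
    hR.continuousAt.norm.eventually (gt_mem_nhds (lt_add_one _))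
  -- The analytic remainder is bounded near `0`, which is the hypothesis of `watson`.
  have hQ : ∀ᶠ u : ℝ in 𝓝 0, φ (q u) = φ s₀ - (u : ℂ) ^ 2 ∧
      ‖deriv q u / q u - ∑ m ∈ Finset.range (2 * N), c m * (u : ℂ) ^ m‖ ≤
        (‖R 0‖ + 1) * u ^ (2 * N) := by
    filter_upwards [hqφ, hcr.eventually (hRe.and hRb)] with u hu1 ⟨hu2, hu3⟩
    refine ⟨hu1, ?_⟩
    simp only [PowerSeries.coeff_mk, sub_zero] at hu2
    rw [hu2, add_sub_cancel_left, norm_mul, norm_pow, Complex.norm_real, Real.norm_eq_abs,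
      (even_two_mul N).pow_abs, mul_comm]
    exact mul_le_mul_of_nonneg_right hu3.le ((even_two_mul N).pow_nonneg u)
  obtain ⟨δ, ε, κ', C₂, hδ, hε, hκ', hC₂, hqu, hlocal⟩ := exists_local_bound h1 h2 hφ hq hs hQ
  obtain ⟨C₁, θ₁, hC₁, hθ₁, hθ₁', htail⟩ := exists_tail_bound hκ hcont hdecay hs hδ
  have hcc : ContinuousOn (fun u : ℝ => deriv q u / q u) (Set.Icc (-ε) ε) := fun u hu => by
    obtain ⟨-, hau, hu0⟩ := hqu u hu
    have hof : ContinuousAt (fun u : ℝ => (u : ℂ)) u := Complex.continuous_ofReal.continuousAt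
    exact ((hau.deriv.div hau hu0).continuousAt.comp (f := fun u : ℝ => (u : ℂ))
      hof).continuousWithinAt
  obtain ⟨C₃, hwatson⟩ := watson hε N hcc fun u hu => (hqu u hu).1.2
  set D : ℝ := Real.sqrt (2 * Real.pi) * ((2 * N).factorial / (N.factorial * 2 ^ N)) with hD
  have hθ₂ : Real.exp (-(κ' / 2)) < 1 := by
    rw [Real.exp_lt_one_iff]; linarith
  refine ⟨C₁ + C₂ + C₃ * D, ?_⟩
  filter_upwards [exists_pow_le hθ₁ hθ₁' N, exists_pow_le (Real.exp_pos _).le hθ₂ N,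
    eventually_ge_atTop 4] with n hn1 hn2 hn4
  have hn0 : (0 : ℝ) < n := by
    have : 0 < n := by omega
    exact_mod_cast this
  have ht := htail n hn4
  have hl := hlocal n
  have hw := hwatson n hn0
  rw [gaussMoment_eq hn0 N] at hw
  rw [expansionSum_eq (by omega), expansionError]
  set E : ℝ := Real.exp ((n : ℝ) / 2 * (φ s₀).re) with hE
  set X : ℝ := Real.sqrt n * (n : ℝ) ^ N with hX
  set S := ∑ k ∈ Finset.range N, c (2 * k) * (gaussMoment n k : ℂ) with hS
  set W := ∫ u in (-ε)..ε, (Real.exp (-((n : ℝ) / 2) * u ^ 2) : ℂ) * (deriv q u / q u) with hW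
  set J := ∫ ω : ℝ, Complex.exp ((n : ℂ) / 2 * φ (s₀ + ω * Complex.I)) / (s₀ + ω * Complex.I) with hJ
  set J₁ := ∫ ω in (-δ)..δ, Complex.exp ((n : ℂ) / 2 * φ (s₀ + ω * Complex.I)) /
    (s₀ + ω * Complex.I) with hJ₁
  set e := Complex.exp ((n : ℂ) / 2 * φ s₀) with he
  -- Along the local path `φ (q u) = φ s₀ - u²`, so the exponential becomes a constant times a
  -- Gaussian weight.
  have hpath : ∫ u in (-ε)..ε, deriv q u * (Complex.exp ((n : ℂ) / 2 * φ (q u)) / q u) = e * W := by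
    rw [hW, ← intervalIntegral.integral_const_mul]
    refine intervalIntegral.integral_congr fun u hu => ?_
    rw [Set.uIcc_of_le (by linarith)] at hu
    rw [(hqu u hu).1.1, mul_sub, Complex.exp_sub, he, div_eq_mul_inv (Complex.exp _),
      ← Complex.exp_neg]
    push_cast
    rw [show -((n : ℂ) / 2 * (u : ℂ) ^ 2) = -((n : ℂ) / 2) * (u : ℂ) ^ 2 by ring]
    ring
  rw [hpath, intervalIntegral.integral_const_mul] at hl
  have hE0 : 0 < E := Real.exp_pos _
  have hX0 : 0 < X := by have := Real.sqrt_pos.2 hn0; positivity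
  have hexp : Real.exp ((n : ℝ) / 2 * ((φ s₀).re - κ')) = E * Real.exp (-(κ' / 2)) ^ n := by
    rw [← Real.exp_nat_mul, hE, ← Real.exp_add]
    congr 1
    ring
  have hen : ‖e‖ = E := by
    rw [he, Complex.norm_exp, hE]
    congr 1
    rw [← Complex.re_ofReal_mul]
    push_cast
    rfl
  -- The three errors are the tails of the line, the change of contour and the Taylor remainder. The
  -- factors `I` come from `ds = i dω`.
  have hsplit : 1 / (2 * Real.pi) * J - 1 / (2 * Real.pi) * (e * S / Complex.I) =
      1 / (2 * Real.pi) * ((J - J₁) + -Complex.I * (Complex.I * J₁ - e * W) +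
        -Complex.I * (e * (W - S))) := by
    rw [Complex.div_I]
    linear_combination (1 / (2 * Real.pi) * J₁) * Complex.I_sq
  have hpi : ‖(1 / (2 * Real.pi) : ℂ)‖ ≤ 1 := by
    rw [norm_div, norm_one, norm_mul, Complex.norm_two, Complex.norm_real,
      Real.norm_of_nonneg Real.pi_pos.le]
    rw [div_le_one (by have := Real.pi_pos; positivity)]
    linarith [Real.pi_gt_three]
  rw [hsplit, norm_mul]
  refine (mul_le_of_le_one_left (norm_nonneg _) hpi).trans ?_
  refine (norm_add₃_le ..).trans ?_
  rw [norm_mul, norm_mul, norm_neg, Complex.norm_I, one_mul, one_mul, norm_mul, hen]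
  rw [hexp] at hl
  have b1 : C₁ * (E * θ₁ ^ n) ≤ C₁ * (E * (1 / X)) := by gcongr
  have b2 : C₂ * (E * Real.exp (-(κ' / 2)) ^ n) ≤ C₂ * (E * (1 / X)) := by gcongr
  have b3 : E * ‖W - S‖ ≤ E * (C₃ * (D / X)) := by gcongr
  calc ‖J - J₁‖ + ‖Complex.I * J₁ - e * W‖ + E * ‖W - S‖
      ≤ C₁ * (E * (1 / X)) + C₂ * (E * (1 / X)) + E * (C₃ * (D / X)) :=
        add_le_add (add_le_add (ht.trans b1) (hl.trans b2)) b3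
    _ = (C₁ + C₂ + C₃ * D) * (E / X) := by ring

/-! ### The error probabilities as integrals over a vertical line -/

section Main

variable {K d : ℕ} {P σ Ω : Fin K → ℝ} {lam : ℝ}

theorem line_mem_regionAlpha (hΩ : ∀ k, 0 < Ω k) {γ : ℝ} (hγ : γ ∈ realRegion Ω) (ω : ℝ) :
    (γ + ω * Complex.I : ℂ) ∈ regionAlpha Ω := by
  rw [mem_regionAlpha_iff hΩ]
  exact fun k => by simpa using hγ k

theorem continuous_alpha_line (hΩ : ∀ k, 0 < Ω k) {γ : ℝ} (hγ : γ ∈ realRegion Ω) :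
    Continuous fun ω : ℝ => alpha Ω lam (γ + ω * Complex.I) := by
  refine continuous_iff_continuousAt.2 fun ω => ?_
  have h := (hasDerivAt_alpha (lam := lam) (slitPlane_of_mem_region hΩ
    (line_mem_regionAlpha hΩ hγ ω))).continuousAt
  exact h.comp (f := fun ω : ℝ => (γ + ω * Complex.I : ℂ)) (by fun_prop)

theorem beta_line {sα sβ : ℝ} (hβ : sβ = sα - 1 / 2) (ω : ℝ) :
    beta Ω lam (sβ + ω * Complex.I) = alpha Ω lam (sα + ω * Complex.I) +
      ((2 * Real.log 2 * capacity Ω + 1 - lam : ℝ) : ℂ) := by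
  rw [beta_eq, hβ]
  congr 2
  push_cast
  ring

theorem exists_re_beta_le (hK : 0 < K) (hΩ : ∀ k, 0 < Ω k) {sα sβ : ℝ} (hs : sα ∈ realRegion Ω)
    (hβ : sβ = sα - 1 / 2) :
    ∃ κ : ℝ, 0 < κ ∧ ∀ ω : ℝ, (beta Ω lam (sβ + ω * Complex.I)).re ≤
      (beta Ω lam sβ).re - 1 / 2 * Real.log (1 + κ * ω ^ 2) := by
  obtain ⟨κ, hκ, h⟩ := exists_re_alpha_le (lam := lam) hK hΩ hs
  refine ⟨κ, hκ, fun ω => ?_⟩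
  have h0 := beta_line (Ω := Ω) (lam := lam) hβ 0
  simp only [Complex.ofReal_zero, zero_mul, add_zero] at h0
  rw [beta_line hβ, h0, Complex.add_re, Complex.add_re]
  linarith [h ω]

theorem probFA_eq (hK : 0 < K) (hd : 0 < d) (hΩ : ∀ k, 0 < Ω k) (hσ : ∀ k, 0 < σ k)
    (hsnr : Ω = snr P σ) (hlam : 0 < lam) {γ : ℝ} (hγ : γ ∈ realRegion Ω) (hγ0 : γ ≠ 0)
    {x : Fin K → Fin d → ℝ} (hx : x ∈ codewordSet P d) (hint : Integrable fun ω : ℝ =>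
      Complex.exp (((K * d : ℕ) : ℂ) / 2 * alpha Ω lam (γ + ω * Complex.I)) /
        (γ + ω * Complex.I)) :
    (probFA P σ x (threshold Ω lam) : ℂ) = unitStep (-γ) + 1 / (2 * Real.pi) *
      ∫ ω : ℝ, Complex.exp (((K * d : ℕ) : ℂ) / 2 * alpha Ω lam (γ + ω * Complex.I)) /
        (γ + ω * Complex.I) := by
  have hn : (0 : ℝ) < ((K * d : ℕ) : ℝ) := by exact_mod_cast Nat.mul_pos hK hd
  have hset : {b | threshold Ω lam ≤ logLikelihood P σ x b} =
      {b | testStatistic Ω σ x b ≤ ((K * d : ℕ) : ℝ) * lam} :=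
    Set.ext fun b => threshold_le_iff hK hd hΩ hσ hsnr hx b
  have h0 : (0 : ℂ) ∈ regionAlpha Ω := by rw [mem_regionAlpha_iff hΩ]; simp
  have hone := integral_outputDensity (lam := lam) hK hΩ hσ hsnr hx h0
  rw [alpha_zero, mul_zero, sub_zero, mul_zero, Complex.exp_zero] at hone
  have key := prob_eq_of_density (n := ((K * d : ℕ) : ℝ)) (lam := lam) (φ := alpha Ω lam)
    (fun b => (outputDensity_pos (P := P) (by rwa [← hsnr]) hσ b).le) measurable_outputDensity
    (measurable_testStatistic (Ω := Ω) (σ := σ) x) hγ0 hone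
    (fun ω => by
      rw [Complex.ofReal_natCast]
      exact integral_outputDensity hK hΩ hσ hsnr hx (line_mem_regionAlpha hΩ hγ ω))
    (volume_testStatistic_eq hΩ hσ x (mul_pos hn hlam))
    (by rw [Complex.ofReal_natCast]; exact hint)
  rw [Complex.ofReal_natCast] at key
  rw [probFA, hset, key.2]

theorem probMD_eq (hK : 0 < K) (hd : 0 < d) (hΩ : ∀ k, 0 < Ω k) (hσ : ∀ k, 0 < σ k)
    (hsnr : Ω = snr P σ) (hlam : 0 < lam) {γ : ℝ}
    (hγ : ∀ ω : ℝ, (γ + ω * Complex.I : ℂ) ∈ regionBeta Ω) (hγ0 : γ ≠ 0)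
    {x : Fin K → Fin d → ℝ} (hx : x ∈ codewordSet P d) (hint : Integrable fun ω : ℝ =>
      Complex.exp (((K * d : ℕ) : ℂ) / 2 * beta Ω lam (γ + ω * Complex.I)) /
        (γ + ω * Complex.I)) :
    (probMD P σ x (threshold Ω lam) : ℂ) = unitStep γ - 1 / (2 * Real.pi) *
      ∫ ω : ℝ, Complex.exp (((K * d : ℕ) : ℂ) / 2 * beta Ω lam (γ + ω * Complex.I)) /
        (γ + ω * Complex.I) := by
  have hn : (0 : ℝ) < ((K * d : ℕ) : ℝ) := by exact_mod_cast Nat.mul_pos hK hd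
  have hset : {b | logLikelihood P σ x b < threshold Ω lam} =
      {b | testStatistic Ω σ x b ≤ ((K * d : ℕ) : ℝ) * lam}ᶜ :=
    Set.ext fun b => by
      have := threshold_le_iff (lam := lam) hK hd hΩ hσ hsnr hx b
      rw [Set.mem_compl_iff, Set.mem_ofPred_eq, Set.mem_ofPred_eq, ← this, not_le]
  have h0 : (0 : ℂ) ∈ regionBeta Ω := by
    change (0 : ℂ) + 1 / 2 ∈ regionAlpha Ω
    rw [mem_regionAlpha_iff hΩ]
    intro k
    have := hΩ k
    norm_num
    positivity
  have hone := integral_transitionDensity (lam := lam) hK hΩ hσ hsnr hx h0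
  rw [beta_zero hK hΩ, mul_zero, sub_zero, mul_zero, Complex.exp_zero] at hone
  obtain ⟨hprob, key⟩ := prob_eq_of_density (n := ((K * d : ℕ) : ℝ)) (lam := lam) (φ := beta Ω lam)
    (fun b => by
      rw [transitionDensity_eq hK hΩ hσ hsnr hx]
      have := outputDensity_pos (P := P) (by rwa [← hsnr]) hσ b
      positivity) (measurable_transitionDensity x)
    (measurable_testStatistic (Ω := Ω) (σ := σ) x) hγ0 hone
    (fun ω => by
      rw [Complex.ofReal_natCast]
      exact integral_transitionDensity hK hΩ hσ hsnr hx (hγ ω))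
    (volume_testStatistic_eq hΩ hσ x (mul_pos hn hlam))
    (by rw [Complex.ofReal_natCast]; exact hint)
  rw [Complex.ofReal_natCast] at key
  -- Passing to the complement reverses the step and the sign of the integral; both unit steps
  -- vanish at `0`, so `γ ≠ 0` matters here.
  have hstep : unitStep (-γ) = 1 - unitStep γ := by
    unfold unitStep
    rcases lt_or_gt_of_ne hγ0 with h | h
    · rw [if_pos (by linarith), if_neg (by linarith)]; norm_num
    · rw [if_neg (by linarith), if_pos h]; norm_num
  rw [probMD, hset, probReal_compl_eq_one_sub
    (measurableSet_le (measurable_testStatistic x) measurable_const), Complex.ofReal_sub, key, hstep]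
  push_cast
  ring

theorem expansionSum_neg (n : ℕ) (φ₀ : ℂ) (c : ℕ → ℂ) (ι : ℂ) (N : ℕ) :
    expansionSum n φ₀ c (-ι) N = -expansionSum n φ₀ c ι N := by
  simp only [expansionSum, div_neg, mul_neg, Finset.sum_neg_distrib]

theorem tendsto_mul_atTop (hK : 0 < K) : Tendsto (fun d : ℕ => K * d) atTop atTop :=
  tendsto_id.const_mul_atTop' hK

/-- The line integral depends on the block length but not on the codeword, so one constant serves
all codewords. -/
theorem exists_bound_probFA (hK : 0 < K) (hΩ : ∀ k, 0 < Ω k) (hσ : ∀ k, 0 < σ k)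
    (hsnr : Ω = snr P σ) (hlam : 0 < lam) {sα : ℝ} (hs : sα ∈ realRegion Ω)
    (h0 : alphaDerivReal Ω lam sα = 0) {p : ℝ → ℂ} (hp : IsSteepestDescentPath Ω lam sα p)
    (hsα : sα ≠ 0) (N : ℕ) : ∃ C : ℝ, ∀ᶠ d : ℕ in atTop, ∀ x ∈ codewordSet P d,
      ‖(probFA P σ x (threshold Ω lam) : ℂ) - (unitStep (-sα) +
        expansionSum (K * d) (alpha Ω lam sα)
          (cCoeff sα (pCoeff sα (fCoeff (aCoeff Ω lam sα)))) Complex.I N)‖ ≤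
        C * expansionError (K * d) (alpha Ω lam sα) N := by
  obtain ⟨-, q, hq, hpq⟩ := pathSeries_alpha hK hΩ hlam hs h0 hp
  obtain ⟨κ, hκ, hdecay⟩ := exists_re_alpha_le (lam := lam) hK hΩ hs
  have hcont := continuous_alpha_line (lam := lam) hΩ hs
  have hqφ : ∀ᶠ u : ℝ in 𝓝 0, alpha Ω lam (q u) = alpha Ω lam sα - (u : ℂ) ^ 2 := by
    filter_upwards [hpq] with u hu
    rw [← hu, alpha_path hs hp]
  have h2 : 0 < aCoeff Ω lam sα 2 := by simpa using aCoeff_sign (lam := lam) hK hΩ hs 2 le_rfl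
  obtain ⟨C, hC⟩ := exists_expansion_bound rfl h2 (hasSeries_alpha hΩ hs h0) hq hqφ hsα hκ hcont
    hdecay N
  refine ⟨C, ?_⟩
  -- The condition `4 ≤ K * d` is what integrability on the line requires.
  filter_upwards [(tendsto_mul_atTop hK).eventually (hC.and (eventually_ge_atTop 4)),
    eventually_gt_atTop 0] with d ⟨hd, hd4⟩ hd0 x hx
  rw [probFA_eq hK hd0 hΩ hσ hsnr hlam hs hsα hx
    (integrable_line hκ hcont hdecay hsα (K * d) hd4), add_sub_add_left_eq_sub]
  exact hd

theorem exists_bound_probMD (hK : 0 < K) (hΩ : ∀ k, 0 < Ω k) (hσ : ∀ k, 0 < σ k)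
    (hsnr : Ω = snr P σ) (hlam : 0 < lam) {sα sβ : ℝ} (hs : sα ∈ realRegion Ω)
    (h0 : alphaDerivReal Ω lam sα = 0) {p : ℝ → ℂ} (hp : IsSteepestDescentPath Ω lam sα p)
    (hβ : sβ = sα - 1 / 2) (hsβ : sβ ≠ 0) (N : ℕ) :
    ∃ C : ℝ, ∀ᶠ d : ℕ in atTop, ∀ x ∈ codewordSet P d,
      ‖(probMD P σ x (threshold Ω lam) : ℂ) - (unitStep sβ +
        expansionSum (K * d) (beta Ω lam sβ)
          (cCoeff sβ (pCoeff sβ (fCoeff (bCoeff Ω lam sα sβ)))) (-Complex.I) N)‖ ≤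
        C * expansionError (K * d) (beta Ω lam sβ) N := by
  have hc : (sβ : ℂ) + 1 / 2 = sα := by rw [hβ]; push_cast; ring
  obtain ⟨-, q, hq, hpq⟩ := pathSeries_beta hK hΩ hlam hs h0 hp hβ (fun _ => rfl)
  obtain ⟨κ, hκ, hdecay⟩ := exists_re_beta_le (lam := lam) hK hΩ hs hβ
  have hcont : Continuous fun ω : ℝ => beta Ω lam (sβ + ω * Complex.I) := by
    simp only [beta_line hβ]
    exact (continuous_alpha_line hΩ hs).add continuous_const
  have hqφ : ∀ᶠ u : ℝ in 𝓝 0, beta Ω lam (q u) = beta Ω lam sβ - (u : ℂ) ^ 2 := by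
    filter_upwards [hpq] with u hu
    rw [← hu, beta_eq, beta_eq, sub_add_cancel, alpha_path hs hp, hc]
    ring
  have h2 : 0 < bCoeff Ω lam sα sβ 2 := by
    simpa using bCoeff_sign (lam := lam) (sβ := sβ) hK hΩ hs 2 le_rfl
  obtain ⟨C, hC⟩ := exists_expansion_bound rfl h2 (hasSeries_beta hΩ hs h0 hβ) hq hqφ hsβ hκ hcont
    hdecay N
  have hmem : ∀ ω : ℝ, (sβ + ω * Complex.I : ℂ) ∈ regionBeta Ω := fun ω => by
    change (sβ + ω * Complex.I + 1 / 2 : ℂ) ∈ regionAlpha Ω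
    rw [add_right_comm, hc]
    exact line_mem_regionAlpha hΩ hs ω
  refine ⟨C, ?_⟩
  filter_upwards [(tendsto_mul_atTop hK).eventually (hC.and (eventually_ge_atTop 4)),
    eventually_gt_atTop 0] with d ⟨hd, hd4⟩ hd0 x hx
  rw [probMD_eq hK hd0 hΩ hσ hsnr hlam hmem hsβ hx
    (integrable_line hκ hcont hdecay hsβ (K * d) hd4), expansionSum_neg, ← norm_neg]
  refine le_of_eq_of_le (congrArg _ ?_) hd
  ring

end Main

end ParallelAWGN

end

/-! ### Assembly of the theorem -/

open ParallelAWGN in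
theorem mainTheorem6 (K : ℕ) (hK : 0 < K) (P σ : Fin K → ℝ) (hP : ∀ k, 0 < P k)
    (hσ : ∀ k, 0 < σ k) (Ω : Fin K → ℝ) (hΩ : Ω = snr P σ) (lam : ℝ) (hlam : 0 < lam) :
    (∃! s : ℝ, IsSaddlePoint (alpha Ω lam) (regionAlpha Ω) s) ∧
    (∃! s : ℝ, IsSaddlePoint (beta Ω lam) (regionBeta Ω) s) ∧
    ∀ sα sβ : ℝ, IsSaddlePoint (alpha Ω lam) (regionAlpha Ω) sα →
      IsSaddlePoint (beta Ω lam) (regionBeta Ω) sβ →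
      sβ = sα - 1 / 2 ∧
      (∃! p : ℝ → ℂ, IsSteepestDescentPath Ω lam sα p) ∧
      ∀ pα pβ : ℝ → ℂ, IsSteepestDescentPath Ω lam sα pα → (∀ u, pβ u = pα u - 1 / 2) →
      ∀ a b : ℕ → ℝ, a = aCoeff Ω lam sα → b = bCoeff Ω lam sα sβ →
      ∀ cα cβ : ℕ → ℂ, cα = cCoeff sα (pCoeff sα (fCoeff a)) →
        cβ = cCoeff sβ (pCoeff sβ (fCoeff b)) →
        PathSeries (alpha Ω lam) sα a pα ∧
        PathSeries (beta Ω lam) sβ b pβ ∧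
        (sα ≠ 0 →
          LogDerivSeries pα cα ∧
          ∀ N : ℕ, ∃ C : ℝ, ∀ᶠ d : ℕ in Filter.atTop, ∀ x ∈ codewordSet P d,
            ‖(probFA P σ x (threshold Ω lam) : ℂ) - (unitStep (-sα) +
                expansionSum (K * d) (alpha Ω lam sα) cα Complex.I N)‖ ≤
              C * expansionError (K * d) (alpha Ω lam sα) N) ∧
        (sβ ≠ 0 →
          LogDerivSeries pβ cβ ∧
          ∀ N : ℕ, ∃ C : ℝ, ∀ᶠ d : ℕ in Filter.atTop, ∀ x ∈ codewordSet P d,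
            ‖(probMD P σ x (threshold Ω lam) : ℂ) - (unitStep sβ +
                expansionSum (K * d) (beta Ω lam sβ) cβ (-Complex.I) N)‖ ≤
              C * expansionError (K * d) (beta Ω lam sβ) N) := by
  have hΩ0 : ∀ k, 0 < Ω k := fun k => by
    rw [hΩ, snr]
    exact div_pos (hP k) (pow_pos (hσ k) 2)
  have hα := existsUnique_saddle_alpha hK hΩ0 hlam
  refine ⟨hα, existsUnique_saddle_beta hK hΩ0 hlam, fun sα sβ hsα hsβ => ?_⟩
  have hβ : sβ = sα - 1 / 2 := by
    rw [hα.unique hsα (isSaddlePoint_beta_iff.1 hsβ)]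
    ring
  obtain ⟨hs, h0⟩ := (isSaddlePoint_alpha_iff hΩ0).1 hsα
  refine ⟨hβ, existsUnique_path hK hΩ0 hlam hs h0, ?_⟩
  rintro pα pβ hp hpβ a b rfl rfl cα cβ rfl rfl
  obtain ⟨hPα, qα, hqα, hpqα⟩ := pathSeries_alpha hK hΩ0 hlam hs h0 hp
  obtain ⟨hPβ, qβ, hqβ, hpqβ⟩ := pathSeries_beta hK hΩ0 hlam hs h0 hp hβ hpβ
  have h2α : 0 < aCoeff Ω lam sα 2 := by simpa using aCoeff_sign (lam := lam) hK hΩ0 hs 2 le_rfl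
  -- Both exponents have the same second coefficient by definition.
  have h2β : 0 < bCoeff Ω lam sα sβ 2 := h2α
  exact ⟨hPα, hPβ,
    fun h => ⟨(logDerivSeries_of_path h h2α hqα hpqα).1,
      exists_bound_probFA hK hΩ0 hσ hΩ hlam hs h0 hp h⟩,
    fun h => ⟨(logDerivSeries_of_path h h2β hqβ hpqβ).1,
      exists_bound_probMD hK hΩ0 hσ hΩ hlam hs h0 hp hβ h⟩⟩
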